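/- Let $N\ge 1$, let $m_i\in(0,\infty)$ and $a_i,b_i\in[0,\infty)$ for $1\le i\le N$. Consider the continuous-time Markov chain $X(t)=(X_1(t),\dots,X_N(t))$ on $\mathbb X_N=\{x\in\mathbb Z^N: x_1\le\cdots\le x_N\}$ in which, from a configuration $x$, the coordinate $x_i$ jumps to $x_i-1$ at rate $A_i(x)$ and to $x_i+1$ at rate $B_i(x)$, where $$A_i(x)=\mathbf 1\{x_{i-1}<x_i\}\sum_{j=i}^N\frac{m_ja_j}{m_i}\mathbf 1\{x_j=x_i\},\qquad B_i(x)=\mathbf 1\{x_{i+1}>x_i\}\sum_{j=1}^i\frac{m_jb_j}{m_i}\mathbf 1\{x_j=x_i\},$$ with the conventions $x_0=-\infty$ and $x_{N+1}=+\infty$. Let $\eta(t)=(X_{i+1}(t)-X_i(t))_{1\le i\le N-1}\in\mathbb Z_+^{N-1}$ be the Markov chain of inter-particle distances, and put $U_k=-\sum_{i=1}^k m_i(b_i-a_i)$ and $M_k=\sum_{i=1}^k m_i$. Call a state $d$ of $\eta$ positive recurrent if it is absorbing or if the mean return time to $d$ is finite, and call the chain $\eta$ positive recurrent if it has a positive recurrent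 state that is reached almost surely from every initial state (for an irreducible chain this is the usual notion; since some of the $a_i,b_i$ may vanish, $\eta$ may have transient states in addition to its recurrent class). Then $\eta$ is positive recurrent if and only if $$\frac{U_k}{M_k}<\frac{U_N}{M_N}\quad\text{for all } 1\le k\le N-1.$$ Moreover, if $\eta$ is positive recurrent, then it has a unique stationary distribution $\pi$; it is geometrically ergodic, i.e. there is $\rho>0$ such that for every initial configuration $x$ there is $C_x<\infty$ with $$\sup_{B\subseteq\mathbb Z_+^{N-1}}\bigl|\mathbb P_x(\eta(t)\in B)-\pi(B)\bigr|\le C_x e^{-\rho t}\quad\text{for all } t\ge 0;$$ and $\pi$ has a finite exponential moment: there is $\delta>0$ with $\sum_{d\in\mathbb Z_+^{N-1}}\pi(d)\,e^{\delta(d_1+\cdots+d_{N-1})}<\infty$. -/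

import Mathlib

open MeasureTheory ProbabilityTheory
open scoped NNReal ENNReal

noncomputable section

namespace ElasticParticles

/-! The system has `N = n + 1` particles, labelled by `Fin (n + 1)`; particle `i` has mass `m i`
and intrinsic jump rates `a i` (to the left) and `b i` (to the right). -/

/-- Ordered configurations `x₁ ≤ ⋯ ≤ x_N` of integers. -/
abbrev Config (n : ℕ) : Type := {x : Fin (n + 1) → ℤ // Monotone x}

/-- Vectors of inter-particle distances: `ℤ₊^(N-1)`. -/
abbrev Gaps (n : ℕ) : Type := Fin n → ℕ

/-- The vector of inter-particle distances of a configuration; the differences are nonnegative,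
so `Int.toNat` does not truncate. -/
def gaps {n : ℕ} (x : Config n) : Gaps n :=
  fun i => (x.1 i.succ - x.1 i.castSucc).toNat

section Rates

variable {n : ℕ} (m a b : Fin (n + 1) → ℝ≥0)

open Classical in
/-- Rate at which particle `i` jumps one step to the left: zero unless `i` is the smallest label at
its site, and then `∑ m_j a_j / m_i` over the particles `j` at that site. -/
def leftRate (i : Fin (n + 1)) (x : Config n) : ℝ≥0 :=
  if ∀ j : Fin (n + 1), (j : ℕ) + 1 = i → x.1 j < x.1 i then
    ∑ j : Fin (n + 1), if i ≤ j ∧ x.1 j = x.1 i then m j * a j / m i else 0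
  else 0

open Classical in
/-- Rate at which particle `i` jumps one step to the right: zero unless `i` is the largest label at
its site, and then `∑ m_j b_j / m_i` over the particles `j` at that site. -/
def rightRate (i : Fin (n + 1)) (x : Config n) : ℝ≥0 :=
  if ∀ j : Fin (n + 1), (i : ℕ) + 1 = j → x.1 i < x.1 j then
    ∑ j : Fin (n + 1), if j ≤ i ∧ x.1 j = x.1 i then m j * b j / m i else 0
  else 0

/-- Total jump rate of the configuration `x`. -/
def totalRate (x : Config n) : ℝ≥0 :=
  ∑ i : Fin (n + 1), (leftRate m a i x + rightRate m b i x)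

open Classical in
/-- Move particle `i` by `s`. The move is only used with `s = ±1` and with a positive rate when the
result is ordered; the fallback value is never charged. -/
def move (i : Fin (n + 1)) (s : ℤ) (x : Config n) : Config n :=
  if h : Monotone (x.1 + Pi.single i s) then ⟨x.1 + Pi.single i s, h⟩ else x

open Classical in
/-- Law of the configuration after the next jump from `x`. If no jump is possible (total rate `0`),
the configuration stays at `x` for ever. -/
def jumpLaw (x : Config n) : Measure (Config n) :=
  if totalRate m a b x = 0 then Measure.dirac x
  else ∑ i : Fin (n + 1),
    ((leftRate m a i x / totalRate m a b x) • Measure.dirac (move i (-1) x) +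
      (rightRate m b i x / totalRate m a b x) • Measure.dirac (move i 1 x))

/-- Parameter of the exponential holding time at `x`. At a configuration with total rate `0` the
chain renews itself at the same place, so any positive value describes the same process. -/
def holdRate (x : Config n) : ℝ :=
  if totalRate m a b x = 0 then 1 else totalRate m a b x

/-- Law of the pair (`x`, holding time at `x`). -/
def enterLaw (x : Config n) : Measure (Config n × ℝ) :=
  (Measure.dirac x).prod (expMeasure (holdRate m a b x))

theorem holdRate_pos (x : Config n) : 0 < holdRate m a b x := by
  unfold holdRate
  split_ifs with h
  · exact one_pos
  · exact_mod_cast pos_iff_ne_zero.mpr h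

instance isProbabilityMeasure_enterLaw (x : Config n) :
    IsProbabilityMeasure (enterLaw m a b x) := by
  have := isProbabilityMeasure_expMeasure (holdRate_pos m a b x)
  unfold enterLaw
  infer_instance

instance isProbabilityMeasure_jumpLaw (x : Config n) :
    IsProbabilityMeasure (jumpLaw m a b x) := by
  unfold jumpLaw
  split_ifs with h
  · infer_instance
  · constructor
    simp only [Measure.coe_finsetSum, Finset.sum_apply, Measure.coe_add, Pi.add_apply,
      Measure.smul_apply, measure_univ]
    have h1 : ∑ i : Fin (n + 1), (leftRate m a i x / totalRate m a b x +
        rightRate m b i x / totalRate m a b x) = 1 := by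
      simp_rw [← add_div]
      rw [← Finset.sum_div]
      exact div_self h
    simp only [ENNReal.smul_def, smul_eq_mul, mul_one]
    exact_mod_cast h1

/-- Transition kernel of the sequence (visited configuration, time spent there): jump, then draw
the holding time at the new configuration. -/
def stepKernel : Kernel (Config n × ℝ) (Config n × ℝ) :=
  ((Kernel.ofFunOfCountable (enterLaw m a b)) ∘ₖ
    (Kernel.ofFunOfCountable (jumpLaw m a b))).comap Prod.fst measurable_fst

instance isMarkovKernel_stepKernel : IsMarkovKernel (stepKernel m a b) := by
  have h1 : IsMarkovKernel (Kernel.ofFunOfCountable (enterLaw m a b)) :=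
    ⟨fun x => isProbabilityMeasure_enterLaw m a b x⟩
  have h2 : IsMarkovKernel (Kernel.ofFunOfCountable (jumpLaw m a b)) :=
    ⟨fun x => isProbabilityMeasure_jumpLaw m a b x⟩
  unfold stepKernel
  infer_instance

/-- Sequences of visited configurations with the times spent there. -/
abbrev Path (n : ℕ) : Type := ℕ → Config n × ℝ

/-- The one-step kernel, seen as depending on the whole past (through its last entry). -/
def pastKernel (k : ℕ) :
    Kernel ((i : Finset.Iic k) → (fun _ : ℕ => Config n × ℝ) i) (Config n × ℝ) :=
  (stepKernel m a b).comap (fun h => h ⟨k, Finset.mem_Iic.mpr le_rfl⟩) (measurable_pi_apply _)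

instance isMarkovKernel_pastKernel (k : ℕ) : IsMarkovKernel (pastKernel m a b k) := by
  unfold pastKernel
  infer_instance

/-- The law `ℙ_x` of the particle system started from the configuration `x`, on the space of jump
sequences with holding times. -/
def law (x : Config n) : Measure (Path n) :=
  Kernel.trajMeasure (X := fun _ : ℕ => Config n × ℝ) (enterLaw m a b x) (pastKernel m a b)

end Rates

section Dynamics

variable {n : ℕ}

/-- The configuration `X(t)` at time `t`: the `k`-th visited one, where `k` is the first index for
which the `k`-th holding interval ends after `t`. -/
def X (t : ℝ≥0) (ω : Path n) : Config n :=
  (ω (sInf {k : ℕ | (t : ℝ) < ∑ i ∈ Finset.range (k + 1), (ω i).2})).1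

/-- The process of inter-particle distances. -/
def eta (t : ℝ≥0) (ω : Path n) : Gaps n := gaps (X t ω)

/-- First jump time of `eta` (`∞` if it never jumps). -/
def firstJump (ω : Path n) : ℝ≥0∞ :=
  ⨅ (t : ℝ≥0) (_ : eta t ω ≠ eta 0 ω), (t : ℝ≥0∞)

/-- First time from the first jump of `eta` on at which `eta` is at `d` (`∞` if there is none);
for a chain started at `d` this is the return time to `d`. -/
def returnTime (d : Gaps n) (ω : Path n) : ℝ≥0∞ :=
  ⨅ (t : ℝ≥0) (_ : firstJump ω ≤ t) (_ : eta t ω = d), (t : ℝ≥0∞)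

end Dynamics

section Recurrence

variable {n : ℕ} (m a b : Fin (n + 1) → ℝ≥0)

/-- The state `d` of the chain `eta` is positive recurrent: it is absorbing, or the mean return
time to it is finite. -/
def IsPositiveRecurrentState (d : Gaps n) : Prop :=
  ∀ x : Config n, gaps x = d →
    (∀ᵐ ω ∂(law m a b x), ∀ t : ℝ≥0, eta t ω = d) ∨
      ∫⁻ ω, returnTime d ω ∂(law m a b x) < ∞

/-- The chain `eta` is positive recurrent (in the sense of Harris): there is a positive recurrent
state that is reached almost surely from every initial configuration. For an irreducible chain this
says that all states are positive recurrent. Some of the rates may vanish, so the chain may also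
have transient states, from which it enters its unique recurrent class. -/
def IsPositiveRecurrent : Prop :=
  ∃ d : Gaps n, IsPositiveRecurrentState m a b d ∧
    ∀ x : Config n, ∀ᵐ ω ∂(law m a b x), ∃ t : ℝ≥0, eta t ω = d

/-- `π` is a stationary distribution of `eta`: if `eta 0` has law `π`, then so has every `eta t`. -/
def IsStationary (π : Measure (Gaps n)) : Prop :=
  IsProbabilityMeasure π ∧
    ∀ μ : Measure (Config n), IsProbabilityMeasure μ → μ.map gaps = π →
      ∀ (t : ℝ≥0) (B : Set (Gaps n)), ∫⁻ x, law m a b x {ω | eta t ω ∈ B} ∂μ = π B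

/-- From every initial configuration, the law of `eta t` converges to `π` in total variation,
exponentially fast, at a rate that does not depend on the initial configuration. -/
def ConvergesGeometrically (π : Measure (Gaps n)) : Prop :=
  ∃ ρ : ℝ, 0 < ρ ∧ ∀ x : Config n, ∃ C : ℝ, ∀ (t : ℝ≥0) (B : Set (Gaps n)),
    |(law m a b x).real {ω | eta t ω ∈ B} - π.real B| ≤ C * Real.exp (-ρ * t)

/-- `π` has a finite exponential moment. -/
def HasExponentialMoment (π : Measure (Gaps n)) : Prop :=
  ∃ δ : ℝ, 0 < δ ∧
    ∫⁻ d, ENNReal.ofReal (Real.exp (δ * ∑ i : Fin n, (d i : ℝ))) ∂π < ∞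

/-- `U_k = -∑_{i ≤ k} m_i (b_i - a_i)`, the sum over the first `k` particles. -/
def U (k : ℕ) : ℝ :=
  -∑ i : Fin (n + 1), if (i : ℕ) < k then (m i : ℝ) * ((b i : ℝ) - (a i : ℝ)) else 0

/-- `M_k = ∑_{i ≤ k} m_i`, the mass of the first `k` particles. -/
def M (k : ℕ) : ℝ :=
  ∑ i : Fin (n + 1), if (i : ℕ) < k then (m i : ℝ) else 0

/-- The stability condition `U_k / M_k < U_N / M_N` for `1 ≤ k ≤ N - 1`, where `N = n + 1`. -/
def StabilityCondition : Prop :=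
  ∀ k : ℕ, 1 ≤ k → k ≤ n → U m a b k / M m k < U m a b (n + 1) / M m (n + 1)

end Recurrence

end ElasticParticles

end

/-! A cluster hands the push of all its members to an extreme particle, and the factor `1 / m i`
makes this transfer conserve momentum: `∑ i, m i * leftRate i * u i = ∑ j, m j * a j * u (lead j)`,
where `lead j` is the left-most particle at the site of `j`, and similarly on the right
(`exists_left_lead`, `exists_right_lead`). The drift of suitable functions can therefore be compared
with that of independent particles with velocities `b i - a i`.

Sufficiency. Let `W` be the moment of inertia about the center of mass. Its first-order variation `2
* m i * (x i - center)` depends, apart from the mass, only on the site, so up to a constant the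
drift of `W` is the free one. Abel summation turns it into minus a sum of gaps with coefficients `2
* M_k * (U_N / M_N - U_k / M_k)`, so the stability condition bounds it by `K - c * diameter`
(`exists_inertia_drift`). The diameter is of order `√W`, hence `V = exp (δ * √(1 + W))` has drift at
most `-κ * V + C` (`exists_exp_drift`). Since an end particle pushes inwards, the state of zero gaps
is reachable from everywhere. The chain uniformized at a rate `Λ` above all total rates is lazy, and
Harris' theorem in the form of Hairer and Mattingly applies to it: a weighted oscillation contracts,
which gives geometric convergence, stationary weights, a finite `V`-moment and a bound on mean
hitting times. Averaging over a Poisson number of steps transfers the convergence to continuous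
time.

Link with the paths. Conditioning on the first jump, the law of the gaps at time `t` satisfies a
renewal equation. The semigroup satisfies the same one, and on bounded time intervals the equation
is contractive (`aliveProb_eq_gapProb`). Mean hitting times are compared with Lyapunov functions by
the same first-jump decomposition (`lintegral_law`).

Necessity. If the condition fails at `k`, take `ψ = M_k * (center of mass of all - center of mass of
the first k)`. Its weights per unit of mass increase with the label, so collisions only help and its
drift is at least `U_k - M_k * U_N / M_N ≥ 0`. A submartingale with upward steps bounded by a
constant that starts above its value at `d` avoids `d` for `i` steps with probability at least of
order `1 / i`, which is not summable (`nonpos_of_lintegral_occ_le`). If the mean return time to `d`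
were finite, no jump from `d` could raise `ψ`; the nonnegative drift then forbids lowering it, while
every jump changes it. So no jump from `d` is possible, all rates vanish, and `d` is not reached
from other states. Irreducibility is never needed. -/

noncomputable section

namespace ElasticParticles

/-! ### Markov operators: drift, minorization and geometric ergodicity -/

section MarkovOperator

variable {S : Type*}

/-- Positive operators on real functions that preserve the constant `1`. -/
structure IsMarkovOp (P : Module.End ℝ (S → ℝ)) : Prop where
  nonneg : ∀ f : S → ℝ, 0 ≤ f → 0 ≤ P f
  one : P 1 = 1

namespace IsMarkovOp

variable {P : Module.End ℝ (S → ℝ)}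

theorem mono (hP : IsMarkovOp P) {f g : S → ℝ} (h : f ≤ g) : P f ≤ P g := by
  have := hP.nonneg (g - f) (sub_nonneg.2 h)
  rw [map_sub] at this
  exact sub_nonneg.1 this

theorem const (hP : IsMarkovOp P) (c : ℝ) : P (fun _ => c) = fun _ => c := by
  have h : (fun _ : S => c) = c • (1 : S → ℝ) := by ext; simp
  rw [h, map_smul, hP.one]

theorem pow (hP : IsMarkovOp P) (n : ℕ) : IsMarkovOp (P ^ n) := by
  induction n with
  | zero => exact ⟨fun f hf => by simpa using hf, by simp⟩
  | succ n ih =>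
    refine ⟨fun f hf => ?_, ?_⟩
    · rw [pow_succ, Module.End.mul_apply]
      exact ih.nonneg _ (hP.nonneg _ hf)
    · rw [pow_succ, Module.End.mul_apply, hP.one, ih.one]

theorem abs_apply_le (hP : IsMarkovOp P) {f : S → ℝ} {c : ℝ} (h : ∀ x, |f x| ≤ c) (x : S) :
    |P f x| ≤ c := by
  have h1 : P f ≤ fun _ => c := by
    rw [← hP.const c]; exact hP.mono fun y => (abs_le.1 (h y)).2
  have h2 : (fun _ => -c) ≤ P f := by
    rw [← hP.const (-c)]; exact hP.mono fun y => (abs_le.1 (h y)).1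
  exact abs_le.2 ⟨h2 x, h1 x⟩

theorem affine (hP : IsMarkovOp P) (c β : ℝ) (V : S → ℝ) (x : S) :
    P (fun u => c + β * V u) x = c + β * P V x := by
  have h : (fun u => c + β * V u) = (fun _ => c) + β • V := by ext; simp
  rw [h, map_add, map_smul, hP.const]
  simp

/-- `C / (1 - γ)` is the fixed point of `t ↦ γ * t + C`, so the bound reproduces itself under one
more step. -/
theorem pow_drift (hP : IsMarkovOp P) {V : S → ℝ} {γ C : ℝ} (hγ : 0 ≤ γ) (hγ1 : γ < 1)
    (hC : 0 ≤ C) (hV : ∀ x, P V x ≤ γ * V x + C) (n : ℕ) (x : S) :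
    (P ^ n) V x ≤ γ ^ n * V x + C / (1 - γ) := by
  induction n generalizing x with
  | zero =>
    have : 0 ≤ C / (1 - γ) := div_nonneg hC (by linarith)
    simpa using this
  | succ n ih =>
    rw [pow_succ, Module.End.mul_apply]
    have h1 : (P ^ n) (P V) x ≤ (P ^ n) (fun u => C + γ * V u) x :=
      (hP.pow n).mono (fun u => (hV u).trans_eq (add_comm _ _)) x
    rw [(hP.pow n).affine] at h1
    have h2 : γ * (P ^ n) V x ≤ γ * (γ ^ n * V x + C / (1 - γ)) :=
      mul_le_mul_of_nonneg_left (ih x) hγ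
    have h4 : C / (1 - γ) * (1 - γ) = C := div_mul_cancel₀ _ (by linarith)
    have h5 : γ ^ (n + 1) * V x = γ * (γ ^ n * V x) := by ring
    linarith

/-- One step of the Hairer–Mattingly contraction, for two initial points whose laws have a common
part of mass `ε` at `o` (`ε = 0` is allowed). -/
theorem sub_le_of_common_atom (hP : IsMarkovOp P) {V f : S → ℝ} (hV0 : 0 ≤ V) {o : S}
    {ε β c : ℝ} (hε : 0 ≤ ε) (hε1 : ε < 1) (hβ : 0 ≤ β) (hc : 0 ≤ c)
    (hf : ∀ u v, f u - f v ≤ c * (2 + β * V u + β * V v)) {x y : S}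
    (hx : ∀ g : S → ℝ, 0 ≤ g → ε * g o ≤ P g x) (hy : ∀ g : S → ℝ, 0 ≤ g → ε * g o ≤ P g y) :
    P f x - P f y ≤ c * (2 * (1 - ε) + β * P V x + β * P V y) := by
  -- Removing the common atom `ε δ_o` from the law after one step from `z` leaves a positive
  -- functional of mass `1 - ε`. It is applied in `u` at `x` with `v` frozen, then in `v` at `y`;
  -- the contributions `ε * f o` cancel.
  have key : ∀ z, (∀ g : S → ℝ, 0 ≤ g → ε * g o ≤ P g z) → ∀ (g : S → ℝ) (k b : ℝ),
      (∀ u, g u ≤ k + b * V u) → P g z - ε * g o ≤ k * (1 - ε) + b * (P V z - ε * V o) := by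
    intro z hz g k b hg
    have h := hz ((fun u => k + b * V u) - g) (fun u => by simpa using hg u)
    rw [map_sub, Pi.sub_apply, Pi.sub_apply, hP.affine] at h
    linarith
  have hcβ : 0 ≤ c * β := mul_nonneg hc hβ
  have h1 : ∀ v, P f x - ε * f o ≤
      (f v + c * (2 + β * V v)) * (1 - ε) + c * β * (P V x - ε * V o) := fun v =>
    key x hx f _ _ fun u => by nlinarith [hf u v]
  have hε' : 0 < 1 - ε := by linarith
  have h2 := key y hy (fun v => -f v * (1 - ε))
    (c * 2 * (1 - ε) + c * β * (P V x - ε * V o) - (P f x - ε * f o)) (c * β * (1 - ε))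
    (fun v => by nlinarith [h1 v])
  have h3 : P (fun v => -f v * (1 - ε)) y = -(1 - ε) * P f y := by
    have : (fun v => -f v * (1 - ε)) = (-(1 - ε)) • f := by ext; simp; ring
    rw [this, map_smul]; simp
  rw [h3] at h2
  have h4 : (1 - ε) * (P f x - P f y) ≤
      (1 - ε) * (c * (2 * (1 - ε) + β * (P V x - ε * V o) + β * (P V y - ε * V o))) := by
    nlinarith [h2]
  have h5 := le_of_mul_le_mul_left h4 hε'
  have h6 : 0 ≤ c * β * (ε * V o) := mul_nonneg hcβ (mul_nonneg hε (hV0 o))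
  nlinarith [h5, h6]

/-- The Hairer–Mattingly contraction of a Markov operator `A` with drift `A V ≤ γ V + K` and a
common atom `o` on a sublevel set of `V`. -/
theorem exists_contraction {A : Module.End ℝ (S → ℝ)} (hA : IsMarkovOp A) {V : S → ℝ}
    (hV0 : 0 ≤ V) {o : S} {γ K ε R : ℝ} (hγ1 : γ < 1) (hK : 0 ≤ K) (hε : 0 < ε)
    (hε1 : ε < 1) (hR : (4 * K + 4) / (1 - γ) ≤ R) (hV : ∀ x, A V x ≤ γ * V x + K)
    (hmin : ∀ x, V x ≤ R → ∀ g : S → ℝ, 0 ≤ g → ε * g o ≤ A g x) :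
    ∃ β α : ℝ, 0 < β ∧ 0 < α ∧ α < 1 ∧ ∀ (f : S → ℝ) (c : ℝ), 0 ≤ c →
      (∀ u v, f u - f v ≤ c * (2 + β * V u + β * V v)) →
      ∀ x y, A f x - A f y ≤ α * c * (2 + β * V x + β * V y) := by
  have hγ' : 0 < 1 - γ := by linarith
  -- The weight `β` is so small that the drift constant costs at most `2 * β * K ≤ ε`, half of the
  -- gain `2 * ε` from the atom. The three bounds on `η` serve the two cases below: for `V x + V y ≤
  -- R` the atom gives the contraction, and beyond `R = (4K+4)/(1-γ)` the drift alone does, with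
  -- atom of mass `0`.
  set β := ε / (2 * (K + 1)) with hβ
  have hβ0 : 0 < β := by positivity
  have hβK : 2 * β * (K + 1) = ε := by rw [hβ]; field_simp
  set η := min β (min ((1 - γ) / 2) (ε / 2)) with hη
  have hη0 : 0 < η := by
    simp only [hη, lt_min_iff]; exact ⟨hβ0, by positivity, by positivity⟩
  have hη1 : η ≤ β := min_le_left _ _
  have hη2 : η ≤ (1 - γ) / 2 := (min_le_right _ _).trans (min_le_left _ _)
  have hη3 : η ≤ ε / 2 := (min_le_right _ _).trans (min_le_right _ _)
  refine ⟨β, 1 - η, hβ0, by linarith, by linarith, fun f c hc hf x y => ?_⟩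
  have hs : 0 ≤ V x + V y := add_nonneg (hV0 x) (hV0 y)
  have hdrift : β * A V x + β * A V y ≤ β * γ * (V x + V y) + 2 * β * K := by
    nlinarith [mul_le_mul_of_nonneg_left (hV x) hβ0.le, mul_le_mul_of_nonneg_left (hV y) hβ0.le]
  have hfin : ∀ b, b ≤ (1 - η) * (2 + β * V x + β * V y) → A f x - A f y ≤ c * b →
      A f x - A f y ≤ (1 - η) * c * (2 + β * V x + β * V y) := fun b hb h =>
    h.trans ((mul_le_mul_of_nonneg_left hb hc).trans_eq (by ring))
  have hβs : 0 ≤ β * (V x + V y) := mul_nonneg hβ0.le hs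
  by_cases hR' : V x + V y ≤ R
  · have h := hA.sub_le_of_common_atom hV0 hε.le hε1 hβ0.le hc hf
      (hmin x (by linarith [hV0 y, show (0 : S → ℝ) y = 0 from rfl, hV0 y]))
      (hmin y (by linarith [hV0 x, show (0 : S → ℝ) x = 0 from rfl]))
    refine hfin _ ?_ h
    nlinarith
  · push Not at hR'
    have h := hA.sub_le_of_common_atom (o := o) hV0 le_rfl one_pos hβ0.le hc hf
      (fun g hg => by simpa using hA.nonneg g hg x) (fun g hg => by simpa using hA.nonneg g hg y)
    refine hfin _ ?_ h
    have h1 : 4 * K + 4 ≤ (1 - γ) * (V x + V y) := by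
      rw [div_le_iff₀ hγ'] at hR
      nlinarith
    nlinarith

end IsMarkovOp

open Classical in
/-- `V` is a Lyapunov function with finite sublevel sets for the lazy Markov operator `P`, and the
state `o` can be reached from everywhere. -/
structure IsGeomStable (P : Module.End ℝ (S → ℝ)) (V : S → ℝ) (o : S) : Prop where
  markov : IsMarkovOp P
  nonneg : 0 ≤ V
  drift : ∃ γ C : ℝ, 0 ≤ γ ∧ γ < 1 ∧ 0 ≤ C ∧ ∀ x, P V x ≤ γ * V x + C
  finite : ∀ R : ℝ, {x | V x ≤ R}.Finite
  lazy : ∀ f : S → ℝ, 0 ≤ f → ∀ x, 0 < f x → 0 < P f x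
  reach : ∀ x, ∃ k : ℕ, 0 < (P ^ k) (Pi.single o 1) x

theorem exists_pos_le_of_finite {F : Set S} (hF : F.Finite) {f : S → ℝ} (hf : ∀ x ∈ F, 0 < f x) :
    ∃ ε : ℝ, 0 < ε ∧ ε < 1 ∧ ∀ x ∈ F, ε ≤ f x := by
  induction F, hF using Set.Finite.induction_on with
  | empty => exact ⟨1 / 2, by norm_num, by norm_num, by simp⟩
  | @insert a F _ _ ih =>
    obtain ⟨ε, h0, h1, h2⟩ := ih fun x hx => hf x (Set.mem_insert_of_mem _ hx)
    refine ⟨min ε (f a), lt_min h0 (hf a (Set.mem_insert _ _)), (min_le_left _ _).trans_lt h1, ?_⟩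
    rintro x (rfl | hx)
    · exact min_le_right _ _
    · exact (min_le_left _ _).trans (h2 x hx)

namespace IsGeomStable

variable {P : Module.End ℝ (S → ℝ)} {V : S → ℝ} {o : S}

-- Laziness keeps a positive probability of sitting at `o` positive at all later times, so one
-- common time serves all points of a finite set.
open Classical in
theorem exists_common_atom (h : IsGeomStable P V o) {F : Set S} (hF : F.Finite) :
    ∃ (M : ℕ) (ε : ℝ), 0 < M ∧ 0 < ε ∧ ε < 1 ∧
      ∀ x ∈ F, ∀ g : S → ℝ, 0 ≤ g → ε * g o ≤ (P ^ M) g x := by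
  choose k hk using h.reach
  have hnn : ∀ j, 0 ≤ (P ^ j) (Pi.single o (1 : ℝ)) := fun j =>
    (h.markov.pow j).nonneg _ (Pi.single_nonneg.2 zero_le_one)
  have hmono : ∀ x j, k x ≤ j → 0 < (P ^ j) (Pi.single o 1) x := by
    intro x j hj
    induction j, hj using Nat.le_induction with
    | base => exact hk x
    | succ j _ ih =>
      rw [pow_succ', Module.End.mul_apply]
      exact h.lazy _ (hnn j) x ih
  obtain ⟨M, hM⟩ := (hF.image k).bddAbove
  obtain ⟨ε, h0, h1, h2⟩ := exists_pos_le_of_finite hF (f := (P ^ (M + 1)) (Pi.single o 1))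
    fun x hx => hmono x _ ((hM ⟨x, hx, rfl⟩).trans (Nat.le_succ M))
  refine ⟨M + 1, ε, M.succ_pos, h0, h1, fun x hx g hg => ?_⟩
  have hle : g o • Pi.single o (1 : ℝ) ≤ g := by
    intro y
    by_cases hy : y = o
    · subst hy; simp
    · simpa [hy] using hg y
  have := (h.markov.pow (M + 1)).mono hle x
  rw [map_smul, Pi.smul_apply, smul_eq_mul] at this
  have h3 := mul_le_mul_of_nonneg_left (h2 x hx) (show 0 ≤ g o from hg o)
  linarith

/-- Some power of `P` satisfies the assumptions of the Hairer–Mattingly theorem. -/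
theorem exists_pow (h : IsGeomStable P V o) :
    ∃ (M : ℕ) (γ K ε R : ℝ), 0 < M ∧ 0 ≤ γ ∧ γ < 1 ∧ 0 ≤ K ∧ 0 < ε ∧ ε < 1 ∧
      (4 * K + 4) / (1 - γ) ≤ R ∧ (∀ n x, (P ^ n) V x ≤ V x + K) ∧
      (∀ x, (P ^ M) V x ≤ γ * V x + K) ∧
      ∀ x, V x ≤ R → ∀ g : S → ℝ, 0 ≤ g → ε * g o ≤ (P ^ M) g x := by
  obtain ⟨γ, C, hγ, hγ1, hC, hV⟩ := h.drift
  obtain ⟨M, ε, hM, hε, hε1, hmin⟩ :=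
    h.exists_common_atom (h.finite ((4 * (C / (1 - γ)) + 4) / (1 - γ)))
  have hd := h.markov.pow_drift hγ hγ1 hC hV
  refine ⟨M, γ, C / (1 - γ), ε, _, hM, hγ, hγ1, div_nonneg hC (by linarith), hε, hε1, le_rfl,
    fun n x => (hd n x).trans ?_, fun x => (hd M x).trans ?_, hmin⟩
  · have := mul_le_of_le_one_left (h.nonneg x) (pow_le_one₀ (n := n) hγ hγ1.le)
    linarith
  · have : γ ^ M ≤ γ := by simpa using pow_le_pow_of_le_one hγ hγ1.le hM
    have := mul_le_mul_of_nonneg_right this (show 0 ≤ V x from h.nonneg x)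
    linarith

/-- Two initial states are forgotten exponentially fast. -/
theorem exists_geometric_contraction (h : IsGeomStable P V o) :
    ∃ c ρ : ℝ, 0 ≤ c ∧ 0 < ρ ∧ ρ < 1 ∧ ∀ f : S → ℝ, (∀ x, |f x| ≤ 1) → ∀ n x y,
      (P ^ n) f x - (P ^ n) f y ≤ c * ρ ^ n * (1 + V x + V y) := by
  obtain ⟨M, γ, K, ε, R, hM, hγ, hγ1, hK, hε, hε1, hR, -, hV, hmin⟩ := h.exists_pow
  obtain ⟨β, α, hβ, hα, hα1, hcon⟩ :=
    (h.markov.pow M).exists_contraction h.nonneg hγ1 hK hε hε1 hR hV hmin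
  have hM' : (0 : ℝ) < M := by exact_mod_cast hM
  have hM1 : (1 : ℝ) ≤ M := by exact_mod_cast hM
  -- A substitute for `α ^ (1 / M)`: Bernoulli's inequality gives `α ≤ ρ ^ M`.
  set ρ := 1 - (1 - α) / M with hρ
  have hq : (1 - α) / M ≤ 1 - α := div_le_self (by linarith) hM1
  have hq0 : 0 < (1 - α) / M := div_pos (by linarith) hM'
  have hρM : α ≤ ρ ^ M := by
    have := one_add_mul_le_pow (a := -((1 - α) / M)) (by linarith) M
    rw [← sub_eq_add_neg, ← hρ] at this
    have h2 : (M : ℝ) * -((1 - α) / M) = -(1 - α) := by field_simp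
    linarith
  have hρ0 : 0 < ρ := by linarith
  have iter : ∀ k (f : S → ℝ), (∀ x, |f x| ≤ 1) → ∀ x y,
      ((P ^ M) ^ k) f x - ((P ^ M) ^ k) f y ≤ α ^ k * (2 + β * V x + β * V y) := by
    intro k f hf
    induction k with
    | zero =>
      intro x y
      have h1 := abs_le.1 (hf x)
      have h2 := abs_le.1 (hf y)
      have h3 := mul_nonneg hβ.le (h.nonneg x)
      have h4 := mul_nonneg hβ.le (h.nonneg y)
      simp only [pow_zero, Module.End.one_apply, one_mul]
      linarith
    | succ k ih =>
      intro x y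
      rw [pow_succ' (P ^ M) k, Module.End.mul_apply, pow_succ' α k]
      exact hcon _ _ (by positivity) ih x y
  refine ⟨α⁻¹ * (2 + β), ρ, by positivity, hρ0, by linarith, fun f hf n x y => ?_⟩
  -- The remainder `n % M` is absorbed into the test function, which stays bounded by `1`; the
  -- factor `α⁻¹` pays for rounding `n / M` down.
  have h1 := iter (n / M) ((P ^ (n % M)) f) (fun x => (h.markov.pow _).abs_apply_le hf x) x y
  rw [← Module.End.mul_apply, ← pow_mul, ← pow_add, Nat.div_add_mod] at h1
  refine h1.trans ?_
  have h2 : α ^ (n / M) ≤ α⁻¹ * ρ ^ n := by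
    rw [le_inv_mul_iff₀ hα, ← pow_succ']
    calc α ^ (n / M + 1) ≤ (ρ ^ M) ^ (n / M + 1) := pow_le_pow_left₀ hα.le hρM _
      _ = ρ ^ (M * (n / M + 1)) := (pow_mul _ _ _).symm
      _ ≤ ρ ^ n := pow_le_pow_of_le_one hρ0.le (by linarith) (Nat.lt_mul_div_succ n hM).le
  have hx : 0 ≤ V x := h.nonneg x
  have hy : 0 ≤ V y := h.nonneg y
  have h3 : 2 + β * V x + β * V y ≤ (2 + β) * (1 + V x + V y) := by nlinarith
  calc α ^ (n / M) * (2 + β * V x + β * V y)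
      ≤ (α⁻¹ * ρ ^ n) * ((2 + β) * (1 + V x + V y)) := by gcongr
    _ = _ := by ring

open Classical in
/-- A bound for the mean hitting time of `o`. -/
theorem exists_hitting_bound (h : IsGeomStable P V o) :
    ∃ G : S → ℝ, 0 ≤ G ∧ ∀ x, P (fun y => if y = o then 0 else G y) x ≤ G x - 1 := by
  obtain ⟨M, γ, K, ε, R, hM, hγ, hγ1, hK, hε, hε1, hR, -, hV, hmin⟩ := h.exists_pow
  -- `Z` sets a function to zero at `o`, so `Q = P * Z` is the chain killed on entering `o`.
  let Z : Module.End ℝ (S → ℝ) :=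
    { toFun := fun f y => if y = o then 0 else f y
      map_add' := fun f g => by ext y; by_cases hy : y = o <;> simp [hy]
      map_smul' := fun c f => by ext y; by_cases hy : y = o <;> simp [hy] }
  have hZ0 : ∀ f : S → ℝ, 0 ≤ f → 0 ≤ Z f := fun f hf y => by
    by_cases hy : y = o
    · simp [Z, hy]
    · simpa [Z, hy] using hf y
  have hZ1 : ∀ f : S → ℝ, 0 ≤ f → Z f ≤ f := fun f hf y => by
    by_cases hy : y = o
    · simpa [Z, hy] using hf o
    · simp [Z, hy]
  set Q := P * Z with hQ
  have hQ0 : ∀ k (f : S → ℝ), 0 ≤ f → 0 ≤ (Q ^ k) f := by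
    intro k
    induction k with
    | zero => intro f hf; simpa using hf
    | succ k ih =>
      intro f hf
      rw [pow_succ, Module.End.mul_apply]
      exact ih _ (h.markov.nonneg _ (hZ0 f hf))
  have hQP : ∀ k (f : S → ℝ), 0 ≤ f → (Q ^ k) f ≤ (P ^ k) f := by
    intro k
    induction k with
    | zero => intro f _; simp
    | succ k ih =>
      intro f hf
      rw [pow_succ', pow_succ', Module.End.mul_apply, Module.End.mul_apply, hQ,
        Module.End.mul_apply]
      exact h.markov.mono ((hZ1 _ (hQ0 k f hf)).trans (ih f hf))
  have hQ1 : ∀ x, (Q ^ M) 1 x ≤ 1 - (P ^ M) (Pi.single o 1) x := by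
    intro x
    obtain ⟨j, rfl⟩ := Nat.exists_eq_succ_of_ne_zero hM.ne'
    have h1 : Z 1 = 1 - Pi.single o 1 := by
      ext y; by_cases hy : y = o <;> simp [Z, hy]
    have h2 : (Q ^ (j + 1)) 1 x ≤ (P ^ (j + 1)) (Z 1) x := by
      rw [pow_succ, pow_succ, Module.End.mul_apply, Module.End.mul_apply]
      exact hQP j _ (h.markov.nonneg _ (hZ0 1 zero_le_one)) x
    rwa [h1, map_sub, (h.markov.pow _).one] at h2
  have hγ' : 0 < 1 - γ := by linarith
  set β := ε / (2 * (K + 1)) with hβ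
  have hβ0 : 0 < β := by positivity
  have hβK : 2 * β * (K + 1) = ε := by rw [hβ]; field_simp
  set η := min β (min ((1 - γ) / 2) (ε / 2)) with hη
  have hη0 : 0 < η := by
    simp only [hη, lt_min_iff]; exact ⟨hβ0, by positivity, by positivity⟩
  have hη1 : η ≤ β := min_le_left _ _
  have hη2 : η ≤ (1 - γ) / 2 := (min_le_right _ _).trans (min_le_left _ _)
  have hη3 : η ≤ ε / 2 := (min_le_right _ _).trans (min_le_right _ _)
  -- Same two cases as in the contraction: on `V x ≤ R` killing removes mass `ε`, and beyond `R` the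
  -- drift suffices.
  have hcon : ∀ x, (Q ^ M) (1 + β • V) x ≤ (1 - η) * (1 + β * V x) := by
    intro x
    have hx : 0 ≤ V x := h.nonneg x
    have h1 : (Q ^ M) V x ≤ γ * V x + K := (hQP M V h.nonneg x).trans (hV x)
    have h2 := mul_le_mul_of_nonneg_left h1 hβ0.le
    have h3 : 0 ≤ (P ^ M) (Pi.single o 1) x :=
      (h.markov.pow M).nonneg _ (Pi.single_nonneg.2 zero_le_one) x
    have h4 : 0 ≤ β * V x := mul_nonneg hβ0.le hx
    rw [map_add, map_smul, Pi.add_apply, Pi.smul_apply, smul_eq_mul]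
    by_cases hR' : V x ≤ R
    · have h5 := hmin x hR' (Pi.single o 1) (Pi.single_nonneg.2 zero_le_one)
      rw [Pi.single_eq_same, mul_one] at h5
      nlinarith [hQ1 x]
    · push Not at hR'
      have h5 : 4 * K + 4 ≤ (1 - γ) * V x := by
        rw [div_le_iff₀ hγ'] at hR
        nlinarith
      nlinarith [hQ1 x]
  set W : S → ℝ := η⁻¹ • (1 + β • V) with hW
  have hW0 : 0 ≤ W := fun x => by
    have : 0 ≤ V x := h.nonneg x
    simp only [hW, Pi.zero_apply, Pi.smul_apply, Pi.add_apply, Pi.one_apply, smul_eq_mul]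
    positivity
  have hWM : ∀ x, (Q ^ M) W x ≤ W x - 1 := by
    intro x
    have h4 : 0 ≤ β * V x := mul_nonneg hβ0.le (h.nonneg x)
    have h5 := mul_le_mul_of_nonneg_left (hcon x) (inv_nonneg.2 hη0.le)
    have h6 : η⁻¹ * η = 1 := inv_mul_cancel₀ hη0.ne'
    rw [hW, map_smul, Pi.smul_apply, smul_eq_mul]
    simp only [Pi.smul_apply, Pi.add_apply, Pi.one_apply, smul_eq_mul]
    nlinarith
  -- The drift `-1` holds only for `Q ^ M`. Summing `Q ^ j W` over `j < M` telescopes it into a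
  -- drift `-1` for `Q` itself.
  refine ⟨∑ j ∈ Finset.range M, (Q ^ j) W,
    Finset.sum_nonneg fun j _ => hQ0 j W hW0, fun x => ?_⟩
  change Q (∑ j ∈ Finset.range M, (Q ^ j) W) x ≤ _
  have h1 : Q (∑ j ∈ Finset.range M, (Q ^ j) W) =
      (∑ j ∈ Finset.range M, (Q ^ j) W) + (Q ^ M) W - W := by
    rw [map_sum]
    simp_rw [← Module.End.mul_apply, ← pow_succ']
    rw [eq_sub_iff_add_eq, ← Finset.sum_range_succ (fun j => (Q ^ j) W),
      Finset.sum_range_succ' (fun j => (Q ^ j) W)]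
    simp
  rw [h1, Pi.sub_apply, Pi.add_apply]
  linarith [hWM x]

open Filter Topology in
/-- Convergence of the iterates of `P`, as a functional. -/
theorem exists_limit (h : IsGeomStable P V o) :
    ∃ (l : (S → ℝ) → ℝ) (c ρ : ℝ), 0 ≤ c ∧ 0 < ρ ∧ ρ < 1 ∧ ∀ f : S → ℝ, (∀ x, |f x| ≤ 1) →
      ∀ n x, |(P ^ n) f x - l f| ≤ c * ρ ^ n * (1 + V x) := by
  obtain ⟨c, ρ, hc, hρ, hρ1, hcon⟩ := h.exists_geometric_contraction
  obtain ⟨-, -, K, -, -, -, -, -, hK, -, -, -, hPV, -⟩ := h.exists_pow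
  have hVo : 0 ≤ V o := h.nonneg o
  have key : ∀ f : S → ℝ, (∀ x, |f x| ≤ 1) → ∀ n m x,
      |(P ^ n) f x - (P ^ (m + n)) f o| ≤ c * ρ ^ n * (1 + V x + (V o + K)) := by
    intro f hf n m x
    have hcρ : 0 ≤ c * ρ ^ n := by positivity
    have h0 := mul_le_mul_of_nonneg_left (hPV m o) hcρ
    -- The contraction between `x` and `u` is integrated over the law of `u` after `m` steps from
    -- `o`, whose mean of `V` is at most `V o + K`.
    have h1 := (h.markov.pow m).mono
      (f := (P ^ n) f) (g := fun u => ((P ^ n) f x + c * ρ ^ n * (1 + V x)) + c * ρ ^ n * V u)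
      (fun u => by dsimp only; linarith [hcon f hf n u x]) o
    have h2 := (h.markov.pow m).mono
      (f := fun u => ((P ^ n) f x - c * ρ ^ n * (1 + V x)) + (-(c * ρ ^ n)) * V u)
      (g := (P ^ n) f) (fun u => by dsimp only; linarith [hcon f hf n x u]) o
    rw [(h.markov.pow m).affine] at h1 h2
    rw [pow_add, Module.End.mul_apply, abs_le]
    constructor <;> linarith
  have hlim : ∀ f : S → ℝ, (∀ x, |f x| ≤ 1) → ∃ l, Tendsto (fun n => (P ^ n) f o) atTop (𝓝 l) := by
    intro f hf
    refine cauchySeq_tendsto_of_complete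
      (cauchySeq_of_le_tendsto_0' (fun n => c * ρ ^ n * (1 + V o + (V o + K))) ?_ ?_)
    · intro n m hnm
      obtain ⟨k, rfl⟩ := Nat.exists_eq_add_of_le' hnm
      exact key f hf n k o
    · have := (tendsto_pow_atTop_nhds_zero_of_lt_one hρ.le hρ1).const_mul c
      simpa using this.mul_const (1 + V o + (V o + K))
  choose! l hl using hlim
  refine ⟨l, c * (1 + V o + K), ρ, by positivity, hρ, hρ1, fun f hf n x => ?_⟩
  have h1 : Tendsto (fun m => |(P ^ n) f x - (P ^ (m + n)) f o|) atTop
      (𝓝 |(P ^ n) f x - l f|) :=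
    (((hl f hf).comp (tendsto_add_atTop_nat n)).const_sub _).abs
  have hx : 0 ≤ V x := h.nonneg x
  have h2 := le_of_tendsto' h1 fun m => key f hf n m x
  refine h2.trans ?_
  have : 1 + V x + (V o + K) ≤ (1 + V o + K) * (1 + V x) := by nlinarith
  calc _ ≤ c * ρ ^ n * ((1 + V o + K) * (1 + V x)) := by gcongr
    _ = _ := by ring

open Filter Topology in
open Classical in
/-- Existence of stationary weights, with geometric convergence and a finite `V`-moment. -/
theorem exists_stationary_weights (h : IsGeomStable P V o) :
    ∃ (p : S → ℝ) (c ρ : ℝ), (∀ x, 0 ≤ p x) ∧ HasSum p 1 ∧ Summable (fun x => p x * V x) ∧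
      0 ≤ c ∧ 0 < ρ ∧ ρ < 1 ∧ ∀ f : S → ℝ, (∀ x, |f x| ≤ 1) →
        ∀ n x, |(P ^ n) f x - ∑' y, p y * f y| ≤ c * ρ ^ n * (1 + V x) := by
  obtain ⟨l, c, ρ, hc, hρ, hρ1, hl⟩ := h.exists_limit
  obtain ⟨-, -, K, -, -, -, -, -, hK, -, -, -, hPV, -⟩ := h.exists_pow
  have htend : ∀ f : S → ℝ, (∀ x, |f x| ≤ 1) → Tendsto (fun n => (P ^ n) f o) atTop (𝓝 (l f)) := by
    intro f hf
    rw [tendsto_iff_norm_sub_tendsto_zero]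
    refine squeeze_zero (fun _ => norm_nonneg _) (fun n => hl f hf n o) ?_
    have := (tendsto_pow_atTop_nhds_zero_of_lt_one hρ.le hρ1).const_mul c
    simpa using this.mul_const (1 + V o)
  have hsingle : ∀ y x : S, |(Pi.single y (1 : ℝ) : S → ℝ) x| ≤ 1 := fun y x => by
    by_cases hx : x = y
    · subst hx; simp
    · simp [hx]
  set p : S → ℝ := fun y => l (Pi.single y 1) with hp
  have hp0 : ∀ y, 0 ≤ p y := fun y =>
    ge_of_tendsto' (htend _ (hsingle y)) fun n =>
      (h.markov.pow n).nonneg _ (Pi.single_nonneg.2 zero_le_one) o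
  have hfin : ∀ (F : Finset S) (f : S → ℝ),
      Tendsto (fun n => (P ^ n) (fun x => if x ∈ F then f x else 0) o) atTop
        (𝓝 (∑ y ∈ F, p y * f y)) := by
    intro F f
    have h1 : (fun x => if x ∈ F then f x else 0) = ∑ y ∈ F, f y • Pi.single y (1 : ℝ) := by
      ext x
      simp [Finset.sum_apply, Pi.single_apply]
    simp_rw [h1, map_sum, map_smul, Finset.sum_apply, Pi.smul_apply, smul_eq_mul]
    refine tendsto_finsetSum _ fun y _ => ?_
    simpa [mul_comm] using (htend _ (hsingle y)).const_mul (f y)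
  have hVo : 0 ≤ V o := h.nonneg o
  have hsum : ∀ f : S → ℝ, (∀ x, |f x| ≤ 1) → HasSum (fun y => p y * f y) (l f) := by
    intro f hf
    rw [HasSum, SummationFilter.unconditional_filter, Metric.tendsto_atTop]
    intro e he
    -- Tightness, uniformly in the number of steps: by Markov's inequality the mass outside `V ≤ R`
    -- is at most `(V o + K) / R ≤ e / 2`. Hence the limit functional is given by its weights and no
    -- mass escapes.
    set R := (V o + K + 1) / (e / 2) with hR
    have hR0 : 0 < R := by positivity
    refine ⟨(h.finite R).toFinset, fun F hF => ?_⟩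
    have h1 : ∀ n, |(P ^ n) (fun x => if x ∈ F then f x else 0) o - (P ^ n) f o| ≤ e / 2 := by
      intro n
      have h2 : ∀ x, |(if x ∈ F then f x else 0) - f x| ≤ V x / R := by
        intro x
        have hx : 0 ≤ V x := h.nonneg x
        by_cases hxF : x ∈ F
        · simp only [hxF, if_true, sub_self, abs_zero]; positivity
        · have : R < V x := by
            by_contra hlt
            exact hxF (hF ((h.finite R).mem_toFinset.2 (not_lt.1 hlt)))
          simp only [hxF, if_false, zero_sub, abs_neg]
          exact (hf x).trans ((one_le_div hR0).2 this.le)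
      have h3 := (h.markov.pow n).mono (f := (fun x => if x ∈ F then f x else 0) - f)
        (g := R⁻¹ • V) (fun x => by
          simpa [div_eq_inv_mul] using (abs_le.1 (h2 x)).2) o
      have h4 := (h.markov.pow n).mono (f := -(R⁻¹ • V))
        (g := (fun x => if x ∈ F then f x else 0) - f) (fun x => by
          have := (abs_le.1 (h2 x)).1
          simpa [div_eq_inv_mul] using this) o
      rw [map_sub, map_smul, Pi.sub_apply, Pi.smul_apply, smul_eq_mul] at h3
      rw [map_sub, map_neg, map_smul, Pi.sub_apply, Pi.neg_apply, Pi.smul_apply, smul_eq_mul] at h4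
      have h5 : R⁻¹ * (P ^ n) V o ≤ R⁻¹ * (V o + K) := by gcongr; exact hPV n o
      have h6 : R⁻¹ * (V o + K) ≤ e / 2 := by
        rw [inv_mul_le_iff₀ hR0, hR, div_mul_cancel₀ _ (by positivity)]
        linarith
      exact abs_le.2 ⟨by linarith, by linarith⟩
    have h7 := le_of_tendsto' (((hfin F f).sub (htend f hf)).abs) h1
    rw [Real.dist_eq]
    linarith
  refine ⟨p, c, ρ, hp0, ?_, ?_, hc, hρ, hρ1, fun f hf n x => ?_⟩
  · have h1 := hsum 1 (by simp)
    have h2 : l 1 = 1 := tendsto_nhds_unique (htend 1 (by simp)) (by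
      simp_rw [fun n => (h.markov.pow n).one]
      exact tendsto_const_nhds)
    simpa [h2] using h1
  -- Fatou's argument: a partial sum is a limit of means of truncations of `V`, each at most `V o +
  -- K`.
  · refine summable_of_sum_le (c := V o + K) (fun y => mul_nonneg (hp0 y) (h.nonneg y)) fun F => ?_
    refine le_of_tendsto' (hfin F V) fun n => le_trans ?_ (hPV n o)
    refine (h.markov.pow n).mono (fun x => ?_) o
    dsimp only
    split_ifs
    · exact le_rfl
    · exact h.nonneg x
  · rw [(hsum f hf).tsum_eq]
    exact hl f hf n x

open Filter Topology in
/-- Weights to which the iterates of `P` converge are stationary. -/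
theorem tsum_apply_eq {p : S → ℝ} {c ρ : ℝ} (h : IsMarkovOp P) (hρ : 0 < ρ) (hρ1 : ρ < 1) (x : S)
    (hp : ∀ f : S → ℝ, (∀ x, |f x| ≤ 1) →
        ∀ n x, |(P ^ n) f x - ∑' y, p y * f y| ≤ c * ρ ^ n * (1 + V x))
    {f : S → ℝ} (hf : ∀ x, |f x| ≤ 1) : ∑' y, p y * P f y = ∑' y, p y * f y := by
  have htend : ∀ g : S → ℝ, (∀ x, |g x| ≤ 1) →
      Tendsto (fun n => (P ^ n) g x) atTop (𝓝 (∑' y, p y * g y)) := by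
    intro g hg
    rw [tendsto_iff_norm_sub_tendsto_zero]
    refine squeeze_zero (fun _ => norm_nonneg _) (fun n => hp g hg n x) ?_
    have := (tendsto_pow_atTop_nhds_zero_of_lt_one hρ.le hρ1).const_mul c
    simpa using this.mul_const (1 + V x)
  refine tendsto_nhds_unique (htend _ (fun x => h.abs_apply_le hf x)) ?_
  have := (htend f hf).comp (tendsto_add_atTop_nat 1)
  simpa [Function.comp_def, pow_succ] using this

end IsGeomStable
end MarkovOperator

/-! ### Exponential generating functions and uniformization -/

section Uniformization

open scoped Nat

theorem summable_expGen {c : ℕ → ℝ} {K : ℝ} (hc : ∀ n, |c n| ≤ K) (t : ℝ) :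
    Summable fun n : ℕ => c n * (t ^ n / n !) := by
  refine Summable.of_norm_bounded ((Real.summable_pow_div_factorial |t|).mul_left K) fun n => ?_
  rw [norm_mul, norm_div, norm_pow, Real.norm_eq_abs, Real.norm_eq_abs, Real.norm_natCast]
  exact mul_le_mul_of_nonneg_right (hc n) (by positivity)

/-- Differentiation shifts the coefficients. For `c n = (P ^ n) f x` the shift replaces `f` by `P
f`, which is the source of Kolmogorov's equation. -/
theorem hasDerivAt_expGen {c : ℕ → ℝ} {K : ℝ} (hc : ∀ n, |c n| ≤ K) (t : ℝ) :
    HasDerivAt (fun t : ℝ => ∑' n : ℕ, c n * (t ^ n / n !))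
      (∑' n : ℕ, c (n + 1) * (t ^ n / n !)) t := by
  have hK : 0 ≤ K := (abs_nonneg _).trans (hc 0)
  have hfac : ∀ (n : ℕ) (y : ℝ), ((n + 1 : ℕ) : ℝ) * y ^ n / ((n + 1)! : ℕ) = y ^ n / n ! := by
    intro n y
    rw [Nat.factorial_succ]
    push_cast
    field_simp
  -- The ball of radius `|t| + 1` contains `t` and gives a summable majorant of the differentiated
  -- series.
  set R := |t| + 1 with hR
  have h1 : HasDerivAt (fun t : ℝ => ∑' n : ℕ, c n * (t ^ n / n !))
      (∑' n : ℕ, c n * (n * t ^ (n - 1) / n !)) t := by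
    refine hasDerivAt_tsum_of_isPreconnected (u := fun n : ℕ => K * (n * R ^ (n - 1) / n !))
      (g := fun (n : ℕ) (t : ℝ) => c n * (t ^ n / n !))
      (g' := fun (n : ℕ) (t : ℝ) => c n * (n * t ^ (n - 1) / n !))
      (t := Metric.ball 0 R) (y₀ := t) ?_ Metric.isOpen_ball
      (convex_ball (0 : ℝ) R).isPreconnected ?_ ?_ ?_ (summable_expGen hc t) ?_
    · refine Summable.mul_left K ((summable_nat_add_iff 1).1 ?_)
      simp_rw [Nat.add_sub_cancel, hfac]
      exact Real.summable_pow_div_factorial R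
    · intro n y _
      exact ((hasDerivAt_pow n y).div_const _).const_mul _
    · intro n y hy
      have hy' : |y| ≤ R := by simpa using (Metric.mem_ball.1 hy).le
      rw [norm_mul, norm_div, norm_mul, norm_pow, Real.norm_natCast, Real.norm_natCast,
        Real.norm_eq_abs, Real.norm_eq_abs]
      exact mul_le_mul (hc n) (by gcongr) (by positivity) hK
    · simp [hR]
    · simp [hR]
  convert h1 using 1
  rw [(show Summable fun n : ℕ => c n * (n * t ^ (n - 1) / n !) from ?_).tsum_eq_zero_add]
  · simp only [Nat.cast_zero, zero_mul, zero_div, mul_zero, zero_add, Nat.add_sub_cancel, hfac]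
  · refine (summable_nat_add_iff 1).1 ?_
    simp_rw [Nat.add_sub_cancel, hfac]
    exact summable_expGen (fun n => hc (n + 1)) t

theorem hasSum_pow_div_factorial (t : ℝ) : HasSum (fun n : ℕ => t ^ n / n !) (Real.exp t) := by
  rw [Real.exp_eq_exp_ℝ]
  exact NormedSpace.expSeries_div_hasSum_exp t

variable {S : Type*}

/-- The semigroup of the continuous-time chain that makes steps of `P` at rate `Λ`. -/
def unif (P : Module.End ℝ (S → ℝ)) (Λ : ℝ) (f : S → ℝ) (t : ℝ) (x : S) : ℝ :=
  Real.exp (-(Λ * t)) * ∑' n : ℕ, (P ^ n) f x * ((Λ * t) ^ n / n !)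

variable {P : Module.End ℝ (S → ℝ)} {f : S → ℝ} {Λ : ℝ}

@[simp]
theorem unif_zero (x : S) : unif P Λ f 0 x = f x := by
  unfold unif
  rw [tsum_eq_single 0 (fun n hn => by simp [hn])]
  simp

theorem IsMarkovOp.hasDerivAt_unif (hP : IsMarkovOp P) (hf : ∀ x, |f x| ≤ 1) (t : ℝ) (x : S) :
    HasDerivAt (fun t => unif P Λ f t x) (Λ * (unif P Λ (P f) t x - unif P Λ f t x)) t := by
  have h1 := hasDerivAt_expGen (c := fun n => (P ^ n) f x) (K := 1)
    (fun n => (hP.pow n).abs_apply_le hf x) (Λ * t)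
  have h2 : HasDerivAt (fun t => Λ * t) Λ t := by simpa using (hasDerivAt_id t).const_mul Λ
  have h3 := (h2.neg.exp).mul (h1.comp t h2)
  have h4 : ∀ n, (P ^ (n + 1)) f x = (P ^ n) (P f) x := fun n => by
    rw [pow_succ, Module.End.mul_apply]
  simp only [h4] at h3
  refine h3.congr_deriv ?_
  simp only [unif, Function.comp, Pi.neg_apply]
  ring

/-- The number of steps up to time `t` is Poisson with mean `Λ * t`, and the mean of `ρ ^ N` is then
`exp (-Λ * (1 - ρ) * t)`. -/
theorem IsMarkovOp.abs_unif_sub_le (hP : IsMarkovOp P) (hf : ∀ x, |f x| ≤ 1) {l c ρ : ℝ} {x : S}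
    (h : ∀ n, |(P ^ n) f x - l| ≤ c * ρ ^ n) {t : ℝ} (ht : 0 ≤ Λ * t) :
    |unif P Λ f t x - l| ≤ c * Real.exp (-(Λ * (1 - ρ)) * t) := by
  have h1 := summable_expGen (c := fun n => (P ^ n) f x) (K := 1)
    (fun n => (hP.pow n).abs_apply_le hf x) (Λ * t)
  have h2 := (hasSum_pow_div_factorial (Λ * t)).mul_left l
  have h3 := (hasSum_pow_div_factorial (Λ * t * ρ)).mul_left c
  have h4 : |(∑' n : ℕ, (P ^ n) f x * ((Λ * t) ^ n / n !)) - l * Real.exp (Λ * t)| ≤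
      c * Real.exp (Λ * t * ρ) := by
    rw [← (h1.hasSum.sub h2).tsum_eq, ← Real.norm_eq_abs]
    refine tsum_of_norm_bounded h3 fun n => ?_
    rw [← sub_mul, norm_mul, Real.norm_eq_abs, Real.norm_eq_abs, abs_of_nonneg (a := _ / _)
      (by positivity), mul_pow _ ρ, mul_comm _ (ρ ^ n), mul_div_assoc, ← mul_assoc]
    exact mul_le_mul_of_nonneg_right (h n) (by positivity)
  have h5 : unif P Λ f t x - l = Real.exp (-(Λ * t)) *
      ((∑' n : ℕ, (P ^ n) f x * ((Λ * t) ^ n / n !)) - l * Real.exp (Λ * t)) := by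
    have : Real.exp (-(Λ * t)) * Real.exp (Λ * t) = 1 := by rw [← Real.exp_add]; simp
    unfold unif
    linear_combination l * this
  rw [h5, abs_mul, abs_of_pos (Real.exp_pos _)]
  calc _ ≤ Real.exp (-(Λ * t)) * (c * Real.exp (Λ * t * ρ)) := by gcongr
    _ = c * (Real.exp (-(Λ * t)) * Real.exp (Λ * t * ρ)) := by ring
    _ = _ := by rw [← Real.exp_add]; ring_nf

theorem IsMarkovOp.unif_add (hP : IsMarkovOp P) {g : S → ℝ} (hf : ∀ x, |f x| ≤ 1)
    (hg : ∀ x, |g x| ≤ 1) (t : ℝ) (x : S) :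
    unif P Λ (f + g) t x = unif P Λ f t x + unif P Λ g t x := by
  unfold unif
  rw [← mul_add, ← (summable_expGen (fun n => (hP.pow n).abs_apply_le hf x) _).tsum_add
    (summable_expGen (fun n => (hP.pow n).abs_apply_le hg x) _)]
  simp_rw [map_add, Pi.add_apply, add_mul]

theorem IsMarkovOp.unif_one (hP : IsMarkovOp P) (t : ℝ) (x : S) : unif P Λ 1 t x = 1 := by
  unfold unif
  simp_rw [fun n => (hP.pow n).one, Pi.one_apply, one_mul]
  rw [(hasSum_pow_div_factorial _).tsum_eq, ← Real.exp_add]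
  simp

theorem IsMarkovOp.unif_nonneg (hP : IsMarkovOp P) (hf : 0 ≤ f) {t : ℝ} (ht : 0 ≤ Λ * t) (x : S) :
    0 ≤ unif P Λ f t x := by
  unfold unif
  refine mul_nonneg (Real.exp_nonneg _) (tsum_nonneg fun n => ?_)
  have : 0 ≤ (P ^ n) f x := (hP.pow n).nonneg f hf x
  positivity

/-- Stationary weights of `P` are stationary for the semigroup. -/
theorem IsMarkovOp.tsum_unif (hP : IsMarkovOp P) {p : S → ℝ} (hp0 : ∀ x, 0 ≤ p x)
    (hp : Summable p)
    (hinv : ∀ f : S → ℝ, (∀ x, |f x| ≤ 1) → ∑' y, p y * P f y = ∑' y, p y * f y)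
    (hf : ∀ x, |f x| ≤ 1) (t : ℝ) :
    ∑' y, p y * unif P Λ f t y = ∑' y, p y * f y := by
  have hpow : ∀ n, ∑' y, p y * (P ^ n) f y = ∑' y, p y * f y := by
    intro n
    induction n with
    | zero => simp
    | succ n ih =>
      rw [pow_succ']
      simp_rw [Module.End.mul_apply]
      rw [hinv _ (fun x => (hP.pow n).abs_apply_le hf x), ih]
  have hb : ∀ n y, |(P ^ n) f y| ≤ 1 := fun n y => (hP.pow n).abs_apply_le hf y
  have hsum : Summable (Function.uncurry fun (y : S) (n : ℕ) =>
      p y * (P ^ n) f y * ((Λ * t) ^ n / n !)) := by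
    have h1 : Summable fun q : S × ℕ => p q.1 * ((|Λ * t|) ^ q.2 / q.2 !) :=
      hp.mul_of_nonneg (Real.summable_pow_div_factorial _) hp0 (fun n => by positivity)
    refine Summable.of_norm_bounded h1 fun q => ?_
    rw [Function.uncurry, norm_mul, norm_mul, norm_div, norm_pow, Real.norm_natCast,
      Real.norm_eq_abs, Real.norm_eq_abs, Real.norm_eq_abs, abs_of_nonneg (hp0 _)]
    exact mul_le_mul_of_nonneg_right (mul_le_of_le_one_right (hp0 _) (hb _ _)) (by positivity)
  have h2 : ∑' y, p y * unif P Λ f t y = Real.exp (-(Λ * t)) *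
      ∑' y, ∑' n : ℕ, p y * (P ^ n) f y * ((Λ * t) ^ n / n !) := by
    rw [← tsum_mul_left]
    refine tsum_congr fun y => ?_
    simp_rw [mul_assoc (p y), tsum_mul_left]
    unfold unif
    ring
  rw [h2, ← hsum.tsum_comm]
  simp_rw [tsum_mul_right, hpow, tsum_mul_left, (hasSum_pow_div_factorial _).tsum_eq]
  have : Real.exp (-(Λ * t)) * Real.exp (Λ * t) = 1 := by rw [← Real.exp_add]; simp
  linear_combination (∑' y, p y * f y) * this

end Uniformization

/-! ### Jump operators with finitely many transitions -/

section JumpOperator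

variable {S ι : Type*} [Fintype ι] (r : ι → S → ℝ) (τ : ι → S → S)

/-- The generator of the chain that jumps from `x` to `τ i x` at rate `r i x`. -/
def gen : Module.End ℝ (S → ℝ) where
  toFun f x := ∑ i, r i x * (f (τ i x) - f x)
  map_add' f g := by
    ext x
    simp only [Pi.add_apply, ← Finset.sum_add_distrib]
    exact Finset.sum_congr rfl fun i _ => by ring
  map_smul' c f := by
    ext x
    simp only [Pi.smul_apply, smul_eq_mul, RingHom.id_apply, Finset.mul_sum]
    exact Finset.sum_congr rfl fun i _ => by ring

theorem gen_apply (f : S → ℝ) (x : S) : gen r τ f x = ∑ i, r i x * (f (τ i x) - f x) := rfl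

/-- The transition operator of the discrete-time chain that makes the jumps of the generator with
the probabilities `r i x / c x` and otherwise stays. -/
def stepOp (c : S → ℝ) : Module.End ℝ (S → ℝ) where
  toFun f x := f x + gen r τ f x / c x
  map_add' f g := by ext x; simp only [map_add, Pi.add_apply]; ring
  map_smul' a f := by
    ext x; simp only [map_smul, Pi.smul_apply, smul_eq_mul, RingHom.id_apply]; ring

variable {r τ}

theorem stepOp_apply (c : S → ℝ) (f : S → ℝ) (x : S) :
    stepOp r τ c f x = f x + gen r τ f x / c x := rfl

theorem stepOp_eq (c : S → ℝ) (f : S → ℝ) (x : S) :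
    stepOp r τ c f x = (1 - (∑ i, r i x) / c x) * f x + ∑ i, r i x / c x * f (τ i x) := by
  rw [stepOp_apply, gen_apply]
  simp_rw [mul_sub, Finset.sum_sub_distrib, ← Finset.sum_mul, div_mul_eq_mul_div,
    ← Finset.sum_div]
  ring

theorem isMarkovOp_stepOp {c : S → ℝ} (hr : ∀ i x, 0 ≤ r i x) (hc : ∀ x, 0 < c x)
    (hrc : ∀ x, ∑ i, r i x ≤ c x) : IsMarkovOp (stepOp r τ c) where
  nonneg f hf x := by
    rw [stepOp_eq]
    have h1 : 0 ≤ 1 - (∑ i, r i x) / c x := sub_nonneg.2 ((div_le_one (hc x)).2 (hrc x))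
    exact add_nonneg (mul_nonneg h1 (hf x)) (Finset.sum_nonneg fun i _ =>
      mul_nonneg (div_nonneg (hr i x) (hc x).le) (hf _))
  one := by ext x; simp [stepOp_apply, gen_apply]

/-- The strict inequality between total rate and `c` leaves a positive probability of staying put.
This laziness excludes periodicity. -/
theorem stepOp_pos_of_pos {c : S → ℝ} (hr : ∀ i x, 0 ≤ r i x) (hc : ∀ x, 0 < c x)
    (hrc : ∀ x, ∑ i, r i x < c x) {f : S → ℝ} (hf : 0 ≤ f) {x : S} (hx : 0 < f x) :
    0 < stepOp r τ c f x := by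
  rw [stepOp_eq]
  have h1 : 0 < 1 - (∑ i, r i x) / c x := sub_pos.2 ((div_lt_one (hc x)).2 (hrc x))
  exact add_pos_of_pos_of_nonneg (mul_pos h1 hx) (Finset.sum_nonneg fun i _ =>
    mul_nonneg (div_nonneg (hr i x) (hc x).le) (hf _))

theorem stepOp_pos_of_target {c : S → ℝ} (hr : ∀ i x, 0 ≤ r i x) (hc : ∀ x, 0 < c x)
    (hrc : ∀ x, ∑ i, r i x ≤ c x) {f : S → ℝ} (hf : 0 ≤ f) {x : S} (i : ι) (hi : 0 < r i x)
    (hx : 0 < f (τ i x)) : 0 < stepOp r τ c f x := by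
  rw [stepOp_eq]
  have h1 : 0 ≤ 1 - (∑ i, r i x) / c x := sub_nonneg.2 ((div_le_one (hc x)).2 (hrc x))
  refine add_pos_of_nonneg_of_pos (mul_nonneg h1 (hf x)) (Finset.sum_pos' (fun i _ =>
    mul_nonneg (div_nonneg (hr i x) (hc x).le) (hf _)) ⟨i, Finset.mem_univ _, ?_⟩)
  exact mul_pos (div_pos hi (hc x)) hx

/-- Kolmogorov's backward equation for the uniformized semigroup. -/
theorem hasDerivAt_unif_stepOp {Λ : ℝ} (hΛ : 0 < Λ) (hr : ∀ i x, 0 ≤ r i x)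
    (hrΛ : ∀ x, ∑ i, r i x ≤ Λ) {f : S → ℝ} (hf : ∀ x, |f x| ≤ 1) (t : ℝ) (x : S) :
    HasDerivAt (fun t => unif (stepOp r τ fun _ => Λ) Λ f t x)
      (gen r τ (unif (stepOp r τ fun _ => Λ) Λ f t) x) t := by
  set P := stepOp r τ fun _ => Λ with hPdef
  have hP : IsMarkovOp P := isMarkovOp_stepOp hr (fun _ => hΛ) hrΛ
  refine (hP.hasDerivAt_unif hf t x).congr_deriv ?_
  have hs : ∀ y, Summable fun n : ℕ => (P ^ n) f y * ((Λ * t) ^ n / n.factorial) := fun y =>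
    summable_expGen (fun n => (hP.pow n).abs_apply_le hf y) _
  have h1 : unif P Λ (P f) t x = P (unif P Λ f t) x := by
    -- `P` evaluates its argument at finitely many points only, so it may be exchanged with the
    -- exponential series.
    have h2 : ∀ n, (P ^ n) (P f) x = P ((P ^ n) f) x := fun n => by
      rw [← Module.End.mul_apply, ← Module.End.mul_apply, ← pow_succ, ← pow_succ']
    conv_rhs => rw [hPdef, stepOp_eq]
    unfold unif
    simp_rw [h2]
    conv_lhs => enter [2, 1, n]; rw [hPdef, stepOp_eq, ← hPdef]
    have h3 : ∀ n : ℕ, ((1 - (∑ i, r i x) / Λ) * (P ^ n) f x +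
        ∑ i, r i x / Λ * (P ^ n) f (τ i x)) * ((Λ * t) ^ n / n.factorial) =
        (1 - (∑ i, r i x) / Λ) * ((P ^ n) f x * ((Λ * t) ^ n / n.factorial)) +
        ∑ i, r i x / Λ * ((P ^ n) f (τ i x) * ((Λ * t) ^ n / n.factorial)) := by
      intro n
      rw [add_mul, Finset.sum_mul]
      simp_rw [mul_assoc]
    simp_rw [h3]
    rw [((hs x).mul_left _).tsum_add (summable_sum fun i _ => (hs (τ i x)).mul_left _),
      Summable.tsum_finsetSum (fun i _ => (hs (τ i x)).mul_left _), mul_add, Finset.mul_sum]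
    simp_rw [tsum_mul_left]
    congr 1
    · ring
    · exact Finset.sum_congr rfl fun i _ => by ring
  rw [h1, hPdef, stepOp_apply, ← hPdef]
  field_simp
  ring

end JumpOperator

/-! ### Configurations and gaps -/

section Configurations

variable {n : ℕ}

/-- Translation of a configuration. -/
def shift (c : ℤ) (x : Config n) : Config n := ⟨fun i => x.1 i + c, fun _ _ h => by
  simpa using x.2 h⟩

@[simp]
theorem shift_val (c : ℤ) (x : Config n) (i : Fin (n + 1)) : (shift c x).1 i = x.1 i + c := rfl

@[simp]
theorem gaps_shift (c : ℤ) (x : Config n) : gaps (shift c x) = gaps x := by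
  ext i; simp [gaps]

theorem gaps_cast (x : Config n) (i : Fin n) :
    ((gaps x i : ℕ) : ℤ) = x.1 i.succ - x.1 i.castSucc := by
  unfold gaps
  exact Int.toNat_of_nonneg (sub_nonneg.2 (x.2 (Fin.castSucc_lt_succ).le))

theorem eq_shift_of_gaps_eq {x y : Config n} (h : gaps x = gaps y) :
    y = shift (y.1 0 - x.1 0) x := by
  apply Subtype.ext
  funext i
  rw [shift_val]
  induction i using Fin.induction with
  | zero => ring
  | succ i ih =>
    have h1 := gaps_cast x i
    have h2 := gaps_cast y i
    rw [h] at h1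
    linarith

/-- The configuration with the given gaps whose first particle is at the origin. -/
def place (d : Gaps n) : Config n :=
  ⟨fun i => ∑ j : Fin n, if (j : ℕ) < i then (d j : ℤ) else 0, fun i k h => by
    refine Finset.sum_le_sum fun j _ => ?_
    have : (i : ℕ) ≤ k := h
    split_ifs <;> omega⟩

@[simp]
theorem gaps_place (d : Gaps n) : gaps (place d) = d := by
  ext i
  have h := gaps_cast (place d) i
  have h2 : (place d).1 i.succ - (place d).1 i.castSucc = d i := by
    simp only [place, ← Finset.sum_sub_distrib]
    rw [Finset.sum_eq_single i]
    · simp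
    · intro j _ hj
      have : (j : ℕ) ≠ i := fun h => hj (Fin.ext h)
      simp only [Fin.val_succ, Fin.val_castSucc]
      split_ifs <;> omega
    · simp
  rw [h2] at h
  exact_mod_cast h

theorem val_eq_add_sum_gaps (x : Config n) (i : Fin (n + 1)) :
    x.1 i = x.1 0 + ∑ j : Fin n, if (j : ℕ) < i then (gaps x j : ℤ) else 0 := by
  have h := eq_shift_of_gaps_eq (x := place (gaps x)) (y := x) (by simp)
  have h0 : (place (gaps x)).1 0 = 0 := by simp [place]
  conv_lhs => rw [h]
  rw [shift_val, h0]
  simp only [place]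
  ring

/-- The diameter of a configuration. -/
theorem last_sub_zero (x : Config n) :
    (x.1 (Fin.last n) : ℝ) - x.1 0 = ∑ j : Fin n, (gaps x j : ℝ) := by
  rw [val_eq_add_sum_gaps x (Fin.last n)]
  simp

/-- Abel summation; the zero total weight removes the dependence on the position of the first
particle. -/
theorem sum_mul_val (x : Config n) (w : Fin (n + 1) → ℝ) (hw : ∑ i, w i = 0) :
    ∑ i, w i * (x.1 i : ℝ) =
      -∑ j : Fin n, (gaps x j : ℝ) * ∑ i : Fin (n + 1), if (i : ℕ) < j + 1 then w i else 0 := by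
  have h1 : ∀ j : Fin n, (∑ i : Fin (n + 1), if (i : ℕ) < j + 1 then w i else 0) =
      -∑ i : Fin (n + 1), if (j : ℕ) < i then w i else 0 := by
    intro j
    rw [eq_neg_iff_add_eq_zero, ← Finset.sum_add_distrib]
    refine Eq.trans ?_ hw
    refine Finset.sum_congr rfl fun i _ => ?_
    split_ifs <;> first | omega | simp
  simp_rw [h1, mul_neg, Finset.sum_neg_distrib, neg_neg, Finset.mul_sum]
  rw [Finset.sum_comm]
  have h2 : ∀ i, w i * (x.1 i : ℝ) = w i * x.1 0 +
      ∑ j : Fin n, (gaps x j : ℝ) * if (j : ℕ) < i then w i else 0 := by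
    intro i
    rw [val_eq_add_sum_gaps x i]
    push_cast
    rw [mul_add, Finset.mul_sum]
    congr 1
    refine Finset.sum_congr rfl fun j _ => ?_
    split_ifs <;> simp [mul_comm]
  simp_rw [h2, Finset.sum_add_distrib, ← Finset.sum_mul, hw, zero_mul, zero_add]

end Configurations

/-! ### Jump rates and their symmetries -/

section Rates

variable {n : ℕ} (m a b : Fin (n + 1) → ℝ≥0)

/-- Rate of the jump of particle `q.1` to the right (`q.2 = true`) or left (`q.2 = false`). -/
def jumpRate (q : Fin (n + 1) × Bool) (x : Config n) : ℝ :=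
  if q.2 then rightRate m b q.1 x else leftRate m a q.1 x

/-- Target of a jump. -/
def jumpTo (q : Fin (n + 1) × Bool) (x : Config n) : Config n :=
  move q.1 (if q.2 then 1 else -1) x

/-- Rates of the chain of gaps. -/
def gapRate (q : Fin (n + 1) × Bool) (d : Gaps n) : ℝ := jumpRate m a b q (place d)

/-- Targets of the chain of gaps. -/
def gapTo (q : Fin (n + 1) × Bool) (d : Gaps n) : Gaps n := gaps (jumpTo q (place d))

theorem jumpRate_nonneg (q : Fin (n + 1) × Bool) (x : Config n) : 0 ≤ jumpRate m a b q x := by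
  unfold jumpRate; split_ifs <;> exact NNReal.coe_nonneg _

theorem sum_jumpRate (x : Config n) : ∑ q, jumpRate m a b q x = totalRate m a b x := by
  rw [Fintype.sum_prod_type]
  simp [jumpRate, totalRate, add_comm]

theorem jumpRate_shift (q : Fin (n + 1) × Bool) (c : ℤ) (x : Config n) :
    jumpRate m a b q (shift c x) = jumpRate m a b q x := by
  unfold jumpRate leftRate rightRate
  simp only [shift_val, add_lt_add_iff_right, add_left_inj]

theorem move_shift (i : Fin (n + 1)) (s c : ℤ) (x : Config n) :
    move i s (shift c x) = shift c (move i s x) := by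
  have h : (shift c x).1 + Pi.single i s =
      fun j => (x.1 + Pi.single i s : Fin (n + 1) → ℤ) j + c := by
    ext j; simp only [Pi.add_apply, shift_val]; ring
  have h2 : Monotone ((shift c x).1 + Pi.single i s) ↔ Monotone (x.1 + Pi.single i s) := by
    rw [h]
    simp only [Monotone, add_le_add_iff_right]
  unfold move
  split_ifs with h3 h4 h4
  · apply Subtype.ext
    funext j
    rw [shift_val]
    exact congrFun h j
  · exact absurd (h2.1 h3) h4
  · exact absurd (h2.2 h4) h3
  · rfl

theorem jumpTo_shift (q : Fin (n + 1) × Bool) (c : ℤ) (x : Config n) :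
    jumpTo q (shift c x) = shift c (jumpTo q x) := move_shift _ _ _ _

theorem jumpRate_eq_gapRate (q : Fin (n + 1) × Bool) (x : Config n) :
    jumpRate m a b q x = gapRate m a b q (gaps x) := by
  rw [gapRate, eq_shift_of_gaps_eq (x := place (gaps x)) (y := x) (by simp), jumpRate_shift]
  simp

theorem gaps_jumpTo (q : Fin (n + 1) × Bool) (x : Config n) :
    gaps (jumpTo q x) = gapTo q (gaps x) := by
  rw [gapTo, eq_shift_of_gaps_eq (x := place (gaps x)) (y := x) (by simp), jumpTo_shift]
  simp

/-- The gaps form a Markov chain: the generator preserves functions of the gaps. -/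
theorem gen_comp_gaps (f : Gaps n → ℝ) (x : Config n) :
    gen (jumpRate m a b) jumpTo (fun y => f (gaps y)) x =
      gen (gapRate m a b) gapTo f (gaps x) := by
  simp only [gen_apply, jumpRate_eq_gapRate, gaps_jumpTo]

/-- A nonzero rate means that the left neighbour is strictly to the left, so the step keeps the
order and the fallback value of `move` is not used. -/
theorem monotone_of_leftRate_ne_zero {i : Fin (n + 1)} {x : Config n}
    (h : leftRate m a i x ≠ 0) : Monotone (x.1 + Pi.single i (-1 : ℤ)) := by
  have hi : ∀ j : Fin (n + 1), (j : ℕ) + 1 = i → x.1 j < x.1 i := by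
    by_contra hcon
    exact h (if_neg hcon)
  intro j k hjk
  simp only [Pi.add_apply, Pi.single_apply]
  have hx := x.2 hjk
  split_ifs with h1 h2 h2
  · omega
  · omega
  · subst h2
    have hlt : j < k := lt_of_le_of_ne hjk h1
    have hlt' : (j : ℕ) < k := hlt
    have h3 := hi ⟨(k : ℕ) - 1, by omega⟩ (by simp only; omega)
    have h4 : x.1 j ≤ x.1 ⟨(k : ℕ) - 1, by omega⟩ := x.2 (by rw [Fin.le_def]; simp only; omega)
    omega
  · omega

theorem monotone_of_rightRate_ne_zero {i : Fin (n + 1)} {x : Config n}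
    (h : rightRate m b i x ≠ 0) : Monotone (x.1 + Pi.single i (1 : ℤ)) := by
  have hi : ∀ j : Fin (n + 1), (i : ℕ) + 1 = j → x.1 i < x.1 j := by
    by_contra hcon
    exact h (if_neg hcon)
  intro j k hjk
  simp only [Pi.add_apply, Pi.single_apply]
  have hx := x.2 hjk
  split_ifs with h1 h2 h2
  · omega
  · subst h1
    have hlt : j < k := lt_of_le_of_ne hjk (Ne.symm h2)
    have hlt' : (j : ℕ) < k := hlt
    have h3 := hi ⟨(j : ℕ) + 1, by omega⟩ rfl
    have h4 : x.1 ⟨(j : ℕ) + 1, by omega⟩ ≤ x.1 k := x.2 (by rw [Fin.le_def]; simp only; omega)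
    omega
  · omega
  · omega

theorem move_left_val {i : Fin (n + 1)} {x : Config n} (h : leftRate m a i x ≠ 0) :
    (move i (-1) x).1 = x.1 + Pi.single i (-1) := by
  unfold move
  rw [dif_pos (monotone_of_leftRate_ne_zero m a h)]

theorem move_right_val {i : Fin (n + 1)} {x : Config n} (h : rightRate m b i x ≠ 0) :
    (move i 1 x).1 = x.1 + Pi.single i 1 := by
  unfold move
  rw [dif_pos (monotone_of_rightRate_ne_zero m b h)]

theorem jumpTo_val {q : Fin (n + 1) × Bool} {x : Config n} (h : jumpRate m a b q x ≠ 0) :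
    (jumpTo q x).1 = x.1 + Pi.single q.1 (if q.2 then 1 else -1) := by
  obtain ⟨i, s⟩ := q
  cases s
  · simp only [jumpRate, jumpTo, Bool.false_eq_true, if_false] at h ⊢
    exact move_left_val m a (by exact_mod_cast h)
  · simp only [jumpRate, jumpTo, if_true] at h ⊢
    exact move_right_val m b (by exact_mod_cast h)

/-- The generator on functions of the positions. -/
theorem gen_apply_val (Φ : (Fin (n + 1) → ℤ) → ℝ) (x : Config n) :
    gen (jumpRate m a b) jumpTo (fun y => Φ y.1) x = ∑ q : Fin (n + 1) × Bool,
      jumpRate m a b q x * (Φ (x.1 + Pi.single q.1 (if q.2 then 1 else -1)) - Φ x.1) := by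
  rw [gen_apply]
  refine Finset.sum_congr rfl fun q _ => ?_
  by_cases h : jumpRate m a b q x = 0
  · simp [h]
  · rw [jumpTo_val m a b h]

/-- A jump changes the gaps when there are at least two particles. -/
theorem gaps_jumpTo_ne (hn : 0 < n) {q : Fin (n + 1) × Bool} {x : Config n}
    (h : jumpRate m a b q x ≠ 0) : gaps (jumpTo q x) ≠ gaps x := by
  intro heq
  have h1 := eq_shift_of_gaps_eq heq.symm
  have hval := jumpTo_val m a b h
  set s : ℤ := if q.2 then 1 else -1 with hs
  have hs0 : s ≠ 0 := by rw [hs]; split_ifs <;> decide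
  have h2 : ∀ j, (Pi.single q.1 s : Fin (n + 1) → ℤ) j = (jumpTo q x).1 0 - x.1 0 := by
    intro j
    have h3 : (jumpTo q x).1 j = x.1 j + ((jumpTo q x).1 0 - x.1 0) := by
      conv_lhs => rw [h1]
      rfl
    rw [hval] at h3 ⊢
    simpa using h3
  have : Nontrivial (Fin (n + 1)) := Fin.nontrivial_iff_two_le.2 (by omega)
  obtain ⟨j, hj⟩ := exists_ne q.1
  have h4 := h2 q.1
  have h5 := h2 j
  rw [Pi.single_eq_same] at h4
  rw [Pi.single_eq_of_ne hj] at h5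
  exact hs0 (h4.trans h5.symm)

/-- Summation over the left-most particles of the clusters. -/
theorem exists_left_lead (hm : ∀ i, 0 < m i) (x : Config n) :
    ∃ lead : Fin (n + 1) → Fin (n + 1), (∀ j, lead j ≤ j ∧ x.1 (lead j) = x.1 j) ∧
      ∀ u : Fin (n + 1) → ℝ, ∑ i, (leftRate m a i x : ℝ) * (m i * u i) =
        ∑ j, (m j : ℝ) * a j * u (lead j) := by
  classical
  -- The two conditions inside `leftRate` select exactly one receiver of the push of `j`: the
  -- smallest label at the site of `j`.
  have key : ∀ j : Fin (n + 1), ∃ i, ∀ i' : Fin (n + 1),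
      ((∀ k : Fin (n + 1), (k : ℕ) + 1 = i' → x.1 k < x.1 i') ∧ i' ≤ j ∧ x.1 j = x.1 i') ↔
        i' = i := by
    intro j
    obtain ⟨i, hi, hmin⟩ := (Finset.univ.filter fun i => x.1 i = x.1 j).exists_minimal
      ⟨j, by simp⟩
    simp only [Finset.mem_filter, Finset.mem_univ, true_and] at hi hmin
    have hle : ∀ i', x.1 i' = x.1 j → i ≤ i' := fun i' h =>
      (le_total i i').elim id fun h' => hmin h h'
    refine ⟨i, fun i' => ⟨fun ⟨h1, _, h3⟩ => ?_, ?_⟩⟩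
    · by_contra hne
      have hlt : i < i' := lt_of_le_of_ne (hle i' h3.symm) (Ne.symm hne)
      have hlt' : (i : ℕ) < i' := hlt
      have h4 := h1 ⟨(i' : ℕ) - 1, by omega⟩ (by simp only; omega)
      have h5 : x.1 i ≤ x.1 ⟨(i' : ℕ) - 1, by omega⟩ := x.2 (by rw [Fin.le_def]; simp only; omega)
      omega
    · rintro rfl
      refine ⟨fun k hk => ?_, hle j rfl, hi.symm⟩
      have hki : k ≤ i' := by rw [Fin.le_def]; omega
      refine lt_of_le_of_ne (x.2 hki) fun h => ?_
      have h6 := hle k (h.trans hi)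
      rw [Fin.le_def] at h6
      omega
  choose lead hlead using key
  refine ⟨lead, fun j => ?_, fun u => ?_⟩
  · obtain ⟨_, h2, h3⟩ := (hlead j (lead j)).2 rfl
    exact ⟨h2, h3.symm⟩
  -- The mass of the receiver cancels the denominator of the rate, so `j` contributes `m j * a j`
  -- whoever receives its push.
  · have h1 : ∀ i, (leftRate m a i x : ℝ) * (m i * u i) =
        ∑ j, if i = lead j then (m j : ℝ) * a j * u i else 0 := by
      intro i
      have hmi : (m i : ℝ) ≠ 0 := by exact_mod_cast (hm i).ne'
      simp_rw [← hlead]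
      unfold leftRate
      split_ifs with h
      · simp only [NNReal.coe_sum, Finset.sum_mul]
        refine Finset.sum_congr rfl fun j _ => ?_
        split_ifs with h2 h3 h3
        · push_cast; field_simp
        · exact absurd ⟨h, h2⟩ h3
        · exact absurd h3.2 h2
        · simp
      · simp [h]
    simp_rw [h1]
    rw [Finset.sum_comm]
    simp

/-- Summation over the right-most particles of the clusters. -/
theorem exists_right_lead (hm : ∀ i, 0 < m i) (x : Config n) :
    ∃ lead : Fin (n + 1) → Fin (n + 1), (∀ j, j ≤ lead j ∧ x.1 (lead j) = x.1 j) ∧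
      ∀ u : Fin (n + 1) → ℝ, ∑ i, (rightRate m b i x : ℝ) * (m i * u i) =
        ∑ j, (m j : ℝ) * b j * u (lead j) := by
  classical
  have key : ∀ j : Fin (n + 1), ∃ i, ∀ i' : Fin (n + 1),
      ((∀ k : Fin (n + 1), (i' : ℕ) + 1 = k → x.1 i' < x.1 k) ∧ j ≤ i' ∧ x.1 j = x.1 i') ↔
        i' = i := by
    intro j
    obtain ⟨i, hi, hmax⟩ := (Finset.univ.filter fun i => x.1 i = x.1 j).exists_maximal
      ⟨j, by simp⟩
    simp only [Finset.mem_filter, Finset.mem_univ, true_and] at hi hmax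
    have hle : ∀ i', x.1 i' = x.1 j → i' ≤ i := fun i' h =>
      (le_total i' i).elim id fun h' => hmax h h'
    refine ⟨i, fun i' => ⟨fun ⟨h1, _, h3⟩ => ?_, ?_⟩⟩
    · by_contra hne
      have hlt : i' < i := lt_of_le_of_ne (hle i' h3.symm) hne
      have hlt' : (i' : ℕ) < i := hlt
      have h4 := h1 ⟨(i' : ℕ) + 1, by omega⟩ rfl
      have h5 : x.1 ⟨(i' : ℕ) + 1, by omega⟩ ≤ x.1 i := x.2 (by rw [Fin.le_def]; simp only; omega)
      omega
    · rintro rfl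
      refine ⟨fun k hk => ?_, hle j rfl, hi.symm⟩
      have hki : i' ≤ k := by rw [Fin.le_def]; omega
      refine lt_of_le_of_ne (x.2 hki) fun h => ?_
      have h6 := hle k (h.symm.trans hi)
      rw [Fin.le_def] at h6
      omega
  choose lead hlead using key
  refine ⟨lead, fun j => ?_, fun u => ?_⟩
  · obtain ⟨_, h2, h3⟩ := (hlead j (lead j)).2 rfl
    exact ⟨h2, h3.symm⟩
  · have h1 : ∀ i, (rightRate m b i x : ℝ) * (m i * u i) =
        ∑ j, if i = lead j then (m j : ℝ) * b j * u i else 0 := by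
      intro i
      have hmi : (m i : ℝ) ≠ 0 := by exact_mod_cast (hm i).ne'
      simp_rw [← hlead]
      unfold rightRate
      split_ifs with h
      · simp only [NNReal.coe_sum, Finset.sum_mul]
        refine Finset.sum_congr rfl fun j _ => ?_
        split_ifs with h2 h3 h3
        · push_cast; field_simp
        · exact absurd ⟨h, h2⟩ h3
        · exact absurd h3.2 h2
        · simp
      · simp [h]
    simp_rw [h1]
    rw [Finset.sum_comm]
    simp

/-- A uniform bound for the total rate, larger than `1`. -/
def rateBound : ℝ≥0 := 1 + ∑ i, ∑ j, (m j * a j / m i + m j * b j / m i)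

theorem totalRate_lt_rateBound (x : Config n) : totalRate m a b x < rateBound m a b := by
  classical
  refine lt_of_le_of_lt ?_ (lt_one_add _)
  unfold totalRate
  refine Finset.sum_le_sum fun i _ => ?_
  rw [Finset.sum_add_distrib]
  unfold leftRate rightRate
  gcongr
  · split_ifs
    · refine Finset.sum_le_sum fun j _ => ?_
      split_ifs <;> simp
    · exact zero_le
  · split_ifs
    · refine Finset.sum_le_sum fun j _ => ?_
      split_ifs <;> simp
    · exact zero_le

theorem one_le_rateBound : 1 ≤ rateBound m a b := le_self_add

theorem holdRate_le_rateBound (x : Config n) : holdRate m a b x ≤ rateBound m a b := by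
  unfold holdRate
  split_ifs
  · exact_mod_cast one_le_rateBound m a b
  · exact_mod_cast (totalRate_lt_rateBound m a b x).le

theorem totalRate_le_holdRate (x : Config n) : (totalRate m a b x : ℝ) ≤ holdRate m a b x := by
  unfold holdRate
  split_ifs with h
  · simp [h]
  · exact le_rfl

end Rates

/-! ### An exponential Lyapunov function from a quadratic one -/

section ExpDrift

variable {S ι : Type*} [Fintype ι] {r : ι → S → ℝ} {τ : ι → S → S}

theorem exp_sub_one_le_add_sq {y : ℝ} (h : |y| ≤ 1) : Real.exp y - 1 ≤ y + y ^ 2 := by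
  have := (abs_le.1 (Real.abs_exp_sub_one_sub_id_le h)).2
  linarith

/-- If `W` has bounded relative increments and negative drift of the order of `√W`, then an
exponential of `√W` is a Lyapunov function. -/
theorem exists_exp_drift {W : S → ℝ} {Λ K₁ K c : ℝ} (hr : ∀ i x, 0 ≤ r i x)
    (hΛ : ∀ x, ∑ i, r i x ≤ Λ) (hΛ0 : 0 < Λ) (hK₁ : 0 < K₁) (hK : 0 ≤ K) (hc : 0 < c)
    (hW : ∀ x, 0 ≤ W x)
    (hjump : ∀ i x, r i x ≠ 0 → |W (τ i x) - W x| ≤ K₁ * √(1 + W x))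
    (hgen : ∀ x, gen r τ W x ≤ K - c * √(1 + W x)) :
    ∃ δ κ C : ℝ, 0 < δ ∧ 0 < κ ∧ 0 ≤ C ∧ ∀ x,
      gen r τ (fun x => Real.exp (δ * √(1 + W x))) x ≤ -κ * Real.exp (δ * √(1 + W x)) + C := by
  -- The first bound keeps the exponents below `1` in size, so that `exp y - 1 ≤ y + y ^ 2`. The
  -- second keeps the quadratic terms below a quarter of the linear drift `δ * c / 2`.
  set δ := min (1 / K₁) (c / (8 * K₁ ^ 2 * Λ)) with hδ
  have hδ0 : 0 < δ := lt_min (by positivity) (by positivity)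
  have hδ1 : δ * K₁ ≤ 1 := by
    calc δ * K₁ ≤ 1 / K₁ * K₁ := by gcongr; exact min_le_left _ _
      _ = 1 := by field_simp
  have hδ2 : δ * (K₁ ^ 2 * Λ) ≤ c / 8 := by
    calc δ * (K₁ ^ 2 * Λ) ≤ c / (8 * K₁ ^ 2 * Λ) * (K₁ ^ 2 * Λ) := by gcongr; exact min_le_right _ _
      _ = c / 8 := by field_simp
  refine ⟨δ, δ * c / 4, Real.exp (δ * (4 * K / c)) * (δ * K / 2 + δ * c / 4), hδ0, by positivity,
    by positivity, fun x => ?_⟩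
  set g : S → ℝ := fun x => √(1 + W x) with hg
  have hg1 : ∀ x, 1 ≤ g x := fun x => Real.one_le_sqrt.2 (by linarith [hW x])
  have hgsq : ∀ x, g x ^ 2 = 1 + W x := fun x => Real.sq_sqrt (by linarith [hW x])
  have hgx := hg1 x
  set V := Real.exp (δ * g x) with hV
  have hV0 : 0 < V := Real.exp_pos _
  have hterm : ∀ i, r i x * (Real.exp (δ * g (τ i x)) - V) ≤
      V * (δ / (2 * g x) * (r i x * (W (τ i x) - W x)) + δ ^ 2 * K₁ ^ 2 * r i x) := by
    intro i
    by_cases h0 : r i x = 0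
    · simp [h0]
    have hg' := hg1 (τ i x)
    set Δ := g (τ i x) - g x with hΔ
    have hWd : W (τ i x) - W x = Δ * (g (τ i x) + g x) := by
      have h1 := hgsq (τ i x)
      have h2 := hgsq x
      rw [hΔ]; linarith
    have habs : |Δ| ≤ K₁ := by
      have h1 := hjump i x h0
      rw [hWd, abs_mul, abs_of_pos (show 0 < g (τ i x) + g x by linarith)] at h1
      have h2 : |Δ| * g x ≤ K₁ * g x :=
        le_trans (mul_le_mul_of_nonneg_left (by linarith) (abs_nonneg _)) h1
      exact le_of_mul_le_mul_right h2 (by linarith)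
    -- Concavity of the square root.
    have hΔle : Δ ≤ (W (τ i x) - W x) / (2 * g x) := by
      rw [le_div_iff₀ (by linarith), hWd, hΔ]
      nlinarith [sq_nonneg (g (τ i x) - g x)]
    have hΔsq : Δ ^ 2 ≤ K₁ ^ 2 := sq_le_sq' (by linarith [(abs_le.1 habs).1]) (abs_le.1 habs).2
    have hsmall : |δ * Δ| ≤ 1 := by
      rw [abs_mul, abs_of_pos hδ0]
      exact (mul_le_mul_of_nonneg_left habs hδ0.le).trans hδ1
    have hexp : Real.exp (δ * g (τ i x)) - V = V * (Real.exp (δ * Δ) - 1) := by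
      rw [hV, mul_sub, ← Real.exp_add, hΔ]; ring_nf
    rw [hexp]
    have h1 := exp_sub_one_le_add_sq hsmall
    have h2 : Real.exp (δ * Δ) - 1 ≤ δ * ((W (τ i x) - W x) / (2 * g x)) + δ ^ 2 * K₁ ^ 2 := by
      have h3 := mul_le_mul_of_nonneg_left hΔle hδ0.le
      have h4 := mul_le_mul_of_nonneg_left hΔsq (sq_nonneg δ)
      nlinarith
    calc r i x * (V * (Real.exp (δ * Δ) - 1))
        ≤ r i x * (V * (δ * ((W (τ i x) - W x) / (2 * g x)) + δ ^ 2 * K₁ ^ 2)) :=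
          mul_le_mul_of_nonneg_left (mul_le_mul_of_nonneg_left h2 hV0.le) (hr i x)
      _ = _ := by field_simp
  have hsum : gen r τ (fun x => Real.exp (δ * √(1 + W x))) x ≤
      V * (δ / (2 * g x) * gen r τ W x + δ ^ 2 * K₁ ^ 2 * ∑ i, r i x) := by
    rw [gen_apply, gen_apply, Finset.mul_sum, Finset.mul_sum, ← Finset.sum_add_distrib,
      Finset.mul_sum]
    exact Finset.sum_le_sum fun i _ => hterm i
  have h1 : δ / (2 * g x) * gen r τ W x ≤ δ * (K / (2 * g x)) - δ * c / 2 := by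
    have := mul_le_mul_of_nonneg_left (hgen x) (show 0 ≤ δ / (2 * g x) by positivity)
    refine this.trans_eq ?_
    change δ / (2 * g x) * (K - c * g x) = _
    field_simp
  have h2 : δ ^ 2 * K₁ ^ 2 * ∑ i, r i x ≤ δ * (c / 8) := by
    calc δ ^ 2 * K₁ ^ 2 * ∑ i, r i x ≤ δ ^ 2 * K₁ ^ 2 * Λ := by gcongr; exact hΛ x
      _ = δ * (δ * (K₁ ^ 2 * Λ)) := by ring
      _ ≤ _ := by gcongr
  have h3 : gen r τ (fun x => Real.exp (δ * √(1 + W x))) x ≤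
      V * (δ * (K / (2 * g x)) - δ * c / 2 + δ * (c / 8)) :=
    hsum.trans (mul_le_mul_of_nonneg_left (by linarith) hV0.le)
  change _ ≤ -(δ * c / 4) * V + _
  -- For large `g` the constant `K` is absorbed by the drift. For small `g` the value `V` is
  -- bounded, and everything goes into the additive constant.
  by_cases hcase : 4 * K / c ≤ g x
  · have h4 : K / (2 * g x) ≤ c / 8 := by
      rw [div_le_iff₀ (by linarith)]
      rw [div_le_iff₀ hc] at hcase
      linarith
    have h5 : V * (δ * (K / (2 * g x)) - δ * c / 2 + δ * (c / 8)) ≤ V * (-(δ * c / 4)) := by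
      refine mul_le_mul_of_nonneg_left ?_ hV0.le
      nlinarith [mul_le_mul_of_nonneg_left h4 hδ0.le]
    have : 0 ≤ Real.exp (δ * (4 * K / c)) * (δ * K / 2 + δ * c / 4) := by positivity
    linarith
  · push Not at hcase
    have h4 : K / (2 * g x) ≤ K / 2 := div_le_div_of_nonneg_left hK (by norm_num) (by linarith)
    have h5 : V * (δ * (K / (2 * g x)) - δ * c / 2 + δ * (c / 8)) ≤ V * (δ * K / 2) := by
      refine mul_le_mul_of_nonneg_left ?_ hV0.le
      nlinarith [mul_le_mul_of_nonneg_left h4 hδ0.le, mul_pos hδ0 hc]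
    have h6 : V ≤ Real.exp (δ * (4 * K / c)) := by
      rw [hV]; gcongr
    have h7 : V * (δ * K / 2 + δ * c / 4) ≤
        Real.exp (δ * (4 * K / c)) * (δ * K / 2 + δ * c / 4) := by gcongr
    linarith

end ExpDrift

/-! ### Drift of the moment of inertia and of the escape functions -/

section Drift

variable {n : ℕ} (m a b : Fin (n + 1) → ℝ≥0)

theorem sum_add_single (g : Fin (n + 1) → ℤ → ℝ) (x : Fin (n + 1) → ℤ) (i : Fin (n + 1)) (s : ℤ) :
    ∑ j, g j ((x + Pi.single i s : Fin (n + 1) → ℤ) j) = ∑ j, g j (x j) + (g i (x i + s) - g i (x i)) := by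
  rw [← sub_eq_iff_eq_add', ← Finset.sum_sub_distrib, Finset.sum_eq_single i]
  · simp
  · intro j _ hj; simp [hj]
  · simp

theorem sum_jumps (F : Fin (n + 1) → ℝ → ℝ) (x : Config n) :
    ∑ q : Fin (n + 1) × Bool, jumpRate m a b q x * F q.1 (if q.2 then 1 else -1) =
      ∑ i, (rightRate m b i x : ℝ) * F i 1 + ∑ i, (leftRate m a i x : ℝ) * F i (-1) := by
  rw [Fintype.sum_prod_type, ← Finset.sum_add_distrib]
  simp [jumpRate]

theorem M_last : M m (n + 1) = ∑ i, (m i : ℝ) := by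
  unfold M
  exact Finset.sum_congr rfl fun i _ => if_pos i.2

theorem U_last : U m a b (n + 1) = -∑ i, (m i : ℝ) * (b i - a i) := by
  unfold U
  congr 1
  exact Finset.sum_congr rfl fun i _ => if_pos i.2

theorem M_pos (hm : ∀ i, 0 < m i) {k : ℕ} (hk : 1 ≤ k) : 0 < M m k := by
  unfold M
  refine Finset.sum_pos' (fun i _ => ?_) ⟨0, Finset.mem_univ _, ?_⟩
  · split_ifs <;> positivity
  · rw [if_pos (by simp; omega)]
    exact_mod_cast hm 0

theorem M_lt_last (hm : ∀ i, 0 < m i) {k : ℕ} (hk : k ≤ n) : M m k < M m (n + 1) := by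
  rw [M_last]
  unfold M
  refine Finset.sum_lt_sum (fun i _ => ?_) ⟨Fin.last n, Finset.mem_univ _, ?_⟩
  · split_ifs
    · exact le_rfl
    · positivity
  · rw [if_neg (by simp; omega)]
    exact_mod_cast hm _

/-- Weights of the position of the center of mass relative to that of the first `k` particles. -/
def escapeWeight (k : ℕ) (i : Fin (n + 1)) : ℝ :=
  m i * (M m k / M m (n + 1) - if (i : ℕ) < k then 1 else 0)

/-- As `0 < M_k < M_N`, the bracket in the weight never vanishes; consequently every possible jump
changes `escape`. -/
theorem escapeWeight_ne_zero (hm : ∀ i, 0 < m i) {k : ℕ} (hk : 1 ≤ k) (hkn : k ≤ n)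
    (i : Fin (n + 1)) : escapeWeight m k i ≠ 0 := by
  have h0 := M_pos m hm hk
  have h1 := M_lt_last m hm hkn
  have h2 : 0 < M m k / M m (n + 1) := div_pos h0 (h0.trans h1)
  have h3 : M m k / M m (n + 1) < 1 := (div_lt_one (h0.trans h1)).2 h1
  refine mul_ne_zero (by exact_mod_cast (hm i).ne') ?_
  split_ifs
  · linarith
  · linarith

theorem sum_escapeWeight (hm : ∀ i, 0 < m i) (k : ℕ) : ∑ i, escapeWeight m k i = 0 := by
  have h1 := M_pos m hm (k := n + 1) (by omega)
  unfold escapeWeight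
  simp_rw [mul_sub, Finset.sum_sub_distrib, ← Finset.sum_mul, ← M_last, mul_ite, mul_one, mul_zero]
  change _ - M m k = 0
  field_simp
  ring

/-- The escape function. -/
def escape (k : ℕ) (x : Config n) : ℝ := ∑ i, escapeWeight m k i * x.1 i

theorem escape_shift (hm : ∀ i, 0 < m i) (k : ℕ) (c : ℤ) (x : Config n) :
    escape m k (shift c x) = escape m k x := by
  simp only [escape, shift_val, Int.cast_add, mul_add, Finset.sum_add_distrib, ← Finset.sum_mul,
    sum_escapeWeight m hm k, zero_mul, add_zero]

theorem escape_jumpTo {k : ℕ} {q : Fin (n + 1) × Bool} {x : Config n}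
    (h : jumpRate m a b q x ≠ 0) :
    escape m k (jumpTo q x) - escape m k x = escapeWeight m k q.1 * if q.2 then 1 else -1 := by
  unfold escape
  rw [jumpTo_val m a b h, sum_add_single (fun j z => escapeWeight m k j * z)]
  split_ifs <;> push_cast <;> ring

/-- If the first `k` particles do not push on average, the escape function has nonnegative drift. -/
theorem gen_escape_nonneg (hm : ∀ i, 0 < m i) {k : ℕ} (hk : 1 ≤ k) (hkn : k ≤ n)
    (hU : U m a b (n + 1) / M m (n + 1) ≤ U m a b k / M m k) (x : Config n) :
    0 ≤ gen (jumpRate m a b) jumpTo (escape m k) x := by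
  have h0 := M_pos m hm hk
  have h1 := h0.trans (M_lt_last m hm hkn)
  set θ : Fin (n + 1) → ℝ := fun i => M m k / M m (n + 1) - if (i : ℕ) < k then 1 else 0 with hθ
  -- Monotonicity of `θ` is what fixes the sign of the interaction: right pushes are passed to
  -- larger labels and left pushes to smaller ones, and both can only increase the drift over the
  -- free one.
  have hθmono : Monotone θ := by
    intro i j hij
    have : (i : ℕ) ≤ j := hij
    simp only [hθ]
    split_ifs <;> first | omega | linarith
  have hgen : gen (jumpRate m a b) jumpTo (escape m k) x =
      ∑ i, (rightRate m b i x : ℝ) * (m i * θ i) - ∑ i, (leftRate m a i x : ℝ) * (m i * θ i) := by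
    have h2 : gen (jumpRate m a b) jumpTo (escape m k) x = ∑ q : Fin (n + 1) × Bool,
        jumpRate m a b q x * (fun i (s : ℝ) => escapeWeight m k i * s) q.1
          (if q.2 then 1 else -1) := by
      rw [gen_apply]
      refine Finset.sum_congr rfl fun q _ => ?_
      by_cases h : jumpRate m a b q x = 0
      · simp [h]
      · rw [escape_jumpTo m a b h]
    rw [h2, sum_jumps m a b (fun i (s : ℝ) => escapeWeight m k i * s)]
    simp only [mul_one, mul_neg, Finset.sum_neg_distrib, sub_eq_add_neg]
    rfl
  obtain ⟨lead, hlead, hsum⟩ := exists_left_lead m a hm x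
  obtain ⟨lead', hlead', hsum'⟩ := exists_right_lead m b hm x
  rw [hgen, hsum, hsum']
  have h2 : ∑ j, (m j : ℝ) * b j * θ j ≤ ∑ j, (m j : ℝ) * b j * θ (lead' j) :=
    Finset.sum_le_sum fun j _ =>
      mul_le_mul_of_nonneg_left (hθmono (hlead' j).1) (by positivity)
  have h3 : ∑ j, (m j : ℝ) * a j * θ (lead j) ≤ ∑ j, (m j : ℝ) * a j * θ j :=
    Finset.sum_le_sum fun j _ =>
      mul_le_mul_of_nonneg_left (hθmono (hlead j).1) (by positivity)
  have h4 : ∑ j, (m j : ℝ) * b j * θ j - ∑ j, (m j : ℝ) * a j * θ j =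
      U m a b k - M m k / M m (n + 1) * U m a b (n + 1) := by
    rw [U_last]
    unfold U
    rw [mul_neg, Finset.mul_sum, ← Finset.sum_sub_distrib, neg_sub_neg, ← Finset.sum_sub_distrib]
    refine Finset.sum_congr rfl fun j _ => ?_
    simp only [hθ]
    split_ifs <;> ring
  have h5 : M m k / M m (n + 1) * U m a b (n + 1) ≤ U m a b k := by
    rw [le_div_iff₀ h0] at hU
    calc _ = U m a b (n + 1) / M m (n + 1) * M m k := by ring
      _ ≤ _ := hU
  linarith

/-- The center of mass. -/
def center (x : Fin (n + 1) → ℤ) : ℝ := (∑ i, (m i : ℝ) * x i) / ∑ i, (m i : ℝ)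

/-- The moment of inertia with respect to the center of mass. -/
def inertia (x : Fin (n + 1) → ℤ) : ℝ :=
  ∑ i, (m i : ℝ) * (x i : ℝ) ^ 2 - (∑ i, (m i : ℝ) * x i) ^ 2 / ∑ i, (m i : ℝ)

theorem sum_mass_pos (hm : ∀ i, 0 < m i) : 0 < ∑ i, (m i : ℝ) :=
  Finset.sum_pos (fun i _ => by exact_mod_cast hm i) Finset.univ_nonempty

theorem inertia_eq (hm : ∀ i, 0 < m i) (x : Fin (n + 1) → ℤ) :
    inertia m x = ∑ i, (m i : ℝ) * (x i - center m x) ^ 2 := by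
  have hM := sum_mass_pos m hm
  have h : ∀ i, (m i : ℝ) * (x i - center m x) ^ 2 = m i * (x i : ℝ) ^ 2 -
      2 * center m x * (m i * x i) + center m x ^ 2 * m i := fun i => by ring
  simp_rw [h, Finset.sum_add_distrib, Finset.sum_sub_distrib, ← Finset.mul_sum]
  unfold inertia center
  field_simp
  ring

theorem inertia_nonneg (hm : ∀ i, 0 < m i) (x : Fin (n + 1) → ℤ) : 0 ≤ inertia m x := by
  rw [inertia_eq m hm]; positivity

theorem mul_sq_le_inertia (hm : ∀ i, 0 < m i) (x : Fin (n + 1) → ℤ) (i : Fin (n + 1)) :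
    (m i : ℝ) * (x i - center m x) ^ 2 ≤ inertia m x := by
  rw [inertia_eq m hm]
  exact Finset.single_le_sum (f := fun i => (m i : ℝ) * (x i - center m x) ^ 2)
    (fun j _ => by positivity) (Finset.mem_univ i)

theorem inertia_add_single (hm : ∀ i, 0 < m i) (x : Fin (n + 1) → ℤ) (i : Fin (n + 1)) (s : ℤ) :
    inertia m (x + Pi.single i s) - inertia m x =
      2 * s * m i * (x i - center m x) + (s : ℝ) ^ 2 * (m i - m i ^ 2 / ∑ i, (m i : ℝ)) := by
  have hM := sum_mass_pos m hm
  unfold inertia center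
  rw [sum_add_single (fun j z => (m j : ℝ) * (z : ℝ) ^ 2), sum_add_single (fun j z => (m j : ℝ) * z)]
  push_cast
  field_simp
  ring

theorem inertia_shift (hm : ∀ i, 0 < m i) (c : ℤ) (x : Config n) :
    inertia m (shift c x).1 = inertia m x.1 := by
  have hM := sum_mass_pos m hm
  have h : center m (shift c x).1 = center m x.1 + c := by
    unfold center
    simp only [shift_val, Int.cast_add, mul_add, Finset.sum_add_distrib, ← Finset.sum_mul]
    field_simp
  rw [inertia_eq m hm, inertia_eq m hm, h]
  simp

/-- The drift of the moment of inertia is that of free particles, up to a constant. -/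
theorem gen_inertia_le (hm : ∀ i, 0 < m i) (x : Config n) :
    gen (jumpRate m a b) jumpTo (fun y => inertia m y.1) x ≤
      2 * ∑ j, (m j : ℝ) * (b j - a j) * (x.1 j - center m x.1) + ∑ j, (m j : ℝ) * (a j + b j) := by
  have hM := sum_mass_pos m hm
  set y : Fin (n + 1) → ℝ := fun i => x.1 i - center m x.1 with hy
  rw [gen_apply_val]
  have h1 : ∑ q : Fin (n + 1) × Bool, jumpRate m a b q x *
      (inertia m (x.1 + Pi.single q.1 (if q.2 then 1 else -1)) - inertia m x.1) ≤
      ∑ q : Fin (n + 1) × Bool, jumpRate m a b q x *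
        (fun i (s : ℝ) => (m i : ℝ) * (2 * s * y i + 1)) q.1 (if q.2 then 1 else -1) := by
    refine Finset.sum_le_sum fun q _ => mul_le_mul_of_nonneg_left ?_ (jumpRate_nonneg m a b q x)
    rw [inertia_add_single m hm]
    have h2 : 0 ≤ (m q.1 : ℝ) ^ 2 / ∑ i, (m i : ℝ) := by positivity
    simp only [hy]
    split_ifs <;> push_cast <;> nlinarith
  refine h1.trans (le_of_eq ?_)
  rw [sum_jumps m a b (fun i (s : ℝ) => (m i : ℝ) * (2 * s * y i + 1))]
  obtain ⟨lead, hlead, hsum⟩ := exists_left_lead m a hm x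
  obtain ⟨lead', hlead', hsum'⟩ := exists_right_lead m b hm x
  rw [hsum (fun i => 2 * -1 * y i + 1), hsum' (fun i => 2 * 1 * y i + 1), Finset.mul_sum,
    ← Finset.sum_add_distrib, ← Finset.sum_add_distrib]
  refine Finset.sum_congr rfl fun j _ => ?_
  -- The receiver sits at the site of `j`, so it has the same distance from the center of mass and
  -- the interaction disappears.
  simp only [hy, (hlead j).2, (hlead' j).2]
  ring

/-- Under the stability condition the moment of inertia has a drift of the order of the diameter. -/
theorem exists_inertia_drift (hm : ∀ i, 0 < m i) (hst : StabilityCondition m a b) :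
    ∃ c K : ℝ, 0 < c ∧ 0 ≤ K ∧ ∀ x : Config n,
      gen (jumpRate m a b) jumpTo (fun y => inertia m y.1) x ≤
        K - c * ∑ j : Fin n, (gaps x j : ℝ) := by
  have hM := sum_mass_pos m hm
  have hM' : 0 < M m (n + 1) := by rwa [M_last]
  -- `v` is the mean velocity of the center of mass. Subtracting it gives weights of total zero, as
  -- Abel summation requires.
  set v : ℝ := -(U m a b (n + 1) / M m (n + 1)) with hv
  set w : Fin (n + 1) → ℝ := fun j => m j * (b j - a j) - v * m j with hw
  have hv' : v * ∑ i, (m i : ℝ) = ∑ i, (m i : ℝ) * (b i - a i) := by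
    rw [hv, ← M_last, U_last]
    field_simp
  have hw0 : ∑ i, w i = 0 := by
    simp only [hw, Finset.sum_sub_distrib, ← Finset.mul_sum, hv', sub_self]
  have hpart : ∀ k, (∑ i : Fin (n + 1), if (i : ℕ) < k then w i else 0) =
      -U m a b k - v * M m k := by
    intro k
    unfold U M
    rw [neg_neg, Finset.mul_sum, ← Finset.sum_sub_distrib]
    refine Finset.sum_congr rfl fun i _ => ?_
    simp only [hw]
    split_ifs <;> simp
  -- The function minimized is `M_k * (U_N / M_N - U_k / M_k)` with `k = j + 1`; its positivity is
  -- the stability condition.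
  obtain ⟨c, hc0, -, hc⟩ := exists_pos_le_of_finite (S := Fin n) Set.finite_univ
    (f := fun j => -U m a b ((j : ℕ) + 1) - v * M m ((j : ℕ) + 1)) (fun j _ => by
      have h0 := M_pos m hm (k := (j : ℕ) + 1) (by omega)
      have h1 := hst ((j : ℕ) + 1) (by omega) (by omega)
      rw [div_lt_iff₀ h0] at h1
      simp only [hv]
      linarith)
  refine ⟨2 * c, ∑ j, (m j : ℝ) * (a j + b j), by positivity, by positivity, fun x => ?_⟩
  refine (gen_inertia_le m a b hm x).trans ?_
  have h1 : ∑ j, (m j : ℝ) * (b j - a j) * (x.1 j - center m x.1) = ∑ i, w i * (x.1 i : ℝ) := by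
    have h2 : ∑ j, (m j : ℝ) * (b j - a j) * center m x.1 = v * ∑ i, (m i : ℝ) * x.1 i := by
      rw [← Finset.sum_mul, ← hv', center]
      field_simp
    simp_rw [mul_sub _ _ (center m x.1), Finset.sum_sub_distrib, h2, hw, sub_mul,
      Finset.sum_sub_distrib, Finset.mul_sum]
    congr 1
    exact Finset.sum_congr rfl fun i _ => by ring
  rw [h1, sum_mul_val x w hw0]
  have h3 : c * ∑ j : Fin n, (gaps x j : ℝ) ≤
      ∑ j : Fin n, (gaps x j : ℝ) * ∑ i : Fin (n + 1), if (i : ℕ) < j + 1 then w i else 0 := by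
    rw [Finset.mul_sum]
    refine Finset.sum_le_sum fun j _ => ?_
    rw [hpart, mul_comm]
    exact mul_le_mul_of_nonneg_left (hc j (Set.mem_univ _)) (by positivity)
  linarith

theorem center_mem_Icc (hm : ∀ i, 0 < m i) (x : Config n) :
    (x.1 0 : ℝ) ≤ center m x.1 ∧ center m x.1 ≤ x.1 (Fin.last n) := by
  have hM := sum_mass_pos m hm
  unfold center
  rw [le_div_iff₀ hM, div_le_iff₀ hM, Finset.mul_sum, Finset.mul_sum]
  constructor
  · refine Finset.sum_le_sum fun i _ => ?_
    have : (x.1 0 : ℝ) ≤ x.1 i := by exact_mod_cast x.2 (Fin.zero_le i)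
    nlinarith [NNReal.coe_nonneg (m i)]
  · refine Finset.sum_le_sum fun i _ => ?_
    have : (x.1 i : ℝ) ≤ x.1 (Fin.last n) := by exact_mod_cast x.2 (Fin.le_last i)
    nlinarith [NNReal.coe_nonneg (m i)]

/-- Together with the lower bound below, this makes `√(1 + W)` comparable with the diameter. The
upper bound converts the drift; the lower one gives finite sublevel sets and the exponential moment.
-/
theorem inertia_le (hm : ∀ i, 0 < m i) (x : Config n) :
    inertia m x.1 ≤ (∑ i, (m i : ℝ)) * (∑ j : Fin n, (gaps x j : ℝ)) ^ 2 := by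
  rw [inertia_eq m hm, ← last_sub_zero, Finset.sum_mul]
  obtain ⟨h1, h2⟩ := center_mem_Icc m hm x
  refine Finset.sum_le_sum fun i _ => mul_le_mul_of_nonneg_left ?_ (by positivity)
  have h3 : (x.1 0 : ℝ) ≤ x.1 i := by exact_mod_cast x.2 (Fin.zero_le i)
  have h4 : (x.1 i : ℝ) ≤ x.1 (Fin.last n) := by exact_mod_cast x.2 (Fin.le_last i)
  exact sq_le_sq' (by linarith) (by linarith)

theorem exists_mul_sum_gaps_sq_le_inertia (hm : ∀ i, 0 < m i) :
    ∃ ε : ℝ, 0 < ε ∧ ∀ x : Config n, (ε * ∑ j : Fin n, (gaps x j : ℝ)) ^ 2 ≤ inertia m x.1 := by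
  obtain ⟨ε, h0, h1, h2⟩ := exists_pos_le_of_finite (S := Fin (n + 1)) Set.finite_univ
    (f := fun j => (m j : ℝ)) (fun j _ => by exact_mod_cast hm j)
  -- The diameter is the difference of the displacements of the last and the first particle from the
  -- center of mass. The factor `1 / 2` comes from `(u - v) ^ 2 ≤ 2 * u ^ 2 + 2 * v ^ 2`; below, `ε
  -- < 1` gives `ε ^ 2 ≤ ε ≤ m i`.
  refine ⟨ε / 2, by positivity, fun x => ?_⟩
  rw [← last_sub_zero]
  have key : ∀ i, (ε * (x.1 i - center m x.1)) ^ 2 ≤ inertia m x.1 := fun i => by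
    refine le_trans ?_ (mul_sq_le_inertia m hm x.1 i)
    rw [mul_pow]
    refine mul_le_mul_of_nonneg_right ?_ (sq_nonneg _)
    have := h2 i (Set.mem_univ _)
    nlinarith
  have h3 := key 0
  have h4 := key (Fin.last n)
  nlinarith [sq_nonneg (ε * (x.1 (Fin.last n) - center m x.1) + ε * (x.1 0 - center m x.1))]

end Drift

/-! ### Geometric stability of the uniformized chain of gaps -/

section Stable

variable {n : ℕ} (m a b : Fin (n + 1) → ℝ≥0)

/-- The uniformized transition operator of the chain of gaps. -/
def gapOp : Module.End ℝ (Gaps n → ℝ) :=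
  stepOp (gapRate m a b) gapTo fun _ => rateBound m a b

theorem gapRate_nonneg (q : Fin (n + 1) × Bool) (d : Gaps n) : 0 ≤ gapRate m a b q d :=
  jumpRate_nonneg m a b q _

theorem sum_gapRate_lt (d : Gaps n) : ∑ q, gapRate m a b q d < rateBound m a b := by
  unfold gapRate
  rw [sum_jumpRate]
  exact_mod_cast totalRate_lt_rateBound m a b _

theorem rateBound_pos : (0 : ℝ) < rateBound m a b := by
  exact_mod_cast one_pos.trans_le (one_le_rateBound m a b)

theorem isMarkovOp_gapOp : IsMarkovOp (gapOp m a b) :=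
  isMarkovOp_stepOp (gapRate_nonneg m a b) (fun _ => rateBound_pos m a b)
    fun d => (sum_gapRate_lt m a b d).le

theorem gaps_eq_zero_of_le {x : Config n} (h : x.1 (Fin.last n) ≤ x.1 0) : gaps x = 0 := by
  ext i
  have h1 := gaps_cast x i
  have h2 : x.1 i.succ ≤ x.1 (Fin.last n) := x.2 (Fin.le_last _)
  have h3 : x.1 0 ≤ x.1 i.castSucc := x.2 (Fin.zero_le _)
  simp only [Pi.zero_apply]
  omega

/-- Some particle pushes inwards at one of the ends. -/
theorem exists_inward_rate (hm : ∀ i, 0 < m i) (hn : 0 < n) (hst : StabilityCondition m a b) :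
    0 < b 0 ∨ 0 < a (Fin.last n) := by
  by_contra! hcon
  obtain ⟨hb, ha⟩ := hcon
  have hb : b 0 = 0 := le_antisymm hb zero_le
  have ha : a (Fin.last n) = 0 := le_antisymm ha zero_le
  have hM1 := M_pos m hm (k := 1) le_rfl
  have hMn := M_pos m hm (k := n) hn
  have hlt := M_lt_last m hm (k := n) le_rfl
  have h1 := hst 1 le_rfl hn
  have h2 := hst n hn le_rfl
  -- Without a push to the right from the first particle, `U_1 ≥ 0`, so stability at `1` forces `U_N
  -- > 0`. Without a push to the left from the last one, `U_n ≥ U_N`; dividing by the smaller mass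
  -- `M_n` contradicts stability at `n`.
  have hU1 : 0 ≤ U m a b 1 := by
    unfold U
    rw [neg_nonneg]
    refine Finset.sum_nonpos fun i _ => ?_
    split_ifs with hi
    · have : i = 0 := Fin.ext (by rw [Fin.val_zero]; omega)
      subst this
      rw [hb]
      simp only [NNReal.coe_zero, zero_sub, mul_neg, Left.neg_nonpos_iff]
      positivity
    · exact le_rfl
  have hUn : U m a b (n + 1) ≤ U m a b n := by
    rw [U_last]
    unfold U
    refine neg_le_neg (Finset.sum_le_sum fun i _ => ?_)
    split_ifs with hi
    · exact le_rfl
    · have : i = Fin.last n := Fin.ext (by simp; omega)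
      subst this
      rw [ha]
      simp only [NNReal.coe_zero, sub_zero]
      positivity
  have hUN : 0 < U m a b (n + 1) := by
    have h3 : 0 < U m a b (n + 1) / M m (n + 1) := lt_of_le_of_lt (div_nonneg hU1 hM1.le) h1
    exact (div_pos_iff_of_pos_right (hMn.trans hlt)).1 h3
  have h4 : U m a b (n + 1) / M m (n + 1) ≤ U m a b (n + 1) / M m n :=
    div_le_div_of_nonneg_left hUN.le hMn hlt.le
  have h5 : U m a b (n + 1) / M m n ≤ U m a b n / M m n := by gcongr
  linarith

theorem reach_of_jump {q : Fin (n + 1) × Bool} {x : Config n} (h : jumpRate m a b q x ≠ 0)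
    (hr : ∃ k : ℕ, 0 < (gapOp m a b ^ k) (Pi.single (0 : Gaps n) 1) (gaps (jumpTo q x))) :
    ∃ k : ℕ, 0 < (gapOp m a b ^ k) (Pi.single (0 : Gaps n) 1) (gaps x) := by
  obtain ⟨k, hk⟩ := hr
  refine ⟨k + 1, ?_⟩
  rw [pow_succ', Module.End.mul_apply]
  rw [gaps_jumpTo] at hk
  rw [jumpRate_eq_gapRate] at h
  exact stepOp_pos_of_target (gapRate_nonneg m a b) (fun _ => rateBound_pos m a b)
    (fun d => (sum_gapRate_lt m a b d).le)
    (((isMarkovOp_gapOp m a b).pow k).nonneg _ (Pi.single_nonneg.2 zero_le_one)) q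
    (lt_of_le_of_ne (gapRate_nonneg m a b q _) (Ne.symm h)) hk

/-- The push of the first particle always moves the right-most particle of its cluster. While the
configuration is not a single cluster, this jump lowers the total distance to the last particle by
one. -/
theorem reach_of_first (hm : ∀ i, 0 < m i) (hb : 0 < b 0) (N : ℕ) (x : Config n)
    (hN : ∑ j, (x.1 (Fin.last n) - x.1 j) ≤ N) :
    ∃ k : ℕ, 0 < (gapOp m a b ^ k) (Pi.single (0 : Gaps n) 1) (gaps x) := by
  induction N generalizing x with
  | zero =>
    have hle : x.1 (Fin.last n) - x.1 0 ≤ 0 := by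
      refine le_trans ?_ hN
      exact Finset.single_le_sum (f := fun j => x.1 (Fin.last n) - x.1 j)
        (fun j _ => sub_nonneg.2 (x.2 (Fin.le_last j))) (Finset.mem_univ 0)
    exact ⟨0, by simp [gaps_eq_zero_of_le (sub_nonpos.1 hle)]⟩
  | succ N ih =>
    by_cases h0 : x.1 (Fin.last n) ≤ x.1 0
    · exact ⟨0, by simp [gaps_eq_zero_of_le h0]⟩
    obtain ⟨lead, hlead, hsum⟩ := exists_right_lead m b hm x
    set i := lead 0 with hi
    have hrate : rightRate m b i x ≠ 0 := by
      intro hzero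
      -- Testing the summation formula on the indicator of `i` shows that `i` receives at least `m 0
      -- * b 0`.
      have h1 := hsum fun j => if j = i then 1 else 0
      rw [Finset.sum_eq_zero (fun j _ => by by_cases hj : j = i <;> simp [hj, hzero])] at h1
      have h2 : (m 0 : ℝ) * b 0 * (if lead 0 = i then 1 else 0) ≤
          ∑ j, (m j : ℝ) * b j * (if lead j = i then 1 else 0) :=
        Finset.single_le_sum (f := fun j => (m j : ℝ) * b j * (if lead j = i then 1 else 0))
          (fun j _ => by positivity) (Finset.mem_univ 0)
      rw [← h1, if_pos hi.symm, mul_one] at h2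
      have : (0 : ℝ) < m 0 * b 0 := by exact_mod_cast mul_pos (hm 0) hb
      linarith
    have hil : Fin.last n ≠ i := by
      intro h
      have := (hlead 0).2
      rw [← hi, ← h] at this
      omega
    have hq : jumpRate m a b (i, true) x ≠ 0 := by simpa [jumpRate] using hrate
    refine reach_of_jump m a b hq (ih _ ?_)
    rw [jumpTo_val m a b hq]
    simp only [if_true, Pi.add_apply, Pi.single_eq_of_ne hil, add_zero, ← sub_sub,
      Finset.sum_sub_distrib] at hN ⊢
    simp only [Finset.mem_univ, if_true, Pi.single_apply, Finset.sum_ite_eq']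
    push_cast at hN
    linarith

theorem reach_of_last (hm : ∀ i, 0 < m i) (ha : 0 < a (Fin.last n)) (N : ℕ) (x : Config n)
    (hN : ∑ j, (x.1 j - x.1 0) ≤ N) :
    ∃ k : ℕ, 0 < (gapOp m a b ^ k) (Pi.single (0 : Gaps n) 1) (gaps x) := by
  induction N generalizing x with
  | zero =>
    have hle : x.1 (Fin.last n) - x.1 0 ≤ 0 := by
      refine le_trans ?_ hN
      exact Finset.single_le_sum (f := fun j => x.1 j - x.1 0)
        (fun j _ => sub_nonneg.2 (x.2 (Fin.zero_le j))) (Finset.mem_univ (Fin.last n))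
    exact ⟨0, by simp [gaps_eq_zero_of_le (sub_nonpos.1 hle)]⟩
  | succ N ih =>
    by_cases h0 : x.1 (Fin.last n) ≤ x.1 0
    · exact ⟨0, by simp [gaps_eq_zero_of_le h0]⟩
    obtain ⟨lead, hlead, hsum⟩ := exists_left_lead m a hm x
    set i := lead (Fin.last n) with hi
    have hrate : leftRate m a i x ≠ 0 := by
      intro hzero
      have h1 := hsum fun j => if j = i then 1 else 0
      rw [Finset.sum_eq_zero (fun j _ => by by_cases hj : j = i <;> simp [hj, hzero])] at h1
      have h2 : (m (Fin.last n) : ℝ) * a (Fin.last n) * (if lead (Fin.last n) = i then 1 else 0) ≤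
          ∑ j, (m j : ℝ) * a j * (if lead j = i then 1 else 0) :=
        Finset.single_le_sum (f := fun j => (m j : ℝ) * a j * (if lead j = i then 1 else 0))
          (fun j _ => by positivity) (Finset.mem_univ (Fin.last n))
      rw [← h1, if_pos hi.symm, mul_one] at h2
      have : (0 : ℝ) < m (Fin.last n) * a (Fin.last n) := by
        exact_mod_cast mul_pos (hm (Fin.last n)) ha
      linarith
    have hil : 0 ≠ i := by
      intro h
      have := (hlead (Fin.last n)).2
      rw [← hi, ← h] at this
      omega
    have hq : jumpRate m a b (i, false) x ≠ 0 := by simpa [jumpRate] using hrate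
    refine reach_of_jump m a b hq (ih _ ?_)
    rw [jumpTo_val m a b hq]
    simp only [Bool.false_eq_true, if_false, Pi.add_apply, Pi.single_eq_of_ne hil, add_zero,
      Finset.sum_sub_distrib, Finset.sum_add_distrib] at hN ⊢
    simp only [Pi.single_apply, Finset.sum_ite_eq', Finset.mem_univ, if_true]
    push_cast at hN
    linarith

theorem exists_reach_zero (hm : ∀ i, 0 < m i) (hst : StabilityCondition m a b) (d : Gaps n) :
    ∃ k : ℕ, 0 < (gapOp m a b ^ k) (Pi.single (0 : Gaps n) 1) d := by
  rcases Nat.eq_zero_or_pos n with hn | hn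
  · subst hn
    exact ⟨0, by simp [Subsingleton.elim d 0]⟩
  · rw [← gaps_place d]
    rcases exists_inward_rate m a b hm hn hst with h | h
    · exact reach_of_first m a b hm h _ _ (Int.self_le_toNat _)
    · exact reach_of_last m a b hm h _ _ (Int.self_le_toNat _)

/-- Under the stability condition the uniformized chain of gaps has a Lyapunov function of
exponential growth. -/
theorem exists_isGeomStable (hm : ∀ i, 0 < m i) (hst : StabilityCondition m a b) :
    ∃ (V : Gaps n → ℝ) (δ : ℝ), 0 < δ ∧ IsGeomStable (gapOp m a b) V 0 ∧
      ∀ d, Real.exp (δ * ∑ i : Fin n, (d i : ℝ)) ≤ V d := by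
  classical
  obtain ⟨c, K, hc, hK, hdrift⟩ := exists_inertia_drift m a b hm hst
  obtain ⟨ε, hε, hlow⟩ := exists_mul_sum_gaps_sq_le_inertia m hm
  have hM := sum_mass_pos m hm
  set Mt := ∑ i, (m i : ℝ) with hMt
  have hΛ := rateBound_pos m a b
  set W : Gaps n → ℝ := fun d => inertia m (place d).1 with hW
  have hWgaps : ∀ x : Config n, W (gaps x) = inertia m x.1 := by
    intro x
    rw [eq_shift_of_gaps_eq (x := place (gaps x)) (y := x) (by simp), inertia_shift m hm]
    simp [hW]
  have hW0 : ∀ d, 0 ≤ W d := fun d => inertia_nonneg m hm _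
  have hgenW : ∀ d, gen (gapRate m a b) gapTo W d ≤ K - c * ∑ j : Fin n, (d j : ℝ) := by
    intro d
    have h1 := hdrift (place d)
    have h2 := gen_comp_gaps m a b W (place d)
    rw [gaps_place] at h1 h2
    rw [← h2]
    simp_rw [hWgaps]
    exact h1
  have hsqrt : ∀ d : Gaps n, √(1 + W d) ≤ 1 + √Mt * ∑ j : Fin n, (d j : ℝ) := by
    intro d
    have h1 := inertia_le m hm (place d)
    rw [gaps_place] at h1
    refine Real.sqrt_le_iff.2 ⟨by positivity, ?_⟩
    have h2 : √Mt ^ 2 = Mt := Real.sq_sqrt hM.le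
    have h3 : 0 ≤ √Mt * ∑ j : Fin n, (d j : ℝ) := by positivity
    have h4 : W d ≤ Mt * (∑ j : Fin n, (d j : ℝ)) ^ 2 := h1
    nlinarith
  have hsM : 0 < √Mt := Real.sqrt_pos.2 hM
  -- A jump changes `W` by `±2 * m * y` plus a term between `0` and the total mass `Mt`, and each of
  -- `m * y` and that term is at most `(1 + Mt) * √(1 + W)`; hence `K₁`. The drift constants come
  -- from `√(1 + W) ≤ 1 + √Mt * diameter`.
  obtain ⟨δ, κ, C, hδ, hκ, hC, hV⟩ := exists_exp_drift (W := W) (r := gapRate m a b) (τ := gapTo)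
    (Λ := rateBound m a b) (K₁ := 3 * (1 + Mt)) (K := K + c / √Mt) (c := c / √Mt)
    (gapRate_nonneg m a b) (fun d => (sum_gapRate_lt m a b d).le) hΛ (by positivity)
    (by positivity) (by positivity) hW0 (by
      intro q d hq
      have hg1 : 1 ≤ √(1 + W d) := Real.one_le_sqrt.2 (by linarith [hW0 d])
      set g := √(1 + W d) with hg
      have hgsq : g ^ 2 = 1 + W d := Real.sq_sqrt (by linarith [hW0 d])
      set x := place d with hx
      set y : ℝ := x.1 q.1 - center m x.1 with hy
      have hmq : (m q.1 : ℝ) ≤ Mt :=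
        Finset.single_le_sum (f := fun i => (m i : ℝ)) (fun j _ => by positivity)
          (Finset.mem_univ q.1)
      have h1 : |(m q.1 : ℝ) * y| ≤ (1 + Mt) * g := by
        refine abs_le_of_sq_le_sq ?_ (by positivity)
        have h2 : (m q.1 : ℝ) * y ^ 2 ≤ W d := mul_sq_le_inertia m hm x.1 q.1
        have hm0 : (0 : ℝ) ≤ m q.1 := by positivity
        calc ((m q.1 : ℝ) * y) ^ 2 = m q.1 * (m q.1 * y ^ 2) := by ring
          _ ≤ Mt * g ^ 2 := by
            refine mul_le_mul hmq (by linarith) (by positivity) hM.le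
          _ ≤ ((1 + Mt) * g) ^ 2 := by
            rw [mul_pow]
            refine mul_le_mul_of_nonneg_right ?_ (sq_nonneg _)
            nlinarith
      have h3 : W (gapTo q d) - W d =
          inertia m (x.1 + Pi.single q.1 (if q.2 then 1 else -1)) - inertia m x.1 := by
        rw [gapTo, hWgaps, jumpTo_val m a b hq]
      rw [h3, inertia_add_single m hm]
      have h4 : 0 ≤ (m q.1 : ℝ) ^ 2 / ∑ i, (m i : ℝ) := by positivity
      have h5 : (m q.1 : ℝ) ^ 2 / ∑ i, (m i : ℝ) ≤ m q.1 := by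
        rw [div_le_iff₀ hM, sq]
        exact mul_le_mul_of_nonneg_left hmq (by positivity)
      have h6 := abs_le.1 h1
      have h7 : Mt ≤ (1 + Mt) * g := by nlinarith
      have h8 : |(m q.1 : ℝ) - (m q.1 : ℝ) ^ 2 / ∑ i, (m i : ℝ)| ≤ (1 + Mt) * g := by
        rw [abs_of_nonneg (by linarith)]
        linarith
      have h9 := abs_le.1 h8
      rw [abs_le]
      split_ifs <;> push_cast <;> constructor <;> nlinarith) (by
      intro d
      refine (hgenW d).trans ?_
      have h1 := mul_le_mul_of_nonneg_left (hsqrt d) (show 0 ≤ c / √Mt by positivity)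
      have h2 : c / √Mt * (1 + √Mt * ∑ j : Fin n, (d j : ℝ)) =
          c / √Mt + c * ∑ j : Fin n, (d j : ℝ) := by field_simp
      linarith)
  set V : Gaps n → ℝ := fun d => Real.exp (δ * √(1 + W d)) with hVdef
  have hVlow : ∀ d, Real.exp (δ * ε * ∑ i : Fin n, (d i : ℝ)) ≤ V d := by
    intro d
    have h1 := hlow (place d)
    rw [gaps_place] at h1
    have h2 : ε * ∑ i : Fin n, (d i : ℝ) ≤ √(1 + W d) := by
      refine Real.le_sqrt_of_sq_le (h1.trans ?_)
      change W d ≤ _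
      linarith
    simp only [hVdef, mul_assoc]
    gcongr
  refine ⟨V, δ * ε, by positivity, ⟨isMarkovOp_gapOp m a b, fun d => (Real.exp_pos _).le, ?_, ?_,
    ?_, fun d => ?_⟩, hVlow⟩
  -- The maximum with `0` is taken because `κ` is not known to be at most the uniformization rate.
  · refine ⟨max (1 - κ / rateBound m a b) 0, C / rateBound m a b, le_max_right _ _, ?_,
      by positivity, fun d => ?_⟩
    · have : 0 < κ / rateBound m a b := by positivity
      exact max_lt (by linarith) one_pos
    · have hVd : 0 < V d := Real.exp_pos _
      have h1 : gapOp m a b V d ≤ V d + (-κ * V d + C) / rateBound m a b := by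
        unfold gapOp
        rw [stepOp_apply]
        gcongr
        exact hV d
      have h2 := mul_le_mul_of_nonneg_right (le_max_left (1 - κ / rateBound m a b) 0) hVd.le
      refine h1.trans ?_
      calc V d + (-κ * V d + C) / rateBound m a b
          = (1 - κ / rateBound m a b) * V d + C / rateBound m a b := by ring
        _ ≤ _ := by linarith
  · intro R
    refine (Set.finite_Iic (fun _ : Fin n => ⌈R / (δ * ε)⌉₊)).subset fun d hd i => ?_
    have h1 : δ * ε * ∑ i : Fin n, (d i : ℝ) ≤ R := by
      have := Real.add_one_le_exp (δ * ε * ∑ i : Fin n, (d i : ℝ))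
      have hd' : V d ≤ R := hd
      linarith [hVlow d]
    have h2 : (d i : ℝ) ≤ ∑ i : Fin n, (d i : ℝ) :=
      Finset.single_le_sum (f := fun i => (d i : ℝ)) (fun _ _ => by positivity) (Finset.mem_univ i)
    have h3 : (d i : ℝ) ≤ R / (δ * ε) := by
      rw [le_div_iff₀ (by positivity)]
      nlinarith [mul_pos hδ hε]
    exact_mod_cast h3.trans (Nat.le_ceil _)
  · intro f hf d hd
    exact stepOp_pos_of_pos (gapRate_nonneg m a b) (fun _ => hΛ) (sum_gapRate_lt m a b) hf hd
  · convert exists_reach_zero m a b hm hst d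

end Stable

/-! ### The path law: decomposition at the first jump -/

section PathSpace

variable {E : Type*}

/-- Put a new initial entry in front of a sequence. -/
def cons (e : E) (ω : ℕ → E) : ℕ → E := fun k => Nat.casesOn k e ω

@[simp] theorem cons_zero (e : E) (ω : ℕ → E) : cons e ω 0 = e := rfl

@[simp] theorem cons_succ (e : E) (ω : ℕ → E) (k : ℕ) : cons e ω (k + 1) = ω k := rfl

variable [MeasurableSpace E]

theorem measurable_cons : Measurable fun p : E × (ℕ → E) => cons p.1 p.2 := by
  rw [measurable_pi_iff]
  intro k
  cases k with
  | zero => exact measurable_fst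
  | succ k => exact (measurable_pi_apply k).comp measurable_snd

open Preorder in
/-- Laws of sequences are determined by the initial law and the transition kernels. -/
theorem path_measure_ext {ν ν' : Measure (ℕ → E)} [IsProbabilityMeasure ν]
    [IsProbabilityMeasure ν']
    (κ : (k : ℕ) → Kernel ((i : Finset.Iic k) → (fun _ : ℕ => E) i) E)
    (h0 : ν.map (fun ω => ω 0) = ν'.map (fun ω => ω 0))
    (h : ∀ k, ν.map (frestrictLe (π := fun _ : ℕ => E) k) ⊗ₘ κ k =
      ν.map (fun ω => (frestrictLe (π := fun _ : ℕ => E) k ω, ω (k + 1))))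
    (h' : ∀ k, ν'.map (frestrictLe (π := fun _ : ℕ => E) k) ⊗ₘ κ k =
      ν'.map (fun ω => (frestrictLe (π := fun _ : ℕ => E) k ω, ω (k + 1)))) : ν = ν' := by
  have key : ∀ k, ν.map (frestrictLe (π := fun _ : ℕ => E) k) =
      ν'.map (frestrictLe (π := fun _ : ℕ => E) k) := by
    intro k
    induction k with
    | zero =>
      have h1 : frestrictLe (π := fun _ : ℕ => E) 0 =
          (fun (e : E) (_ : Finset.Iic 0) => e) ∘ fun ω : ℕ → E => ω 0 := by
        funext ω i
        obtain ⟨i, hi⟩ := i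
        have : i = 0 := by simpa using hi
        subst this
        rfl
      have h2 : Measurable (fun (e : E) (_ : Finset.Iic 0) => e) := by fun_prop
      rw [h1, ← Measure.map_map h2 (by fun_prop), ← Measure.map_map h2 (by fun_prop), h0]
    | succ k ih =>
      let Ψ : ((i : Finset.Iic k) → (fun _ : ℕ => E) i) × E →
          ((i : Finset.Iic (k + 1)) → (fun _ : ℕ => E) i) :=
        fun p i => if hi : (i : ℕ) ≤ k then p.1 ⟨i, Finset.mem_Iic.2 hi⟩ else p.2
      have hΨ : Measurable Ψ := by
        rw [measurable_pi_iff]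
        intro i
        by_cases hi : (i : ℕ) ≤ k
        · simp only [Ψ, hi, dif_pos]
          exact (measurable_pi_apply _).comp measurable_fst
        · simp only [Ψ, hi, dif_neg, not_false_eq_true]
          exact measurable_snd
      have h1 : frestrictLe (π := fun _ : ℕ => E) (k + 1) =
          Ψ ∘ fun ω : ℕ → E => (frestrictLe (π := fun _ : ℕ => E) k ω, ω (k + 1)) := by
        funext ω i
        obtain ⟨i, hi⟩ := i
        by_cases hik : i ≤ k
        · simp [Ψ, hik]
        · have : i = k + 1 := by
            have := Finset.mem_Iic.1 hi
            omega
          subst this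
          simp [Ψ]
      rw [h1, ← Measure.map_map hΨ (by fun_prop), ← Measure.map_map hΨ (by fun_prop), ← h, ← h', ih]
  -- Every finite set of times lies in an initial segment, so equality on initial segments
  -- identifies the two projective limits.
  have hlim : ∀ μ : Measure (ℕ → E), (∀ k, ν.map (frestrictLe (π := fun _ : ℕ => E) k) =
      μ.map (frestrictLe (π := fun _ : ℕ => E) k)) →
      IsProjectiveLimit (α := fun _ : ℕ => E) μ (fun I => ν.map I.restrict) := by
    intro μ hμ I
    have h1 : I.restrict (π := fun _ : ℕ => E) =
        Finset.restrict₂ (π := fun _ : ℕ => E) I.subset_Iic_sup_id ∘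
          frestrictLe (π := fun _ : ℕ => E) (I.sup id) := rfl
    change μ.map (I.restrict (π := fun _ : ℕ => E)) = ν.map (I.restrict (π := fun _ : ℕ => E))
    rw [h1, ← Measure.map_map (Finset.measurable_restrict₂ _) (measurable_frestrictLe _),
      ← Measure.map_map (Finset.measurable_restrict₂ _) (measurable_frestrictLe _), hμ]
  have : ∀ I : Finset ℕ, IsFiniteMeasure (ν.map (I.restrict (π := fun _ : ℕ => E))) :=
    fun I => inferInstance
  exact (hlim ν fun _ => rfl).unique (hlim ν' key)

end PathSpace

/-! ### The law of the particle system as a first entry followed by a restarted path -/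

section Law

variable {n : ℕ} (m a b : Fin (n + 1) → ℝ≥0)

instance isProbabilityMeasure_law (x : Config n) : IsProbabilityMeasure (law m a b x) := by
  unfold law; infer_instance

theorem law_map_zero (x : Config n) : (law m a b x).map (fun ω => ω 0) = enterLaw m a b x := by
  unfold law Kernel.trajMeasure
  have h1 : (fun ω : Path n => ω 0) =
      (fun h : (i : Finset.Iic 0) → (fun _ : ℕ => Config n × ℝ) i => h ⟨0, by simp⟩) ∘
        Preorder.frestrictLe (π := fun _ : ℕ => Config n × ℝ) 0 := rfl
  rw [h1, ← Measure.map_map (by fun_prop) (by fun_prop), Measure.map_comp _ _ (by fun_prop),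
    Kernel.traj_map_frestrictLe, Kernel.partialTraj_self, Measure.id_comp,
    Measure.map_map (by fun_prop) (by fun_prop)]
  convert Measure.map_id
  funext e
  exact (MeasurableEquiv.piUnique
    fun i : Finset.Iic 0 => (fun _ : ℕ => Config n × ℝ) i).apply_symm_apply e

theorem measurable_law : Measurable (law m a b) := measurable_of_countable _

theorem lintegral_stepKernel (x : Config n) (s : ℝ) {g : Config n × ℝ → ℝ≥0∞}
    (hg : Measurable g) :
    ∫⁻ e, g e ∂stepKernel m a b (x, s) =
      ∫⁻ y, ∫⁻ e, g e ∂enterLaw m a b y ∂jumpLaw m a b x := by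
  unfold stepKernel
  rw [Kernel.comap_apply, Kernel.lintegral_comp _ _ _ hg]
  rfl

theorem lintegral_enterLaw (x : Config n) {g : Config n × ℝ → ℝ≥0∞} (hg : Measurable g) :
    ∫⁻ e, g e ∂enterLaw m a b x = ∫⁻ s, g (x, s) ∂expMeasure (holdRate m a b x) := by
  have := isProbabilityMeasure_expMeasure (holdRate_pos m a b x)
  unfold enterLaw
  rw [lintegral_prod _ hg.aemeasurable, lintegral_dirac' _ hg.lintegral_prod_right']

/-- The law of a path built from a first entry at `x` and a path started after a jump from `x`. -/
def consLaw (x : Config n) : Measure (Path n) :=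
  ((enterLaw m a b x).prod ((jumpLaw m a b x).bind (law m a b))).map fun p => cons p.1 p.2

instance isProbabilityMeasure_bind_law (x : Config n) :
    IsProbabilityMeasure ((jumpLaw m a b x).bind (law m a b)) :=
  isProbabilityMeasure_bind (measurable_law m a b).aemeasurable
    (Filter.Eventually.of_forall fun _ => inferInstance)

instance isProbabilityMeasure_consLaw (x : Config n) : IsProbabilityMeasure (consLaw m a b x) :=
  Measure.isProbabilityMeasure_map measurable_cons.aemeasurable

theorem lintegral_consLaw (x : Config n) {F : Path n → ℝ≥0∞} (hF : Measurable F) :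
    ∫⁻ ω, F ω ∂consLaw m a b x = ∫⁻ s, ∫⁻ y, ∫⁻ ω, F (cons (x, s) ω) ∂law m a b y
      ∂jumpLaw m a b x ∂expMeasure (holdRate m a b x) := by
  have hFc : Measurable fun p : (Config n × ℝ) × Path n => F (cons p.1 p.2) :=
    hF.comp measurable_cons
  unfold consLaw
  rw [lintegral_map hF measurable_cons, lintegral_prod _ hFc.aemeasurable,
    lintegral_enterLaw m a b x hFc.lintegral_prod_right']
  refine lintegral_congr fun s => ?_
  exact Measure.lintegral_bind (measurable_law m a b).aemeasurable
    (hFc.comp measurable_prodMk_left).aemeasurable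

/-- The Markov property in terms of test functions of the path, a form in which the first entry can
be split off. -/
theorem compProd_pastKernel_iff (ν : Measure (Path n)) [IsProbabilityMeasure ν] (k : ℕ) :
    ν.map (Preorder.frestrictLe (π := fun _ : ℕ => Config n × ℝ) k) ⊗ₘ pastKernel m a b k =
      ν.map (fun ω => (Preorder.frestrictLe (π := fun _ : ℕ => Config n × ℝ) k ω, ω (k + 1))) ↔
    ∀ f : ((i : Finset.Iic k) → (fun _ : ℕ => Config n × ℝ) i) × (Config n × ℝ) → ℝ≥0∞,
      Measurable f → ∫⁻ ω, ∫⁻ e, f (Preorder.frestrictLe (π := fun _ : ℕ => Config n × ℝ) k ω, e)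
        ∂stepKernel m a b (ω k) ∂ν =
      ∫⁻ ω, f (Preorder.frestrictLe (π := fun _ : ℕ => Config n × ℝ) k ω, ω (k + 1)) ∂ν := by
  have hm1 : Measurable (fun ω : Path n =>
      (Preorder.frestrictLe (π := fun _ : ℕ => Config n × ℝ) k ω, ω (k + 1))) := by fun_prop
  have h1 : ∀ f : ((i : Finset.Iic k) → (fun _ : ℕ => Config n × ℝ) i) × (Config n × ℝ) → ℝ≥0∞,
      Measurable f → ∫⁻ p, f p ∂(ν.map (Preorder.frestrictLe (π := fun _ : ℕ => Config n × ℝ) k) ⊗ₘ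
        pastKernel m a b k) =
      ∫⁻ ω, ∫⁻ e, f (Preorder.frestrictLe (π := fun _ : ℕ => Config n × ℝ) k ω, e)
        ∂stepKernel m a b (ω k) ∂ν := by
    intro f hf
    rw [Measure.lintegral_compProd hf, lintegral_map (hf.lintegral_kernel_prod_right')
      (by fun_prop)]
    rfl
  constructor
  · intro h f hf
    rw [← h1 f hf, h, lintegral_map hf hm1]
  · intro h
    refine Measure.ext_of_lintegral _ fun f hf => ?_
    rw [h1 f hf, h f hf, lintegral_map hf hm1]

/-- Decomposition of the path at the first jump. -/
theorem law_eq_consLaw (x : Config n) : law m a b x = consLaw m a b x := by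
  have hlaw : ∀ y k, (law m a b y).map
      (Preorder.frestrictLe (π := fun _ : ℕ => Config n × ℝ) k) ⊗ₘ pastKernel m a b k =
      (law m a b y).map
        (fun ω => (Preorder.frestrictLe (π := fun _ : ℕ => Config n × ℝ) k ω, ω (k + 1))) :=
    fun y k => Kernel.map_frestrictLe_trajMeasure_compProd_eq_map_trajMeasure
  refine path_measure_ext (pastKernel m a b) ?_ (hlaw x) fun k => ?_
  · rw [law_map_zero]
    unfold consLaw
    rw [Measure.map_map (measurable_pi_apply 0) measurable_cons]
    exact Measure.fst_prod.symm
  · rw [compProd_pastKernel_iff]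
    intro f hf
    have hker : Measurable fun ω : Path n =>
        ∫⁻ e, f (Preorder.frestrictLe (π := fun _ : ℕ => Config n × ℝ) k ω, e)
          ∂stepKernel m a b (ω k) := by
      have h1 : Measurable fun p : Path n × (Config n × ℝ) =>
          f (Preorder.frestrictLe (π := fun _ : ℕ => Config n × ℝ) k p.1, p.2) := by fun_prop
      exact Measurable.lintegral_kernel_prod_right' (κ := (stepKernel m a b).comap
        (fun ω : Path n => ω k) (measurable_pi_apply k)) h1
    rw [lintegral_consLaw m a b x hker, lintegral_consLaw m a b x (by fun_prop)]
    refine lintegral_congr fun s => ?_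
    -- For the first transition the restarted path supplies its own entry law. Later transitions are
    -- those of the restarted path, one index earlier, with the past rebuilt by `Ψ`.
    cases k with
    | zero =>
      have hconst : ∀ ω : Path n, Preorder.frestrictLe (π := fun _ : ℕ => Config n × ℝ) 0
          (cons (x, s) ω) = fun _ => (x, s) := by
        intro ω
        funext i
        obtain ⟨i, hi⟩ := i
        have : i = 0 := by simpa using hi
        subst this
        rfl
      simp only [hconst, cons_zero, cons_succ, lintegral_const, measure_univ, mul_one]
      rw [lintegral_stepKernel m a b x s (by fun_prop)]
      refine lintegral_congr fun y => ?_
      rw [← law_map_zero, lintegral_map (by fun_prop) (by fun_prop)]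
    | succ k =>
      refine lintegral_congr fun y => ?_
      let Ψ : ((i : Finset.Iic k) → (fun _ : ℕ => Config n × ℝ) i) →
          ((i : Finset.Iic (k + 1)) → (fun _ : ℕ => Config n × ℝ) i) := fun h i =>
        if hi : (i : ℕ) = 0 then (x, s) else h ⟨(i : ℕ) - 1, by
          have := Finset.mem_Iic.1 i.2
          rw [Finset.mem_Iic]; omega⟩
      have hΨ : Measurable Ψ := by
        rw [measurable_pi_iff]
        intro i
        by_cases hi : (i : ℕ) = 0
        · simp only [Ψ, hi, dif_pos]
          exact measurable_const
        · simp only [Ψ, hi, dif_neg, not_false_eq_true]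
          exact measurable_pi_apply _
      have hcons : ∀ ω : Path n, Preorder.frestrictLe (π := fun _ : ℕ => Config n × ℝ) (k + 1)
          (cons (x, s) ω) = Ψ (Preorder.frestrictLe (π := fun _ : ℕ => Config n × ℝ) k ω) := by
        intro ω
        funext i
        obtain ⟨i, hi⟩ := i
        cases i with
        | zero => rfl
        | succ i => rfl
      simp only [hcons, cons_succ]
      exact (compProd_pastKernel_iff m a b (law m a b y) k).1 (hlaw y k)
        (fun p => f (Ψ p.1, p.2)) (by fun_prop)

theorem lintegral_law (x : Config n) {F : Path n → ℝ≥0∞} (hF : Measurable F) :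
    ∫⁻ ω, F ω ∂law m a b x = ∫⁻ s, ∫⁻ y, ∫⁻ ω, F (cons (x, s) ω) ∂law m a b y
      ∂jumpLaw m a b x ∂expMeasure (holdRate m a b x) := by
  rw [law_eq_consLaw m a b x, lintegral_consLaw m a b x hF]

end Law

/-! ### Exponential holding times -/

section Exponential

theorem expMeasure_real_Iic {q : ℝ} (hq : 0 < q) {t : ℝ} (ht : 0 ≤ t) :
    (expMeasure q).real (Set.Iic t) = 1 - Real.exp (-(q * t)) := by
  have := isProbabilityMeasure_expMeasure hq
  rw [← cdf_eq_real, cdf_expMeasure_eq hq, if_pos ht]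

theorem expMeasure_real_Ioi {q : ℝ} (hq : 0 < q) {t : ℝ} (ht : 0 ≤ t) :
    (expMeasure q).real (Set.Ioi t) = Real.exp (-(q * t)) := by
  have := isProbabilityMeasure_expMeasure hq
  rw [← Set.compl_Iic, probReal_compl_eq_one_sub measurableSet_Iic, expMeasure_real_Iic hq ht]
  ring

theorem ae_pos_expMeasure {q : ℝ} (hq : 0 < q) : ∀ᵐ s ∂expMeasure q, 0 < s := by
  have := isProbabilityMeasure_expMeasure hq
  have h := expMeasure_real_Iic hq le_rfl
  rw [mul_zero, neg_zero, Real.exp_zero, sub_self, measureReal_eq_zero_iff] at h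
  rw [ae_iff]
  convert h using 2
  ext s; simp

theorem measurable_gammaPDF (p q : ℝ) : Measurable (gammaPDF p q) :=
  (measurable_gammaPDFReal p q).ennreal_ofReal

theorem lintegral_expMeasure {q : ℝ} {f : ℝ → ℝ≥0∞} (hf : Measurable f) :
    ∫⁻ s, f s ∂expMeasure q = ∫⁻ s, exponentialPDF q s * f s := by
  unfold expMeasure gammaMeasure
  rw [lintegral_withDensity_eq_lintegral_mul _ (measurable_gammaPDF 1 q) hf]
  rfl

/-- Weighting the exponential density by `s` gives `1 / q` times the gamma density of shape `2`,
which has mass one. -/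
theorem lintegral_ofReal_expMeasure {q : ℝ} (hq : 0 < q) :
    ∫⁻ s, ENNReal.ofReal s ∂expMeasure q = ENNReal.ofReal (1 / q) := by
  rw [lintegral_expMeasure (by fun_prop)]
  have h : ∀ s, exponentialPDF q s * ENNReal.ofReal s =
      ENNReal.ofReal (1 / q) * gammaPDF 2 q s := by
    intro s
    rcases lt_or_ge s 0 with hs | hs
    · rw [exponentialPDF_of_neg hs, gammaPDF_of_neg hs]; simp
    · rw [exponentialPDF_of_nonneg hs, gammaPDF_of_nonneg hs, ← ENNReal.ofReal_mul (by positivity),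
        ← ENNReal.ofReal_mul (by positivity)]
      congr 1
      have h2 : Real.Gamma 2 = 1 := Real.Gamma_two
      have h3 : s ^ ((2 : ℝ) - 1) = s := by norm_num
      rw [h2, h3, Real.rpow_two]
      field_simp
  simp_rw [h]
  rw [lintegral_const_mul _ (measurable_gammaPDF 2 q),
    lintegral_gammaPDF_eq_one two_pos hq, mul_one]

theorem setIntegral_Iic_expMeasure {q : ℝ} (hq : 0 < q) {t : ℝ} (ht : 0 ≤ t) (h : ℝ → ℝ) :
    ∫ s in Set.Iic t, h s ∂expMeasure q = ∫ s in (0)..t, q * Real.exp (-(q * s)) * h s := by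
  unfold expMeasure gammaMeasure
  rw [setIntegral_withDensity_eq_setIntegral_toReal_smul
    (measurable_gammaPDF 1 q) (Filter.Eventually.of_forall fun s =>
      ENNReal.ofReal_lt_top) _ measurableSet_Iic, intervalIntegral.integral_of_le ht]
  have h1 : ∀ s, (gammaPDF 1 q s).toReal • h s =
      if 0 ≤ s then q * Real.exp (-(q * s)) * h s else 0 := by
    intro s
    change (exponentialPDF q s).toReal • h s = _
    rw [exponentialPDF_eq]
    split_ifs
    · rw [ENNReal.toReal_ofReal (by positivity), smul_eq_mul]
    · simp
  simp_rw [h1]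
  rw [← integral_Icc_eq_integral_Ioc, ← Set.Ici_inter_Iic, Set.inter_comm,
    ← setIntegral_indicator measurableSet_Ici]
  rfl

end Exponential

/-! ### The transition operator of the jump chain -/

section JumpChain

variable {n : ℕ} (m a b : Fin (n + 1) → ℝ≥0)

/-- The transition operator of the jump chain. -/
def jumpOp : Module.End ℝ (Config n → ℝ) := stepOp (jumpRate m a b) jumpTo (holdRate m a b)

theorem isMarkovOp_jumpOp : IsMarkovOp (jumpOp m a b) :=
  isMarkovOp_stepOp (jumpRate_nonneg m a b) (holdRate_pos m a b) fun x => by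
    rw [sum_jumpRate]
    exact totalRate_le_holdRate m a b x

theorem lintegral_jumpLaw_eq_sum {x : Config n} (h : totalRate m a b x ≠ 0)
    (f : Config n → ℝ≥0∞) : ∫⁻ y, f y ∂jumpLaw m a b x =
      ∑ q, ENNReal.ofReal (jumpRate m a b q x / totalRate m a b x) * f (jumpTo q x) := by
  unfold jumpLaw
  rw [if_neg h, lintegral_finsetSum_measure, Fintype.sum_prod_type]
  refine Finset.sum_congr rfl fun i _ => ?_
  rw [lintegral_add_measure, Fintype.sum_bool, add_comm]
  simp only [lintegral_smul_measure, lintegral_dirac, jumpRate, jumpTo, if_true,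
    Bool.false_eq_true, if_false, ← NNReal.coe_div, ENNReal.ofReal_coe_nnreal]
  rfl

/-- When the total rate vanishes both sides reduce to `f x`: the generator is zero there, and the
artificial holding rate is harmless. -/
theorem lintegral_jumpLaw {f : Config n → ℝ} (hf : 0 ≤ f) (x : Config n) :
    ∫⁻ y, ENNReal.ofReal (f y) ∂jumpLaw m a b x = ENNReal.ofReal (jumpOp m a b f x) := by
  by_cases h : totalRate m a b x = 0
  · have h0 : ∀ q, jumpRate m a b q x = 0 := by
      have h1 := sum_jumpRate m a b x
      rw [h, NNReal.coe_zero, Finset.sum_eq_zero_iff_of_nonneg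
        fun q _ => jumpRate_nonneg m a b q x] at h1
      exact fun q => h1 q (Finset.mem_univ q)
    unfold jumpLaw jumpOp
    rw [if_pos h, lintegral_dirac, stepOp_apply, gen_apply]
    simp [h0]
  · rw [lintegral_jumpLaw_eq_sum m a b h]
    have hT : holdRate m a b x = totalRate m a b x := if_neg h
    have hT0 : (0 : ℝ) < totalRate m a b x := by
      exact_mod_cast pos_iff_ne_zero.2 h
    unfold jumpOp
    rw [stepOp_eq, sum_jumpRate, hT, div_self hT0.ne', sub_self, zero_mul, zero_add,
      ENNReal.ofReal_sum_of_nonneg fun q _ =>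
        mul_nonneg (div_nonneg (jumpRate_nonneg m a b q x) hT0.le) (hf _)]
    refine Finset.sum_congr rfl fun q _ => ?_
    rw [ENNReal.ofReal_mul (div_nonneg (jumpRate_nonneg m a b q x) hT0.le)]

end JumpChain

/-! ### Kolmogorov's equation for the law at a fixed time -/

section Backward

variable {n : ℕ} (m a b : Fin (n + 1) → ℝ≥0)

/-- Paths that have not exploded before `t` and whose gaps at time `t` belong to `B`. -/
def aliveIn (B : Set (Gaps n)) (t : ℝ) : Set (Path n) :=
  {ω | ∃ k : ℕ, (∀ j < k, ∑ i ∈ Finset.range (j + 1), (ω i).2 ≤ t) ∧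
    t < ∑ i ∈ Finset.range (k + 1), (ω i).2 ∧ gaps (ω k).1 ∈ B}

/-- Either the first holding interval covers `t`, or the remaining path has to be alive at the
remaining time. This is the pathwise form of the renewal equation. -/
theorem cons_mem_aliveIn (B : Set (Gaps n)) (t : ℝ) (x : Config n) (s : ℝ) (ω : Path n) :
    cons (x, s) ω ∈ aliveIn B t ↔ (t < s ∧ gaps x ∈ B) ∨ (s ≤ t ∧ ω ∈ aliveIn B (t - s)) := by
  have hsum : ∀ k, ∑ i ∈ Finset.range (k + 1 + 1), (cons (x, s) ω i).2 =
      s + ∑ i ∈ Finset.range (k + 1), (ω i).2 := by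
    intro k
    rw [Finset.sum_range_succ', add_comm]
    rfl
  constructor
  · rintro ⟨k, h1, h2, h3⟩
    cases k with
    | zero => exact Or.inl ⟨by simpa using h2, h3⟩
    | succ k =>
      refine Or.inr ⟨by simpa using h1 0 k.succ_pos, k, fun j hj => ?_, ?_, h3⟩
      · have := h1 (j + 1) (by omega)
        rw [hsum] at this
        linarith
      · rw [hsum] at h2
        linarith
  · rintro (⟨h1, h2⟩ | ⟨h1, k, h2, h3, h4⟩)
    · exact ⟨0, by simp, by simpa using h1, h2⟩
    · refine ⟨k + 1, fun j hj => ?_, ?_, h4⟩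
      · cases j with
        | zero => simpa using h1
        | succ j =>
          rw [hsum]
          linarith [h2 j (by omega)]
      · rw [hsum]
        linarith

theorem measurableSet_aliveIn_prod (B : Set (Gaps n)) :
    MeasurableSet {p : ℝ × Path n | p.2 ∈ aliveIn B p.1} := by
  have h1 : ∀ k, Measurable fun p : ℝ × Path n => ∑ i ∈ Finset.range (k + 1), (p.2 i).2 :=
    fun k => Finset.measurable_fun_sum _ fun i _ => by fun_prop
  have h2 : ∀ k, MeasurableSet {p : ℝ × Path n | gaps (p.2 k).1 ∈ B} := by
    intro k
    have h3 : Measurable fun p : ℝ × Path n => gaps (p.2 k).1 :=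
      (measurable_of_countable gaps).comp (by fun_prop)
    exact h3 (Set.to_countable B).measurableSet
  have h4 : {p : ℝ × Path n | p.2 ∈ aliveIn B p.1} = ⋃ k : ℕ,
      (⋂ j : ℕ, ⋂ (_ : j < k), {p : ℝ × Path n | ∑ i ∈ Finset.range (j + 1), (p.2 i).2 ≤ p.1}) ∩
        ({p : ℝ × Path n | p.1 < ∑ i ∈ Finset.range (k + 1), (p.2 i).2} ∩
          {p : ℝ × Path n | gaps (p.2 k).1 ∈ B}) := by
    ext p
    simp [aliveIn]
  rw [h4]
  refine MeasurableSet.iUnion fun k => ?_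
  refine MeasurableSet.inter (MeasurableSet.iInter fun j => MeasurableSet.iInter fun _ => ?_)
    (MeasurableSet.inter ?_ (h2 k))
  · exact measurableSet_le (h1 j) measurable_fst
  · exact measurableSet_lt measurable_fst (h1 k)

theorem measurableSet_aliveIn (B : Set (Gaps n)) (t : ℝ) :
    MeasurableSet (aliveIn B t : Set (Path n)) :=
  measurable_prodMk_left (measurableSet_aliveIn_prod B)

/-- The probability of `aliveIn`. -/
def aliveProb (B : Set (Gaps n)) (t : ℝ) (x : Config n) : ℝ := (law m a b x).real (aliveIn B t)

theorem measurable_aliveProb (B : Set (Gaps n)) (x : Config n) :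
    Measurable fun t => aliveProb m a b B t x :=
  (measurable_measure_prodMk_left (measurableSet_aliveIn_prod B)).ennreal_toReal

theorem aliveProb_nonneg (B : Set (Gaps n)) (t : ℝ) : 0 ≤ aliveProb m a b B t :=
  fun _ => measureReal_nonneg

theorem abs_aliveProb_le (B : Set (Gaps n)) (t : ℝ) (x : Config n) :
    |aliveProb m a b B t x| ≤ 1 := by
  rw [abs_of_nonneg (aliveProb_nonneg m a b B t x)]
  exact measureReal_le_one

open Classical in
/-- Renewal equation at the first jump. -/
theorem aliveProb_eq (B : Set (Gaps n)) (t : ℝ) (x : Config n) :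
    aliveProb m a b B t x = ∫ s, (if t < s then if gaps x ∈ B then 1 else 0
      else jumpOp m a b (aliveProb m a b B (t - s)) x) ∂expMeasure (holdRate m a b x) := by
  have hq := holdRate_pos m a b x
  have := isProbabilityMeasure_expMeasure hq
  have hJ := isMarkovOp_jumpOp m a b
  have hmeas : Measurable fun s : ℝ => jumpOp m a b (aliveProb m a b B (t - s)) x := by
    unfold jumpOp
    simp only [stepOp_apply, gen_apply]
    have h1 : ∀ y, Measurable fun s : ℝ => aliveProb m a b B (t - s) y := fun y =>
      (measurable_aliveProb m a b B y).comp (measurable_const.sub measurable_id)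
    refine (h1 x).add (Measurable.div_const (Finset.measurable_fun_sum _ fun q _ => ?_) _)
    exact measurable_const.mul ((h1 _).sub (h1 _))
  rw [integral_eq_lintegral_of_nonneg_ae]
  · unfold aliveProb Measure.real
    congr 1
    rw [← lintegral_indicator_one (measurableSet_aliveIn B t),
      lintegral_law m a b x (measurable_one.indicator (measurableSet_aliveIn B t))]
    refine lintegral_congr fun s => ?_
    have h1 : ∀ ω : Path n, (aliveIn B t).indicator (1 : Path n → ℝ≥0∞) (cons (x, s) ω) =
        if t < s then if gaps x ∈ B then 1 else 0
        else (aliveIn B (t - s)).indicator (1 : Path n → ℝ≥0∞) ω := by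
      intro ω
      simp only [Set.indicator_apply, cons_mem_aliveIn, Pi.one_apply]
      split_ifs <;> first | rfl | (exfalso; grind)
    simp_rw [h1]
    split_ifs with hts hB
    · simp
    · simp
    · simp_rw [lintegral_indicator_one (measurableSet_aliveIn B (t - s))]
      refine Eq.trans ?_ (lintegral_jumpLaw m a b (f := aliveProb m a b B (t - s))
        (aliveProb_nonneg m a b B _) x)
      refine lintegral_congr fun y => ?_
      unfold aliveProb
      rw [ofReal_measureReal]
  · refine Filter.Eventually.of_forall fun s => ?_
    dsimp only [Pi.zero_apply]
    split_ifs
    · exact zero_le_one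
    · exact le_rfl
    · exact hJ.nonneg _ (aliveProb_nonneg m a b B _) x
  · exact (Measurable.ite measurableSet_Ioi measurable_const hmeas).aestronglyMeasurable

/-- Indicator of a set of gap vectors. -/
def gapInd (B : Set (Gaps n)) : Gaps n → ℝ := B.indicator 1

theorem gapInd_nonneg (B : Set (Gaps n)) : 0 ≤ gapInd B :=
  Set.indicator_nonneg fun _ _ => zero_le_one

theorem abs_gapInd_le (B : Set (Gaps n)) (d : Gaps n) : |gapInd B d| ≤ 1 := by
  classical
  unfold gapInd
  rw [Set.indicator_apply]
  split_ifs <;> simp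

/-- The semigroup of the chain of gaps, applied to an indicator. -/
def gapProb (B : Set (Gaps n)) (t : ℝ) (d : Gaps n) : ℝ :=
  unif (gapOp m a b) (rateBound m a b) (gapInd B) t d

theorem gapProb_nonneg (B : Set (Gaps n)) {t : ℝ} (ht : 0 ≤ t) (d : Gaps n) :
    0 ≤ gapProb m a b B t d :=
  (isMarkovOp_gapOp m a b).unif_nonneg (gapInd_nonneg B)
    (mul_nonneg (rateBound_pos m a b).le ht) d

theorem gapProb_add_compl (B : Set (Gaps n)) (t : ℝ) (d : Gaps n) :
    gapProb m a b B t d + gapProb m a b Bᶜ t d = 1 := by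
  have hP := isMarkovOp_gapOp m a b
  unfold gapProb
  rw [← hP.unif_add (abs_gapInd_le B) (abs_gapInd_le Bᶜ)]
  unfold gapInd
  rw [Set.indicator_self_add_compl, hP.unif_one]

theorem abs_gapProb_le (B : Set (Gaps n)) {t : ℝ} (ht : 0 ≤ t) (d : Gaps n) :
    |gapProb m a b B t d| ≤ 1 := by
  rw [abs_of_nonneg (gapProb_nonneg m a b B ht d)]
  linarith [gapProb_add_compl m a b B t d, gapProb_nonneg m a b Bᶜ ht d]

theorem hasDerivAt_gapProb (B : Set (Gaps n)) (t : ℝ) (x : Config n) :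
    HasDerivAt (fun t => gapProb m a b B t (gaps x))
      (gen (jumpRate m a b) jumpTo (fun y => gapProb m a b B t (gaps y)) x) t := by
  rw [gen_comp_gaps]
  exact hasDerivAt_unif_stepOp (rateBound_pos m a b) (gapRate_nonneg m a b)
    (fun d => (sum_gapRate_lt m a b d).le) (abs_gapInd_le B) t (gaps x)

open Classical in
/-- The semigroup satisfies the renewal equation. -/
theorem gapProb_eq (B : Set (Gaps n)) {t : ℝ} (ht : 0 ≤ t) (x : Config n) :
    Integrable (fun s => if t < s then if gaps x ∈ B then (1 : ℝ) else 0
      else jumpOp m a b (fun y => gapProb m a b B (t - s) (gaps y)) x)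
      (expMeasure (holdRate m a b x)) ∧
    gapProb m a b B t (gaps x) = ∫ s, (if t < s then if gaps x ∈ B then 1 else 0
      else jumpOp m a b (fun y => gapProb m a b B (t - s) (gaps y)) x)
        ∂expMeasure (holdRate m a b x) := by
  set q := holdRate m a b x with hqdef
  have hq : 0 < q := holdRate_pos m a b x
  have := isProbabilityMeasure_expMeasure hq
  have hJ := isMarkovOp_jumpOp m a b
  have hcont : ∀ y : Config n, Continuous fun s : ℝ => gapProb m a b B (t - s) (gaps y) := by
    intro y
    have : Continuous fun s : ℝ => gapProb m a b B s (gaps y) :=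
      continuous_iff_continuousAt.2 fun s => (hasDerivAt_gapProb m a b B s y).continuousAt
    exact this.comp (continuous_const.sub continuous_id)
  have hcontJ : Continuous fun s : ℝ => jumpOp m a b (fun y => gapProb m a b B (t - s) (gaps y)) x := by
    unfold jumpOp
    simp only [stepOp_apply, gen_apply]
    exact (hcont x).add (Continuous.div_const (continuous_finsetSum _ fun r _ =>
      continuous_const.mul ((hcont _).sub (hcont _))) _)
  have hinte : Integrable (fun s => if t < s then if gaps x ∈ B then (1 : ℝ) else 0
      else jumpOp m a b (fun y => gapProb m a b B (t - s) (gaps y)) x) (expMeasure q) := by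
    refine Integrable.of_bound (Measurable.ite measurableSet_Ioi measurable_const
      hcontJ.measurable).aestronglyMeasurable 1 (Filter.Eventually.of_forall fun s => ?_)
    rw [Real.norm_eq_abs]
    split_ifs with hs
    · simp
    · simp
    · exact hJ.abs_apply_le (fun y => abs_gapProb_le m a b B (by linarith) _) x
  refine ⟨hinte, ?_⟩
  rw [← integral_add_compl measurableSet_Iic hinte (s := Set.Iic t), Set.compl_Iic]
  have h1 : ∫ s in Set.Ioi t, (if t < s then if gaps x ∈ B then (1 : ℝ) else 0
      else jumpOp m a b (fun y => gapProb m a b B (t - s) (gaps y)) x) ∂expMeasure q =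
      Real.exp (-(q * t)) * gapInd B (gaps x) := by
    have h2 : ∀ s ∈ Set.Ioi t, (if t < s then if gaps x ∈ B then (1 : ℝ) else 0
        else jumpOp m a b (fun y => gapProb m a b B (t - s) (gaps y)) x) =
        gapInd B (gaps x) := by
      intro s hs
      rw [if_pos (Set.mem_Ioi.1 hs), gapInd, Set.indicator_apply]
      rfl
    rw [setIntegral_congr_fun measurableSet_Ioi h2, setIntegral_const, expMeasure_real_Ioi hq ht,
      smul_eq_mul]
  have h3 : ∫ s in Set.Iic t, (if t < s then if gaps x ∈ B then (1 : ℝ) else 0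
      else jumpOp m a b (fun y => gapProb m a b B (t - s) (gaps y)) x) ∂expMeasure q =
      gapProb m a b B t (gaps x) - Real.exp (-(q * t)) * gapInd B (gaps x) := by
    have h4 : ∀ s ∈ Set.Iic t, (if t < s then if gaps x ∈ B then (1 : ℝ) else 0
        else jumpOp m a b (fun y => gapProb m a b B (t - s) (gaps y)) x) =
        jumpOp m a b (fun y => gapProb m a b B (t - s) (gaps y)) x := fun s hs =>
      if_neg (not_lt.2 (Set.mem_Iic.1 hs))
    rw [setIntegral_congr_fun measurableSet_Iic h4, setIntegral_Iic_expMeasure hq ht]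
    -- The backward equation rewritten with the true holding rate `q` instead of `Λ`: since `q * g +
    -- gen g = q * jumpOp g`, the integrand has an explicit primitive.
    have hder : ∀ s ∈ Set.uIcc 0 t, HasDerivAt
        (fun s => -(Real.exp (-(q * s)) * gapProb m a b B (t - s) (gaps x)))
        (q * Real.exp (-(q * s)) * jumpOp m a b (fun y => gapProb m a b B (t - s) (gaps y)) x)
        s := by
      intro s _
      have e1 : HasDerivAt (fun s => -(q * s)) (-q) s := by
        exact ((hasDerivAt_id s).const_mul q).neg.congr_deriv (by simp)
      have e2 : HasDerivAt (fun s => t - s) (-1) s := by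
        simpa using (hasDerivAt_id s).const_sub t
      have e3 := ((e1.exp).mul ((hasDerivAt_gapProb m a b B (t - s) x).comp s e2)).neg
      refine e3.congr_deriv ?_
      unfold jumpOp
      rw [stepOp_apply, ← hqdef]
      simp only [Function.comp]
      field_simp
      ring
    rw [intervalIntegral.integral_eq_sub_of_hasDerivAt hder
      (Continuous.intervalIntegrable (by fun_prop) _ _)]
    have h5 : gapProb m a b B 0 (gaps x) = gapInd B (gaps x) := unif_zero _
    simp [h5]
    ring
  rw [h1, h3]
  ring

/-- The law of the gaps at time `t`, on the event of no explosion. -/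
theorem aliveProb_eq_gapProb (B : Set (Gaps n)) {t : ℝ} (ht : 0 ≤ t) (x : Config n) :
    aliveProb m a b B t x = gapProb m a b B t (gaps x) := by
  classical
  set T := t with hT
  have hΛ := rateBound_pos m a b
  -- `c` is the probability that a clock of rate `Λ` rings before `T`. All holding rates are at most
  -- `Λ`, so each use of the renewal equation shrinks the error by `c`, uniformly in the
  -- configuration.
  set c := 1 - Real.exp (-(rateBound m a b * T)) with hc
  have hc0 : 0 ≤ c := by
    rw [hc, sub_nonneg, Real.exp_le_one_iff, neg_nonpos]
    exact mul_nonneg hΛ.le ht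
  have hc1 : c < 1 := by
    rw [hc]; linarith [Real.exp_pos (-((rateBound m a b : ℝ) * T))]
  have hJ := isMarkovOp_jumpOp m a b
  have key : ∀ k : ℕ, ∀ t, 0 ≤ t → t ≤ T → ∀ x,
      |aliveProb m a b B t x - gapProb m a b B t (gaps x)| ≤ 2 * c ^ k := by
    intro k
    induction k with
    | zero =>
      intro t ht _ x
      have h1 := abs_le.1 (abs_aliveProb_le m a b B t x)
      have h2 := abs_le.1 (abs_gapProb_le m a b B ht (gaps x))
      rw [pow_zero, abs_le]
      constructor <;> linarith
    | succ k ih =>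
      intro t ht htT x
      have hq := holdRate_pos m a b x
      have := isProbabilityMeasure_expMeasure hq
      obtain ⟨hinte, hgap⟩ := gapProb_eq m a b B ht x
      have hinte' : Integrable (fun s => if t < s then if gaps x ∈ B then (1 : ℝ) else 0
          else jumpOp m a b (aliveProb m a b B (t - s)) x) (expMeasure (holdRate m a b x)) := by
        refine Integrable.of_bound (Measurable.ite measurableSet_Ioi measurable_const
          ?_).aestronglyMeasurable 1 (Filter.Eventually.of_forall fun s => ?_)
        · unfold jumpOp
          simp only [stepOp_apply, gen_apply]
          have h1 : ∀ y, Measurable fun s : ℝ => aliveProb m a b B (t - s) y := fun y =>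
            (measurable_aliveProb m a b B y).comp (measurable_const.sub measurable_id)
          refine (h1 x).add (Measurable.div_const (Finset.measurable_fun_sum _ fun q _ => ?_) _)
          exact measurable_const.mul ((h1 _).sub (h1 _))
        · rw [Real.norm_eq_abs]
          split_ifs with hs
          · simp
          · simp
          · exact hJ.abs_apply_le (fun y => abs_aliveProb_le m a b B _ _) x
      rw [aliveProb_eq, hgap, ← integral_sub hinte' hinte, ← Real.norm_eq_abs]
      have hbound : ∀ᵐ s ∂expMeasure (holdRate m a b x),
          ‖(if t < s then if gaps x ∈ B then (1 : ℝ) else 0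
            else jumpOp m a b (aliveProb m a b B (t - s)) x) -
            (if t < s then if gaps x ∈ B then (1 : ℝ) else 0
            else jumpOp m a b (fun y => gapProb m a b B (t - s) (gaps y)) x)‖ ≤
          (Set.Iic t).indicator (fun _ => 2 * c ^ k) s := by
        filter_upwards [ae_pos_expMeasure hq] with s hs
        by_cases hts : t < s
        · rw [if_pos hts, if_pos hts, sub_self, norm_zero]
          exact Set.indicator_nonneg (fun _ _ => by positivity) _
        · rw [if_neg hts, if_neg hts, Set.indicator_of_mem (Set.mem_Iic.2 (not_lt.1 hts)), Real.norm_eq_abs,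
            ← Pi.sub_apply, ← map_sub]
          exact hJ.abs_apply_le (fun y => ih (t - s) (by linarith) (by linarith) y) x
      refine (norm_integral_le_of_norm_le
        ((integrable_const _).indicator measurableSet_Iic) hbound).trans ?_
      rw [integral_indicator measurableSet_Iic, setIntegral_const, expMeasure_real_Iic hq ht,
        smul_eq_mul]
      have h1 : 1 - Real.exp (-(holdRate m a b x * t)) ≤ c := by
        rw [hc]
        have h2 : holdRate m a b x * t ≤ rateBound m a b * T :=
          mul_le_mul (holdRate_le_rateBound m a b x) htT ht hΛ.le
        have := Real.exp_le_exp.2 (neg_le_neg h2)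
        linarith
      calc (1 - Real.exp (-(holdRate m a b x * t))) * (2 * c ^ k) ≤ c * (2 * c ^ k) := by gcongr
        _ = 2 * c ^ (k + 1) := by ring
  have hlim : Filter.Tendsto (fun k : ℕ => 2 * c ^ k) Filter.atTop (nhds 0) := by
    simpa using (tendsto_pow_atTop_nhds_zero_of_lt_one hc0 hc1).const_mul 2
  have h0 := ge_of_tendsto' hlim fun k => key k T ht le_rfl x
  exact sub_eq_zero.1 (abs_nonpos_iff.1 h0)

/-- The clause on earlier indices in `aliveIn` makes `k` the first one, as in `X`, without assuming
positive holding times. -/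
theorem aliveIn_subset (B : Set (Gaps n)) (t : ℝ≥0) :
    aliveIn B (t : ℝ) ⊆ {ω : Path n | eta t ω ∈ B} := by
  rintro ω ⟨k, h1, h2, h3⟩
  have : sInf {k : ℕ | (t : ℝ) < ∑ i ∈ Finset.range (k + 1), (ω i).2} = k := by
    refine le_antisymm (Nat.sInf_le h2) (le_csInf ⟨k, h2⟩ fun j hj => ?_)
    by_contra hlt
    exact absurd (h1 j (not_le.1 hlt)) (not_le.2 hj)
  simp only [Set.mem_ofPred_eq, eta, X, this]
  exact h3

/-- The law of the gaps at time `t`. -/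
theorem law_real_eta (B : Set (Gaps n)) (t : ℝ≥0) (x : Config n) :
    (law m a b x).real {ω | eta t ω ∈ B} = gapProb m a b B t (gaps x) := by
  -- The alive probabilities of `B` and of its complement add up to one. This squeezes the
  -- probability of `eta t ω ∈ B`, and explosion is excluded without a separate argument.
  have h1 := aliveProb_eq_gapProb m a b B t.coe_nonneg x
  have h2 := aliveProb_eq_gapProb m a b Bᶜ t.coe_nonneg x
  have h3 := gapProb_add_compl m a b B t (gaps x)
  have h4 : aliveProb m a b B t x ≤ (law m a b x).real {ω | eta t ω ∈ B} :=
    measureReal_mono (aliveIn_subset B t)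
  have h5 : (law m a b x).real {ω | eta t ω ∈ B} ≤
      (law m a b x).real (aliveIn Bᶜ (t : ℝ))ᶜ := by
    refine measureReal_mono fun ω hω hω' => ?_
    exact aliveIn_subset Bᶜ t hω' hω
  rw [probReal_compl_eq_one_sub (measurableSet_aliveIn _ _)] at h5
  change _ ≤ 1 - aliveProb m a b Bᶜ t x at h5
  linarith

end Backward

/-! ### Occupation before hitting, and return times -/

section Paths

variable {n : ℕ}

theorem sum_hold_lt {ω : Path n} (hpos : ∀ i, 0 < (ω i).2) {j k : ℕ} (h : j < k) :
    ∑ i ∈ Finset.range j, (ω i).2 < ∑ i ∈ Finset.range k, (ω i).2 :=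
  Finset.sum_lt_sum_of_subset (Finset.range_mono h.le) (Finset.mem_range.2 h) (by simp) (hpos j)
    fun i _ _ => (hpos i).le

theorem sum_hold_le {ω : Path n} (hpos : ∀ i, 0 < (ω i).2) {j k : ℕ} (h : j ≤ k) :
    ∑ i ∈ Finset.range j, (ω i).2 ≤ ∑ i ∈ Finset.range k, (ω i).2 :=
  Finset.sum_le_sum_of_subset_of_nonneg (Finset.range_mono h) fun i _ _ => (hpos i).le

theorem X_eq_of_eq_sum {ω : Path n} (hpos : ∀ i, 0 < (ω i).2) {k : ℕ} {t : ℝ≥0}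
    (ht : (t : ℝ) = ∑ i ∈ Finset.range k, (ω i).2) : X t ω = (ω k).1 := by
  unfold X
  have : sInf {j : ℕ | (t : ℝ) < ∑ i ∈ Finset.range (j + 1), (ω i).2} = k := by
    refine le_antisymm (Nat.sInf_le ?_) (le_csInf ⟨k, ?_⟩ fun j hj => ?_)
    · simpa [ht] using sum_hold_lt hpos k.lt_succ_self
    · simpa [ht] using sum_hold_lt hpos k.lt_succ_self
    · by_contra hlt
      have h1 : (t : ℝ) < ∑ i ∈ Finset.range (j + 1), (ω i).2 := hj
      have h2 := sum_hold_le hpos (show j + 1 ≤ k by omega)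
      rw [ht] at h1
      linarith
  rw [this]

theorem X_eq_of_lt {ω : Path n} {t : ℝ≥0} (ht : (t : ℝ) < (ω 0).2) : X t ω = (ω 0).1 := by
  unfold X
  have : sInf {j : ℕ | (t : ℝ) < ∑ i ∈ Finset.range (j + 1), (ω i).2} = 0 :=
    Nat.le_zero.1 (Nat.sInf_le (by simpa using ht))
  rw [this]

theorem exists_eta_eq {ω : Path n} (hpos : ∀ i, 0 < (ω i).2) (k : ℕ) :
    ∃ t : ℝ≥0, (t : ℝ) = ∑ i ∈ Finset.range k, (ω i).2 ∧ eta t ω = gaps (ω k).1 := by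
  have h := Real.coe_toNNReal _ (Finset.sum_nonneg fun i (_ : i ∈ Finset.range k) => (hpos i).le)
  refine ⟨_, h, ?_⟩
  rw [eta, X_eq_of_eq_sum hpos h]

open Classical in
/-- Sum of the weights of the first `N` entries, as long as `d` has not been visited. -/
def occ (w : Config n × ℝ → ℝ≥0∞) (d : Gaps n) (N : ℕ) (ω : Path n) : ℝ≥0∞ :=
  ∑ i ∈ Finset.range N, if ∀ j ≤ i, gaps (ω j).1 ≠ d then w (ω i) else 0

open Classical in
theorem occ_cons (w : Config n × ℝ → ℝ≥0∞) (d : Gaps n) (N : ℕ) (e : Config n × ℝ) (ω : Path n) :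
    occ w d (N + 1) (cons e ω) = if gaps e.1 = d then 0 else w e + occ w d N ω := by
  unfold occ
  rw [Finset.sum_range_succ', add_comm]
  by_cases h : gaps e.1 = d
  · rw [if_pos h, if_neg (fun h' => h' 0 le_rfl h), zero_add]
    exact Finset.sum_eq_zero fun i _ => if_neg fun h' => h' 0 (Nat.zero_le _) h
  · rw [if_neg h]
    congr 1
    · refine if_pos fun j hj => ?_
      rw [Nat.le_zero.1 hj]
      exact h
    · refine Finset.sum_congr rfl fun i _ => ?_
      refine if_congr ⟨fun h' j hj => h' (j + 1) (by omega), fun h' j hj => ?_⟩ rfl rfl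
      cases j with
      | zero => exact h
      | succ j => exact h' j (by omega)

theorem occ_mono (w : Config n × ℝ → ℝ≥0∞) (d : Gaps n) (ω : Path n) :
    Monotone fun N => occ w d N ω := fun _ _ h =>
  Finset.sum_le_sum_of_subset (Finset.range_mono h)

theorem measurable_occ {w : Config n × ℝ → ℝ≥0∞} (hw : Measurable w) (d : Gaps n) (N : ℕ) :
    Measurable (occ w d N) := by
  classical
  refine Finset.measurable_fun_sum _ fun i _ => Measurable.ite ?_ (by fun_prop) measurable_const
  have h1 : {ω : Path n | ∀ j ≤ i, gaps (ω j).1 ≠ d} =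
      ⋂ j : ℕ, ⋂ (_ : j ≤ i), (fun ω : Path n => (ω j).1) ⁻¹' {y | gaps y ≠ d} := by
    ext ω; simp
  rw [h1]
  exact MeasurableSet.iInter fun j => MeasurableSet.iInter fun _ =>
    (by fun_prop : Measurable fun ω : Path n => (ω j).1) (Set.to_countable _).measurableSet

/-- The holding time as a weight. -/
def holdWeight (e : Config n × ℝ) : ℝ≥0∞ := ENNReal.ofReal e.2

theorem measurable_holdWeight : Measurable (holdWeight : Config n × ℝ → ℝ≥0∞) := by
  unfold holdWeight; fun_prop

/-- The path after its first jump. -/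
def tail (ω : Path n) : Path n := fun k => ω (k + 1)

theorem measurable_tail : Measurable (tail : Path n → Path n) := by
  unfold tail; fun_prop

/-- Let `k` be the first visit of the tail to `d`. The path is back at `d` after the initial holding
time and the first `k` holding times of the tail, which is the occupation before the visit. As `ω 1`
has other gaps, this is past the first jump of `eta`. -/
theorem returnTime_le {ω : Path n} {d : Gaps n} (hpos : ∀ i, 0 < (ω i).2)
    (h0 : gaps (ω 0).1 = d) (h1 : gaps (ω 1).1 ≠ d) (hex : ∃ k, gaps (tail ω k).1 = d) :
    returnTime d ω ≤ ENNReal.ofReal (ω 0).2 + ⨆ N, occ holdWeight d N (tail ω) := by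
  classical
  set k := Nat.find hex with hk
  have hkd : gaps (ω (k + 1)).1 = d := Nat.find_spec hex
  have hmin : ∀ j < k, gaps (tail ω j).1 ≠ d := fun j hj => Nat.find_min hex hj
  obtain ⟨t, ht, hteta⟩ := exists_eta_eq hpos (k + 1)
  obtain ⟨t₁, ht₁, ht₁eta⟩ := exists_eta_eq hpos 1
  obtain ⟨t₀, ht₀, ht₀eta⟩ := exists_eta_eq hpos 0
  have ht₀' : t₀ = 0 := by
    rw [Finset.sum_range_zero] at ht₀
    exact_mod_cast ht₀
  subst ht₀'
  have hjump : firstJump ω ≤ t := by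
    have h2 : firstJump ω ≤ t₁ := iInf₂_le t₁ (by rw [ht₁eta, ht₀eta, h0]; exact h1)
    refine h2.trans ?_
    have : (t₁ : ℝ) ≤ t := by
      rw [ht₁, ht]
      exact sum_hold_le hpos (by omega)
    exact_mod_cast this
  have hret : returnTime d ω ≤ t :=
    iInf_le_of_le t (iInf_le_of_le hjump (iInf_le_of_le (hteta.trans hkd) le_rfl))
  refine hret.trans ?_
  have h3 : (t : ℝ≥0∞) = ENNReal.ofReal (ω 0).2 + occ holdWeight d k (tail ω) := by
    have h4 : (t : ℝ≥0∞) = ENNReal.ofReal (t : ℝ) := by simp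
    rw [h4, ht, Finset.sum_range_succ', add_comm, ENNReal.ofReal_add (hpos 0).le
      (Finset.sum_nonneg fun i _ => (hpos _).le), ENNReal.ofReal_sum_of_nonneg
      fun i _ => (hpos _).le]
    congr 1
    refine Finset.sum_congr rfl fun i hi => ?_
    rw [if_pos fun j hj => hmin j (hj.trans_lt (Finset.mem_range.1 hi))]
    rfl
  rw [h3]
  gcongr
  exact le_iSup (fun N => occ holdWeight d N (tail ω)) k

theorem occ_tail_le_returnTime {ω : Path n} {d : Gaps n} (hpos : ∀ i, 0 < (ω i).2)
    (h0 : gaps (ω 0).1 = d) (N : ℕ) : occ holdWeight d N (tail ω) ≤ returnTime d ω := by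
  classical
  have heta0 : ∀ t : ℝ≥0, (t : ℝ) < (ω 0).2 → eta t ω = d := fun t ht => by
    rw [eta, X_eq_of_lt ht, h0]
  refine le_iInf fun t => le_iInf fun hjump => le_iInf fun hteta => ?_
  have ht0 : (ω 0).2 ≤ t := by
    have h1 : ENNReal.ofReal (ω 0).2 ≤ firstJump ω := by
      refine le_iInf₂ fun s hs => ?_
      rw [ENNReal.ofReal_le_coe]
      by_contra hlt
      exact hs ((heta0 s (not_le.1 hlt)).trans (heta0 0 (by simpa using hpos 0)).symm)
    have h2 := h1.trans hjump
    rwa [ENNReal.ofReal_le_coe] at h2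
  have key : ∀ k, (∀ i, (∀ j ≤ i, gaps (tail ω j).1 ≠ d) → i < k ∨ N ≤ i) →
      ∑ i ∈ Finset.range (k + 1), (ω i).2 ≤ t → occ holdWeight d N (tail ω) ≤ t := by
    intro k hk hkt
    have h1 : occ holdWeight d N (tail ω) ≤
        ∑ i ∈ Finset.range k, ENNReal.ofReal (ω (i + 1)).2 := by
      unfold occ
      rw [← Finset.sum_filter]
      refine Finset.sum_le_sum_of_subset fun i hi => ?_
      rw [Finset.mem_filter, Finset.mem_range] at hi
      rw [Finset.mem_range]
      rcases hk i hi.2 with h | h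
      · exact h
      · omega
    refine h1.trans ?_
    rw [← ENNReal.ofReal_sum_of_nonneg fun i _ => (hpos _).le, ENNReal.ofReal_le_coe]
    rw [Finset.sum_range_succ'] at hkt
    linarith [hpos 0]
  -- If no partial sum exceeds `t`, the infimum defining `X` is over the empty set and `X` falls
  -- back to the initial state, so `eta t ω = d` says nothing. But then `t` dominates all partial
  -- sums, which is already the bound.
  by_cases hex : ∃ k : ℕ, (t : ℝ) < ∑ i ∈ Finset.range (k + 1), (ω i).2
  · have hmem := Nat.sInf_mem (s := {k : ℕ | (t : ℝ) < ∑ i ∈ Finset.range (k + 1), (ω i).2}) hex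
    have hnot := fun j => Nat.notMem_of_lt_sInf (m := j)
      (s := {k : ℕ | (t : ℝ) < ∑ i ∈ Finset.range (k + 1), (ω i).2})
    rw [eta, X] at hteta
    generalize sInf {k : ℕ | (t : ℝ) < ∑ i ∈ Finset.range (k + 1), (ω i).2} = k at hmem hnot hteta
    cases k with
    | zero =>
      have h1 : (t : ℝ) < ∑ i ∈ Finset.range (0 + 1), (ω i).2 := hmem
      rw [zero_add, Finset.sum_range_one] at h1
      linarith
    | succ k =>
      refine key k (fun i hi => Or.inl ?_) ?_
      · by_contra hlt
        exact hi k (not_lt.1 hlt) hteta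
      · have h1 := hnot k k.lt_succ_self
        exact not_lt.1 h1
  · push Not at hex
    exact key N (fun i _ => lt_or_ge i N) (hex N)

end Paths

/-! ### Mean occupation before hitting, and sufficiency of the stability condition -/

section Hitting

variable {n : ℕ} (m a b : Fin (n + 1) → ℝ≥0)

/-- Almost sure properties of the path from its first entry and the path after the first jump. -/
theorem ae_law {p : Path n → Prop} (hp : MeasurableSet {ω | p ω}) (x : Config n)
    (h : ∀ᵐ s ∂expMeasure (holdRate m a b x), ∀ᵐ y ∂jumpLaw m a b x, ∀ᵐ ω ∂law m a b y,
      p (cons (x, s) ω)) : ∀ᵐ ω ∂law m a b x, p ω := by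
  rw [ae_iff]
  have hp' : MeasurableSet {ω | ¬p ω} := hp.compl
  rw [← lintegral_indicator_one hp', lintegral_law m a b x (measurable_one.indicator hp')]
  refine lintegral_eq_zero_of_ae_eq_zero ?_
  filter_upwards [h] with s hs
  refine lintegral_eq_zero_of_ae_eq_zero ?_
  filter_upwards [hs] with y hy
  refine lintegral_eq_zero_of_ae_eq_zero ?_
  filter_upwards [hy] with ω hω
  exact Set.indicator_of_notMem (by simpa using hω) _

theorem measurableSet_entry (A : Set (Config n)) (k : ℕ) :
    MeasurableSet {ω : Path n | (ω k).1 ∈ A ∧ 0 < (ω k).2} := by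
  have h1 : MeasurableSet ((fun ω : Path n => (ω k).1) ⁻¹' A) :=
    (by fun_prop : Measurable fun ω : Path n => (ω k).1) (Set.to_countable _).measurableSet
  have h2 : MeasurableSet {ω : Path n | 0 < (ω k).2} :=
    measurableSet_lt measurable_const (by fun_prop : Measurable fun ω : Path n => (ω k).2)
  exact h1.inter h2

/-- The path stays in sets that are closed for the jump chain; the holding times are positive. -/
theorem ae_law_mem {A : Set (Config n)} (hA : ∀ x ∈ A, ∀ᵐ y ∂jumpLaw m a b x, y ∈ A) {x : Config n}
    (hx : x ∈ A) : ∀ᵐ ω ∂law m a b x, ∀ k, (ω k).1 ∈ A ∧ 0 < (ω k).2 := by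
  rw [ae_all_iff]
  intro k
  induction k generalizing x with
  | zero =>
    refine ae_law m a b (measurableSet_entry A 0) x ?_
    filter_upwards [ae_pos_expMeasure (holdRate_pos m a b x)] with s hs
    exact Filter.Eventually.of_forall fun y => Filter.Eventually.of_forall fun ω => ⟨hx, hs⟩
  | succ k ih =>
    refine ae_law m a b (measurableSet_entry A (k + 1)) x ?_
    refine Filter.Eventually.of_forall fun s => ?_
    filter_upwards [hA x hx] with y hy
    exact ih hy

theorem ae_hold_pos (x : Config n) : ∀ᵐ ω ∂law m a b x, ∀ k, 0 < (ω k).2 := by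
  filter_upwards [ae_law_mem m a b (A := Set.univ) (fun _ _ => by simp) (Set.mem_univ x)] with ω hω
  exact fun k => (hω k).2

theorem ae_entry_zero (x : Config n) : ∀ᵐ ω ∂law m a b x, (ω 0).1 = x := by
  refine ae_law m a b (p := fun ω => (ω 0).1 = x) ?_ x
    (Filter.Eventually.of_forall fun s => Filter.Eventually.of_forall fun y =>
      Filter.Eventually.of_forall fun ω => rfl)
  exact (by fun_prop : Measurable fun ω : Path n => (ω 0).1) (measurableSet_singleton x)

theorem ae_jumpLaw_gaps_ne (hn : 0 < n) {x : Config n} (h : totalRate m a b x ≠ 0) :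
    ∀ᵐ y ∂jumpLaw m a b x, gaps y ≠ gaps x := by
  classical
  have hmeas : MeasurableSet {y : Config n | ¬gaps y ≠ gaps x} := (Set.to_countable _).measurableSet
  rw [ae_iff, ← lintegral_indicator_one hmeas, lintegral_jumpLaw_eq_sum m a b h]
  refine Finset.sum_eq_zero fun q _ => ?_
  by_cases hq : jumpRate m a b q x = 0
  · simp [hq]
  · rw [Set.indicator_of_notMem (by simpa using gaps_jumpTo_ne m a b hn hq), mul_zero]

theorem ae_entry_one (hn : 0 < n) {x : Config n} (h : totalRate m a b x ≠ 0) :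
    ∀ᵐ ω ∂law m a b x, gaps (ω 1).1 ≠ gaps x := by
  refine ae_law m a b (p := fun ω => gaps (ω 1).1 ≠ gaps x) ?_ x
    (Filter.Eventually.of_forall fun s => ?_)
  · exact (by fun_prop : Measurable fun ω : Path n => (ω 1).1)
      (t := {y | gaps y ≠ gaps x}) (Set.to_countable _).measurableSet
  · filter_upwards [ae_jumpLaw_gaps_ne m a b hn h] with y hy
    filter_upwards [ae_entry_zero m a b y] with ω hω
    rw [cons_succ, hω]
    exact hy

theorem lintegral_occ_succ {w : Config n × ℝ → ℝ≥0∞} (hw : Measurable w) (d : Gaps n) (N : ℕ)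
    {x : Config n} (hx : gaps x ≠ d) :
    ∫⁻ ω, occ w d (N + 1) ω ∂law m a b x = ∫⁻ s, w (x, s) ∂expMeasure (holdRate m a b x) +
      ∫⁻ y, ∫⁻ ω, occ w d N ω ∂law m a b y ∂jumpLaw m a b x := by
  have := isProbabilityMeasure_expMeasure (holdRate_pos m a b x)
  rw [lintegral_law m a b x (measurable_occ hw d _)]
  simp only [occ_cons, hx, if_false]
  simp_rw [lintegral_add_left measurable_const, lintegral_const, measure_univ, mul_one]
  simp_rw [lintegral_add_left measurable_const, lintegral_const, measure_univ, mul_one]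
  rw [lintegral_add_right _ measurable_const, lintegral_const, measure_univ, mul_one]

theorem lintegral_occ_of_eq (w : Config n × ℝ → ℝ≥0∞) (N : ℕ)
    (x : Config n) : ∫⁻ ω, occ w (gaps x) N ω ∂law m a b x = 0 := by
  refine lintegral_eq_zero_of_ae_eq_zero ?_
  filter_upwards [ae_entry_zero m a b x] with ω hω
  refine Finset.sum_eq_zero fun i _ => if_neg fun h => h 0 (Nat.zero_le _) ?_
  rw [hω]

/-- Comparison of the mean occupation with a Lyapunov function. -/
theorem lintegral_iSup_occ_le {w : Config n × ℝ → ℝ≥0∞} (hw : Measurable w) (d : Gaps n)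
    {G : Config n → ℝ} (hG : 0 ≤ G) (h : ∀ x, gaps x ≠ d →
      ∫⁻ s, w (x, s) ∂expMeasure (holdRate m a b x) + ENNReal.ofReal (jumpOp m a b G x) ≤
        ENNReal.ofReal (G x)) (x : Config n) :
    ∫⁻ ω, ⨆ N, occ w d N ω ∂law m a b x ≤ ENNReal.ofReal (G x) := by
  -- Monotone convergence reduces the claim to finitely many entries, where decomposing at the first
  -- jump gives an induction.
  rw [lintegral_iSup (fun N => measurable_occ hw d N) fun _ _ h ω => occ_mono w d ω h]
  refine iSup_le fun N => ?_
  induction N generalizing x with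
  | zero => simp [occ]
  | succ N ih =>
    by_cases hx : gaps x = d
    · subst hx
      rw [lintegral_occ_of_eq m a b w]
      exact zero_le
    · rw [lintegral_occ_succ m a b hw d N hx]
      refine le_trans ?_ (h x hx)
      gcongr
      rw [← lintegral_jumpLaw m a b hG]
      exact lintegral_mono fun y => ih y

theorem exists_hit_of_iSup_occ_lt_top {ω : Path n} {d : Gaps n}
    (h : ⨆ N, occ (fun _ => 1) d N ω < ∞) : ∃ k, gaps (ω k).1 = d := by
  by_contra! hcon
  have h1 : ∀ N, occ (fun _ => 1) d N ω = N := by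
    intro N
    unfold occ
    simp [hcon]
  simp_rw [h1] at h
  exact absurd ENNReal.iSup_natCast h.ne

/-- The mass-weighted sums of the left and right rates are `∑ m j * a j` and `∑ m j * b j` in every
configuration, so one frozen configuration forces all intrinsic rates to vanish. -/
theorem rates_eq_zero_of_totalRate_eq_zero (hm : ∀ i, 0 < m i) {x : Config n}
    (h : totalRate m a b x = 0) (i : Fin (n + 1)) : a i = 0 ∧ b i = 0 := by
  have h0 : ∀ i, leftRate m a i x = 0 ∧ rightRate m b i x = 0 := by
    intro i
    have := (Finset.sum_eq_zero_iff.1 h) i (Finset.mem_univ i)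
    exact add_eq_zero.1 this
  obtain ⟨lead, -, hsum⟩ := exists_left_lead m a hm x
  obtain ⟨lead', -, hsum'⟩ := exists_right_lead m b hm x
  have h1 := hsum fun _ => 1
  have h2 := hsum' fun _ => 1
  simp only [h0, NNReal.coe_zero, zero_mul, Finset.sum_const_zero, mul_one] at h1 h2
  have h3 := (Finset.sum_eq_zero_iff_of_nonneg fun j _ => by positivity).1 h1.symm i
    (Finset.mem_univ i)
  have h4 := (Finset.sum_eq_zero_iff_of_nonneg fun j _ => by positivity).1 h2.symm i
    (Finset.mem_univ i)
  have hmi : (m i : ℝ) ≠ 0 := by exact_mod_cast (hm i).ne'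
  exact ⟨by exact_mod_cast (mul_eq_zero.1 h3).resolve_left hmi,
    by exact_mod_cast (mul_eq_zero.1 h4).resolve_left hmi⟩

/-- The stability condition implies positive recurrence. -/
theorem isPositiveRecurrent_of_stabilityCondition (hm : ∀ i, 0 < m i)
    (hst : StabilityCondition m a b) : IsPositiveRecurrent m a b := by
  classical
  rcases Nat.eq_zero_or_pos n with hn | hn
  · subst hn
    exact ⟨0, fun x _ => Or.inl (Filter.Eventually.of_forall fun ω t => Subsingleton.elim _ _),
      fun x => Filter.Eventually.of_forall fun ω => ⟨0, Subsingleton.elim _ _⟩⟩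
  obtain ⟨V, δ, -, hV, -⟩ := exists_isGeomStable m a b hm hst
  obtain ⟨G, hG0, hG⟩ := hV.exists_hitting_bound
  set G₀ : Gaps n → ℝ := fun d => if d = 0 then 0 else G d with hG₀
  have hG₀0 : 0 ≤ G₀ := fun d => by
    simp only [hG₀]
    split_ifs
    · exact le_rfl
    · exact hG0 d
  have hΛ := rateBound_pos m a b
  have hΛ1 : (1 : ℝ) ≤ rateBound m a b := by exact_mod_cast one_le_rateBound m a b
  have hJ := isMarkovOp_jumpOp m a b
  have hGx0 : (0 : Config n → ℝ) ≤ fun x => G₀ (gaps x) := fun x => hG₀0 _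
  -- The uniformized chain and the jump chain share the generator and differ only in its
  -- normalization: a decrease by `1` per uniformized step becomes `Λ / q` per jump. This dominates
  -- both `1`, which counts jumps, and `1 / q`, which counts mean time.
  have hdrift : ∀ x : Config n, gaps x ≠ 0 → jumpOp m a b (fun y => G₀ (gaps y)) x ≤
      G₀ (gaps x) - rateBound m a b / holdRate m a b x := by
    intro x hx
    have h1 : G₀ (gaps x) + gen (gapRate m a b) gapTo G₀ (gaps x) / rateBound m a b ≤
        G₀ (gaps x) - 1 := by
      have h2 : gapOp m a b G₀ (gaps x) ≤ G₀ (gaps x) - 1 := by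
        rw [show G₀ (gaps x) = G (gaps x) from if_neg hx]
        convert hG (gaps x)
      exact h2
    have h4 : gen (gapRate m a b) gapTo G₀ (gaps x) ≤ -rateBound m a b := by
      have h5 : gen (gapRate m a b) gapTo G₀ (gaps x) / rateBound m a b ≤ -1 := by linarith
      rw [div_le_iff₀ hΛ] at h5
      linarith
    unfold jumpOp
    rw [stepOp_apply, gen_comp_gaps]
    have h6 := div_le_div_of_nonneg_right h4 (holdRate_pos m a b x).le
    rw [neg_div] at h6
    linarith
  have hcomp : ∀ (c : ℝ) (x : Config n), 0 ≤ c → gaps x ≠ 0 →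
      c ≤ rateBound m a b / holdRate m a b x →
      ENNReal.ofReal c + ENNReal.ofReal (jumpOp m a b (fun y => G₀ (gaps y)) x) ≤
        ENNReal.ofReal (G₀ (gaps x)) := by
    intro c x hc hx hcx
    rw [← ENNReal.ofReal_add hc (hJ.nonneg _ hGx0 x)]
    exact ENNReal.ofReal_le_ofReal (by linarith [hdrift x hx])
  have hsteps : ∀ x, ∫⁻ ω, ⨆ N, occ (fun _ => 1) 0 N ω ∂law m a b x ≤
      ENNReal.ofReal (G₀ (gaps x)) := by
    refine lintegral_iSup_occ_le m a b measurable_const 0 hGx0 fun x hx => ?_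
    have := isProbabilityMeasure_expMeasure (holdRate_pos m a b x)
    have h1 := hcomp 1 x zero_le_one hx
      ((one_le_div (holdRate_pos m a b x)).2 (holdRate_le_rateBound m a b x))
    simpa using h1
  have htime : ∀ x, ∫⁻ ω, ⨆ N, occ holdWeight 0 N ω ∂law m a b x ≤
      ENNReal.ofReal (G₀ (gaps x)) := by
    refine lintegral_iSup_occ_le m a b measurable_holdWeight 0 hGx0 fun x hx => ?_
    have hq := holdRate_pos m a b x
    have h1 := hcomp (1 / holdRate m a b x) x (by positivity) hx (by gcongr)
    rw [← lintegral_ofReal_expMeasure hq] at h1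
    exact h1
  have hhit : ∀ x : Config n, ∀ᵐ ω ∂law m a b x, ∃ k, gaps (ω k).1 = 0 := by
    intro x
    have h1 := ae_lt_top (Measurable.iSup fun N => measurable_occ measurable_const 0 N)
      ((hsteps x).trans_lt ENNReal.ofReal_lt_top).ne
    filter_upwards [h1] with ω hω using exists_hit_of_iSup_occ_lt_top hω
  refine ⟨0, fun x hx => Or.inr ?_, fun x => ?_⟩
  -- Zero gaps are not absorbing, because some end particle has a positive inward rate. Hence the
  -- first jump of the path is a jump of `eta`.
  · have hT : totalRate m a b x ≠ 0 := by
      intro h0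
      have h1 := rates_eq_zero_of_totalRate_eq_zero m a b hm h0
      rcases exists_inward_rate m a b hm hn hst with h | h
      · exact h.ne' (h1 0).2
      · exact h.ne' (h1 (Fin.last n)).1
    have htail : ∀ᵐ ω ∂law m a b x, ∃ k, gaps (tail ω k).1 = 0 := by
      refine ae_law m a b (p := fun ω => ∃ k, gaps (tail ω k).1 = 0) ?_ x
        (Filter.Eventually.of_forall fun s => Filter.Eventually.of_forall fun y => hhit y)
      have h1 : {ω : Path n | ∃ k, gaps (tail ω k).1 = 0} =
          ⋃ k : ℕ, (fun ω : Path n => (ω (k + 1)).1) ⁻¹' {y | gaps y = 0} := by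
        ext ω; simp [tail]
      rw [h1]
      exact MeasurableSet.iUnion fun k =>
        (by fun_prop : Measurable fun ω : Path n => (ω (k + 1)).1) (Set.to_countable _).measurableSet
    have hle : ∫⁻ ω, returnTime 0 ω ∂law m a b x ≤
        ∫⁻ ω, (ENNReal.ofReal (ω 0).2 + ⨆ N, occ holdWeight 0 N (tail ω)) ∂law m a b x := by
      refine lintegral_mono_ae ?_
      filter_upwards [ae_hold_pos m a b x, ae_entry_zero m a b x, ae_entry_one m a b hn hT, htail]
        with ω h1 h2 h3 h4
      refine returnTime_le h1 (by rw [h2, hx]) (by rw [← hx]; exact h3) h4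
    refine hle.trans_lt ?_
    have hmeas : Measurable fun ω : Path n => ⨆ N, occ holdWeight 0 N ω :=
      Measurable.iSup fun N => measurable_occ measurable_holdWeight 0 N
    have := isProbabilityMeasure_expMeasure (holdRate_pos m a b x)
    have hmeas' : Measurable fun ω : Path n =>
        ENNReal.ofReal (ω 0).2 + ⨆ N, occ holdWeight 0 N (tail ω) :=
      (by fun_prop : Measurable fun ω : Path n => ENNReal.ofReal (ω 0).2).add
        (hmeas.comp measurable_tail)
    rw [lintegral_law m a b x hmeas']
    have h5 : ∀ s (ω : Path n), tail (cons (x, s) ω) = ω := fun s ω => rfl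
    simp only [h5, cons_zero]
    simp_rw [lintegral_add_left measurable_const, lintegral_const, measure_univ, mul_one]
    simp_rw [lintegral_add_left measurable_const, lintegral_const, measure_univ, mul_one]
    rw [lintegral_add_right _ measurable_const, lintegral_const, measure_univ, mul_one,
      lintegral_ofReal_expMeasure (holdRate_pos m a b x)]
    refine ENNReal.add_lt_top.2 ⟨ENNReal.ofReal_lt_top, ?_⟩
    refine (lintegral_mono fun y => htime y).trans_lt ?_
    rw [lintegral_jumpLaw m a b hGx0]
    exact ENNReal.ofReal_lt_top
  · filter_upwards [hhit x, ae_hold_pos m a b x] with ω ⟨k, hk⟩ hpos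
    obtain ⟨t, -, ht⟩ := exists_eta_eq hpos k
    exact ⟨t, ht.trans hk⟩

end Hitting

/-! ### Necessity of the stability condition -/

section Converse

variable {n : ℕ} (m a b : Fin (n + 1) → ℝ≥0)

theorem jumpOp_apply_le_of_le {f g : Config n → ℝ} {x : Config n} (hx : f x ≤ g x)
    (h : ∀ q, jumpRate m a b q x ≠ 0 → f (jumpTo q x) ≤ g (jumpTo q x)) :
    jumpOp m a b f x ≤ jumpOp m a b g x := by
  have hq := holdRate_pos m a b x
  have h1 : (∑ q, jumpRate m a b q x) / holdRate m a b x ≤ 1 := by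
    rw [sum_jumpRate, div_le_one hq]
    exact totalRate_le_holdRate m a b x
  unfold jumpOp
  rw [stepOp_eq, stepOp_eq]
  refine add_le_add (mul_le_mul_of_nonneg_left hx (by linarith)) (Finset.sum_le_sum fun q _ => ?_)
  by_cases h0 : jumpRate m a b q x = 0
  · simp [h0]
  · exact mul_le_mul_of_nonneg_left (h q h0) (div_nonneg (jumpRate_nonneg m a b q x) hq.le)

open Classical in
/-- Probability that the jump chain avoids `d` up to and including its `i`-th step. -/
def avoid (d : Gaps n) : ℕ → Config n → ℝ
  | 0 => fun y => if gaps y = d then 0 else 1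
  | i + 1 => fun y => if gaps y = d then 0 else jumpOp m a b (avoid d i) y

theorem avoid_of_eq {d : Gaps n} (i : ℕ) {y : Config n} (h : gaps y = d) :
    avoid m a b d i y = 0 := by
  cases i <;> simp [avoid, h]

theorem avoid_nonneg (d : Gaps n) (i : ℕ) : 0 ≤ avoid m a b d i := by
  induction i with
  | zero =>
    intro y
    simp only [avoid]
    split_ifs <;> simp
  | succ i ih =>
    intro y
    simp only [avoid]
    split_ifs
    · exact le_rfl
    · exact (isMarkovOp_jumpOp m a b).nonneg _ ih y

/-- Each configuration visited before `d` is held for a mean time of at least `1 / Λ`. -/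
theorem sum_avoid_le_lintegral_occ (d : Gaps n) (N : ℕ) (y : Config n) :
    ENNReal.ofReal (∑ i ∈ Finset.range N, (rateBound m a b : ℝ)⁻¹ * avoid m a b d i y) ≤
      ∫⁻ ω, occ holdWeight d N ω ∂law m a b y := by
  have hΛ := rateBound_pos m a b
  have hnn : ∀ N, (0 : Config n → ℝ) ≤
      ∑ i ∈ Finset.range N, (rateBound m a b : ℝ)⁻¹ • avoid m a b d i := fun N =>
    Finset.sum_nonneg fun i _ => smul_nonneg (by positivity) (avoid_nonneg m a b d i)
  induction N generalizing y with
  | zero => simp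
  | succ N ih =>
    by_cases hy : gaps y = d
    · simp [avoid_of_eq m a b _ hy]
    · have hq := holdRate_pos m a b y
      rw [lintegral_occ_succ m a b measurable_holdWeight d N hy]
      have h1 : ∑ i ∈ Finset.range (N + 1), (rateBound m a b : ℝ)⁻¹ * avoid m a b d i y =
          (rateBound m a b : ℝ)⁻¹ + jumpOp m a b
            (∑ i ∈ Finset.range N, (rateBound m a b : ℝ)⁻¹ • avoid m a b d i) y := by
        rw [Finset.sum_range_succ', add_comm, map_sum, Finset.sum_apply]
        simp [avoid, hy]
      rw [h1, ENNReal.ofReal_add (by positivity)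
        ((isMarkovOp_jumpOp m a b).nonneg _ (hnn N) y)]
      refine add_le_add ?_ ?_
      · have h2 := lintegral_ofReal_expMeasure hq
        change _ ≤ ∫⁻ s, ENNReal.ofReal s ∂expMeasure (holdRate m a b y)
        rw [h2, one_div]
        exact ENNReal.ofReal_le_ofReal (inv_anti₀ hq (holdRate_le_rateBound m a b y))
      · rw [← lintegral_jumpLaw m a b (hnn N)]
        refine lintegral_mono fun z => ?_
        convert ih z using 2
        simp

/-- A submartingale with bounded jumps that vanishes at `d` bounds the avoidance probabilities
from below. -/
theorem le_mul_avoid {d : Gaps n} {ψ : Config n → ℝ} {D : ℝ} (hD : 0 ≤ D)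
    (h0 : ∀ y, gaps y = d → ψ y = 0) (hsub : ∀ y, ψ y ≤ jumpOp m a b ψ y)
    (hstep : ∀ y q, jumpRate m a b q y ≠ 0 → ψ (jumpTo q y) ≤ ψ y + D) (i : ℕ) (y : Config n) :
    ψ y ≤ (ψ y + D * i) * avoid m a b d i y := by
  induction i generalizing y with
  | zero =>
    by_cases hy : gaps y = d
    · simp [h0 y hy]
    · simp [avoid, hy]
  | succ i ih =>
    by_cases hy : gaps y = d
    · simp [h0 y hy, avoid_of_eq m a b _ hy]
    -- One step raises `ψ` by at most `D`, so the coefficient of the induction hypothesis at every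
    -- target is at most `ψ y + D * (i + 1)`. This no longer depends on the target and can be taken
    -- out of the operator.
    · have h1 : jumpOp m a b ψ y ≤ jumpOp m a b ((ψ y + D * (i + 1)) • avoid m a b d i) y := by
        refine jumpOp_apply_le_of_le m a b ?_ fun q hq => ?_
        · refine (ih y).trans (mul_le_mul_of_nonneg_right ?_ (avoid_nonneg m a b d i y))
          nlinarith
        · refine (ih _).trans (mul_le_mul_of_nonneg_right ?_ (avoid_nonneg m a b d i _))
          linarith [hstep y q hq]
      refine (hsub y).trans (h1.trans ?_)
      simp [avoid, hy]

/-- If the mean occupation before hitting `d` is finite, the submartingale is nonpositive. -/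
theorem nonpos_of_lintegral_occ_le {d : Gaps n} {ψ : Config n → ℝ} {D : ℝ} (hD : 0 ≤ D)
    (h0 : ∀ y, gaps y = d → ψ y = 0) (hsub : ∀ y, ψ y ≤ jumpOp m a b ψ y)
    (hstep : ∀ y q, jumpRate m a b q y ≠ 0 → ψ (jumpTo q y) ≤ ψ y + D) {y : Config n} {K : ℝ≥0∞}
    (hK : K ≠ ∞) (hocc : ∀ N, ∫⁻ ω, occ holdWeight d N ω ∂law m a b y ≤ K) : ψ y ≤ 0 := by
  by_contra! hpos
  have hΛ := rateBound_pos m a b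
  -- The avoidance probability is at least `ψ y / (ψ y + D * i)`, hence at least `(ψ y / (ψ y + D))
  -- / (i + 1)`, and the harmonic series contradicts the finite mean occupation.
  set c := (rateBound m a b : ℝ)⁻¹ * (ψ y / (ψ y + D)) with hc
  have hcpos : 0 < c := by positivity
  have h1 : ∀ i : ℕ, c * (1 / ((i : ℝ) + 1)) ≤ (rateBound m a b : ℝ)⁻¹ * avoid m a b d i y := by
    intro i
    rw [hc, mul_assoc]
    refine mul_le_mul_of_nonneg_left ?_ (by positivity)
    rw [div_mul_div_comm, mul_one, div_le_iff₀ (by positivity)]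
    refine (le_mul_avoid m a b hD h0 hsub hstep i y).trans ?_
    rw [mul_comm]
    refine mul_le_mul_of_nonneg_left ?_ (avoid_nonneg m a b d i y)
    have : 0 ≤ ψ y * i := by positivity
    nlinarith
  have h2 : ∀ N : ℕ, c * ∑ i ∈ Finset.range N, 1 / ((i : ℝ) + 1) ≤ K.toReal := by
    intro N
    rw [Finset.mul_sum]
    refine (Finset.sum_le_sum fun i _ => h1 i).trans ?_
    exact (ENNReal.ofReal_le_iff_le_toReal hK).1
      ((sum_avoid_le_lintegral_occ m a b d N y).trans (hocc N))
  obtain ⟨N, hN⟩ := (Real.tendsto_sum_range_one_div_nat_succ_atTop.eventually_gt_atTop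
    (K.toReal / c)).exists
  rw [div_lt_iff₀' hcpos] at hN
  exact absurd (h2 N) (not_le.2 hN)

/-- The jump `q` is the first one with positive probability, so the mean occupation from its target
is at most the mean return time divided by this probability. -/
theorem lintegral_occ_jumpTo_le {x : Config n} (q : Fin (n + 1) × Bool)
    (hq : jumpRate m a b q x ≠ 0) (hret : ∫⁻ ω, returnTime (gaps x) ω ∂law m a b x < ∞) :
    ∃ K : ℝ≥0∞, K ≠ ∞ ∧
      ∀ N, ∫⁻ ω, occ holdWeight (gaps x) N ω ∂law m a b (jumpTo q x) ≤ K := by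
  have hT : totalRate m a b x ≠ 0 := by
    intro h0
    have h1 := sum_jumpRate m a b x
    rw [h0, NNReal.coe_zero] at h1
    exact hq ((Finset.sum_eq_zero_iff_of_nonneg fun q _ => jumpRate_nonneg m a b q x).1 h1 q
      (Finset.mem_univ q))
  set R := ∫⁻ ω, returnTime (gaps x) ω ∂law m a b x with hR
  set c := ENNReal.ofReal (jumpRate m a b q x / totalRate m a b x) with hc
  have hc0 : c ≠ 0 := by
    have h1 : 0 < jumpRate m a b q x := lt_of_le_of_ne (jumpRate_nonneg m a b q x) hq.symm
    have h2 : (0 : ℝ) < totalRate m a b x := by exact_mod_cast pos_iff_ne_zero.2 hT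
    rw [hc]
    exact (ENNReal.ofReal_pos.2 (div_pos h1 h2)).ne'
  refine ⟨R / c, (ENNReal.div_lt_top hret.ne hc0).ne, fun N => ?_⟩
  rw [ENNReal.le_div_iff_mul_le (Or.inl hc0) (Or.inl ENNReal.ofReal_ne_top), mul_comm]
  have := isProbabilityMeasure_expMeasure (holdRate_pos m a b x)
  calc c * ∫⁻ ω, occ holdWeight (gaps x) N ω ∂law m a b (jumpTo q x)
      ≤ ∫⁻ y, ∫⁻ ω, occ holdWeight (gaps x) N ω ∂law m a b y ∂jumpLaw m a b x := by
        rw [lintegral_jumpLaw_eq_sum m a b hT]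
        exact Finset.single_le_sum (f := fun q => ENNReal.ofReal (jumpRate m a b q x /
          totalRate m a b x) * ∫⁻ ω, occ holdWeight (gaps x) N ω ∂law m a b (jumpTo q x))
          (fun _ _ => zero_le) (Finset.mem_univ q)
    _ = ∫⁻ ω, occ holdWeight (gaps x) N (tail ω) ∂law m a b x := by
        have hmeas : Measurable fun ω : Path n => occ holdWeight (gaps x) N (tail ω) :=
          (measurable_occ measurable_holdWeight _ N).comp measurable_tail
        rw [lintegral_law m a b x hmeas]
        have h5 : ∀ s (ω : Path n), tail (cons (x, s) ω) = ω := fun s ω => rfl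
        simp only [h5, lintegral_const, measure_univ, mul_one]
    _ ≤ R := by
        refine lintegral_mono_ae ?_
        filter_upwards [ae_hold_pos m a b x, ae_entry_zero m a b x] with ω h1 h2
        exact occ_tail_le_returnTime h1 (by rw [h2]) N

theorem escape_jumpTo_le {k : ℕ} {q : Fin (n + 1) × Bool} {x : Config n}
    (h : jumpRate m a b q x ≠ 0) :
    escape m k (jumpTo q x) ≤ escape m k x + ∑ i, |escapeWeight m k i| := by
  have h1 := escape_jumpTo m a b (k := k) h
  have h2 : |escapeWeight m k q.1| ≤ ∑ i, |escapeWeight m k i| :=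
    Finset.single_le_sum (f := fun i => |escapeWeight m k i|) (fun _ _ => abs_nonneg _)
      (Finset.mem_univ q.1)
  have h3 : escapeWeight m k q.1 * (if q.2 then 1 else -1) ≤ |escapeWeight m k q.1| := by
    split_ifs
    · simpa using le_abs_self _
    · simpa using neg_le_abs _
  linarith

/-- Off the stability region, a state from which jumps are possible has infinite mean return
time. -/
theorem lintegral_returnTime_eq_top (hm : ∀ i, 0 < m i) {k : ℕ} (hk : 1 ≤ k) (hkn : k ≤ n)
    (hU : U m a b (n + 1) / M m (n + 1) ≤ U m a b k / M m k) {x : Config n}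
    (hT : totalRate m a b x ≠ 0) : ∫⁻ ω, returnTime (gaps x) ω ∂law m a b x = ∞ := by
  by_contra hret
  have hle : ∀ q, jumpRate m a b q x ≠ 0 → escape m k (jumpTo q x) - escape m k x ≤ 0 := by
    intro q hq
    obtain ⟨K, hK, hocc⟩ := lintegral_occ_jumpTo_le m a b q hq (lt_top_iff_ne_top.2 hret)
    refine nonpos_of_lintegral_occ_le m a b (d := gaps x)
      (ψ := fun y => escape m k y - escape m k x) (D := ∑ i, |escapeWeight m k i|)
      (Finset.sum_nonneg fun _ _ => abs_nonneg _) (fun y hy => ?_) (fun y => ?_)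
      (fun y q hq => ?_) hK hocc
    · rw [eq_shift_of_gaps_eq hy.symm, escape_shift m hm, sub_self]
    · unfold jumpOp
      rw [stepOp_apply, gen_apply]
      simp only [sub_sub_sub_cancel_right]
      rw [← gen_apply]
      have := div_nonneg (gen_escape_nonneg m a b hm hk hkn hU y) (holdRate_pos m a b y).le
      linarith
    · have := escape_jumpTo_le m a b (k := k) hq
      linarith
  have hterm : ∀ q, jumpRate m a b q x * (escape m k (jumpTo q x) - escape m k x) ≤ 0 := by
    intro q
    by_cases hq : jumpRate m a b q x = 0
    · simp [hq]
    · exact mul_nonpos_of_nonneg_of_nonpos (jumpRate_nonneg m a b q x) (hle q hq)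
  have hsum : ∑ q, jumpRate m a b q x * (escape m k (jumpTo q x) - escape m k x) = 0 :=
    le_antisymm (Finset.sum_nonpos fun q _ => hterm q)
      (by rw [← gen_apply]; exact gen_escape_nonneg m a b hm hk hkn hU x)
  -- Nonpositive terms with nonnegative sum all vanish, while an actual jump changes `escape` by a
  -- nonzero weight.
  have hzero : ∀ q, jumpRate m a b q x = 0 := by
    intro q
    by_contra hq
    have h1 := (Finset.sum_eq_zero_iff_of_nonpos fun q _ => hterm q).1 hsum q (Finset.mem_univ q)
    rw [escape_jumpTo m a b hq] at h1
    have h2 := escapeWeight_ne_zero m hm hk hkn q.1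
    have h3 : (if q.2 then (1 : ℝ) else -1) ≠ 0 := by split_ifs <;> norm_num
    exact (mul_ne_zero hq (mul_ne_zero h2 h3)) h1
  have h4 := sum_jumpRate m a b x
  simp only [hzero, Finset.sum_const_zero] at h4
  exact hT (by exact_mod_cast h4.symm)

theorem totalRate_eq_zero_of_rates_eq_zero (h : ∀ i, a i = 0 ∧ b i = 0) (x : Config n) :
    totalRate m a b x = 0 := by
  simp [totalRate, leftRate, rightRate, h]

/-- Positive recurrence implies the stability condition. -/
theorem stabilityCondition_of_isPositiveRecurrent (hm : ∀ i, 0 < m i)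
    (h : IsPositiveRecurrent m a b) : StabilityCondition m a b := by
  intro k hk hkn
  by_contra! hU
  obtain ⟨d, hd, hhit⟩ := h
  have hn : 0 < n := by omega
  by_cases hT : totalRate m a b (place d) = 0
  -- A frozen state means that all intrinsic rates are zero, so the chain never leaves its initial
  -- state, and the gaps `d + 1` never become `d`.
  · have h0 := totalRate_eq_zero_of_rates_eq_zero m a b
      (rates_eq_zero_of_totalRate_eq_zero m a b hm hT)
    set x : Config n := place (d + 1) with hx
    have hmem := ae_law_mem m a b (A := {x}) (fun y hy => by
      rw [jumpLaw, if_pos (h0 y), ae_dirac_eq]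
      exact hy) (Set.mem_singleton x)
    obtain ⟨ω, h1, t, h2⟩ := (hmem.and (hhit x)).exists
    have h3 : X t ω = x := (h1 _).1
    rw [eta, h3, hx, gaps_place] at h2
    have h4 := congrFun h2 ⟨0, hn⟩
    simp at h4
  · rcases hd (place d) (gaps_place d) with habs | hret
    · obtain ⟨ω, h1, h2, h3⟩ := (habs.and ((ae_hold_pos m a b _).and
        (ae_entry_one m a b hn hT))).exists
      obtain ⟨t, -, ht⟩ := exists_eta_eq h2 1
      rw [gaps_place, ← ht] at h3
      exact h3 (h1 t)
    · have h1 := lintegral_returnTime_eq_top m a b hm hk hkn hU hT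
      rw [gaps_place] at h1
      exact hret.ne h1

end Converse

/-! ### The stationary distribution -/

section Stationary

variable {n : ℕ} (m a b : Fin (n + 1) → ℝ≥0)

theorem measurable_gaps : Measurable (gaps : Config n → Gaps n) := measurable_of_countable _

theorem law_eta (B : Set (Gaps n)) (t : ℝ≥0) (x : Config n) :
    law m a b x {ω | eta t ω ∈ B} = ENNReal.ofReal (gapProb m a b B t (gaps x)) := by
  rw [← law_real_eta, ofReal_measureReal]

/-- Stationarity in terms of the semigroup of the chain of gaps. -/
theorem isStationary_iff {π : Measure (Gaps n)} : IsStationary m a b π ↔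
    IsProbabilityMeasure π ∧ ∀ (t : ℝ≥0) (B : Set (Gaps n)),
      ∫⁻ d, ENNReal.ofReal (gapProb m a b B t d) ∂π = π B := by
  have key : ∀ (μ : Measure (Config n)) (t : ℝ≥0) (B : Set (Gaps n)),
      ∫⁻ x, law m a b x {ω | eta t ω ∈ B} ∂μ =
        ∫⁻ d, ENNReal.ofReal (gapProb m a b B t d) ∂μ.map gaps := by
    intro μ t B
    rw [lintegral_map (measurable_of_countable _) measurable_gaps]
    simp_rw [law_eta]
  refine and_congr_right fun hπ => ⟨fun h t B => ?_, fun h μ _ hμ t B => ?_⟩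
  -- Each law of the gaps is lifted to configurations by putting the first particle at the origin.
  · have hplace : Measurable (place : Gaps n → Config n) := measurable_of_countable _
    have h1 : (π.map place).map gaps = π := by
      rw [Measure.map_map measurable_gaps hplace,
        show gaps ∘ place = (id : Gaps n → Gaps n) from funext gaps_place, Measure.map_id]
    have h2 := h _ (Measure.isProbabilityMeasure_map hplace.aemeasurable) h1 t B
    rwa [key, h1] at h2
  · rw [key, hμ, h]

/-- The measure with given weights at the points. -/
def weightMeasure (p : Gaps n → ℝ) : Measure (Gaps n) :=
  Measure.sum fun d => ENNReal.ofReal (p d) • Measure.dirac d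

theorem lintegral_weightMeasure {p g : Gaps n → ℝ} (hp : 0 ≤ p) (hg : 0 ≤ g)
    (hs : Summable fun d => p d * g d) :
    ∫⁻ d, ENNReal.ofReal (g d) ∂weightMeasure p = ENNReal.ofReal (∑' d, p d * g d) := by
  rw [ENNReal.ofReal_tsum_of_nonneg (fun d => mul_nonneg (hp d) (hg d)) hs, weightMeasure,
    lintegral_sum_measure]
  refine tsum_congr fun d => ?_
  rw [lintegral_smul_measure, lintegral_dirac, smul_eq_mul, ENNReal.ofReal_mul (hp d)]

theorem summable_mul_of_abs_le_one {p g : Gaps n → ℝ} (hp : 0 ≤ p) (hs : Summable p)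
    (hg : ∀ d, |g d| ≤ 1) : Summable fun d => p d * g d :=
  hs.of_norm_bounded fun d => by
    rw [Real.norm_eq_abs, abs_mul, abs_of_nonneg (hp d)]
    exact mul_le_of_le_one_right (hp d) (hg d)

theorem weightMeasure_apply {p : Gaps n → ℝ} (hp : 0 ≤ p) (hs : Summable p) (B : Set (Gaps n)) :
    weightMeasure p B = ENNReal.ofReal (∑' d, p d * gapInd B d) := by
  rw [← lintegral_weightMeasure hp (gapInd_nonneg B)
    (summable_mul_of_abs_le_one hp hs (abs_gapInd_le B)),
    ← lintegral_indicator_one (Set.to_countable B).measurableSet]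
  refine lintegral_congr fun d => ?_
  classical
  unfold gapInd
  rw [Set.indicator_apply, Set.indicator_apply]
  split_ifs <;> simp

open Filter Topology in
/-- Under the stability condition the chain of gaps has a unique stationary distribution, it
converges to it exponentially fast, and this distribution has exponential tails. -/
theorem exists_stationary_of_stabilityCondition (hm : ∀ i, 0 < m i)
    (hst : StabilityCondition m a b) :
    ∃ π : Measure (Gaps n), IsStationary m a b π ∧
      (∀ π' : Measure (Gaps n), IsStationary m a b π' → π' = π) ∧
      ConvergesGeometrically m a b π ∧ HasExponentialMoment π := by
  obtain ⟨V, δ, hδ, hV, hexp⟩ := exists_isGeomStable m a b hm hst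
  obtain ⟨p, c, ρ, hp0, hp1, hpV, hc, hρ, hρ1, hconv⟩ := hV.exists_stationary_weights
  have hP := isMarkovOp_gapOp m a b
  have hΛ := rateBound_pos m a b
  have hps := hp1.summable
  have hinv : ∀ f : Gaps n → ℝ, (∀ x, |f x| ≤ 1) →
      ∑' y, p y * gapOp m a b f y = ∑' y, p y * f y := fun f hf =>
    IsGeomStable.tsum_apply_eq hP hρ hρ1 0 hconv hf
  have hrate : 0 < rateBound m a b * (1 - ρ) := mul_pos hΛ (by linarith)
  have hlim : ∀ (B : Set (Gaps n)) (t : ℝ≥0) (d : Gaps n),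
      |gapProb m a b B t d - ∑' y, p y * gapInd B y| ≤
        c * (1 + V d) * Real.exp (-(rateBound m a b * (1 - ρ)) * t) := by
    intro B t d
    refine hP.abs_unif_sub_le (abs_gapInd_le B) (fun k => ?_) (mul_nonneg hΛ.le t.coe_nonneg)
    refine (hconv _ (abs_gapInd_le B) k d).trans_eq ?_
    ring
  have hsum0 : ∀ B : Set (Gaps n), 0 ≤ ∑' y, p y * gapInd B y := fun B =>
    tsum_nonneg fun y => mul_nonneg (hp0 y) (gapInd_nonneg B y)
  refine ⟨weightMeasure p, ?_, fun π' hπ' => ?_, ⟨_, hrate, fun x => ⟨c * (1 + V (gaps x)),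
    fun t B => ?_⟩⟩, δ, hδ, ?_⟩
  · refine (isStationary_iff m a b).2 ⟨⟨?_⟩, fun t B => ?_⟩
    · rw [weightMeasure_apply hp0 hps]
      simp [gapInd, hp1.tsum_eq]
    · rw [lintegral_weightMeasure hp0 (fun d => gapProb_nonneg m a b B t.coe_nonneg d)
        (summable_mul_of_abs_le_one hp0 hps fun d => abs_gapProb_le m a b B t.coe_nonneg d),
        weightMeasure_apply hp0 hps]
      congr 1
      exact hP.tsum_unif hp0 hps hinv (abs_gapInd_le B) t
  -- Uniqueness: averaged over a stationary law, the semigroup is constant in time, while it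
  -- converges pointwise to the weight of `B`; dominated convergence identifies the two.
  · obtain ⟨hprob, hstat⟩ := (isStationary_iff m a b).1 hπ'
    ext B -
    rw [weightMeasure_apply hp0 hps]
    have h1 : Tendsto (fun k : ℕ => ∫⁻ d, ENNReal.ofReal (gapProb m a b B (k : ℝ≥0) d) ∂π') atTop
        (𝓝 (∫⁻ _, ENNReal.ofReal (∑' y, p y * gapInd B y) ∂π')) := by
      refine tendsto_lintegral_of_dominated_convergence (fun _ => 1)
        (fun k => measurable_of_countable _) (fun k => ae_of_all _ fun d => ?_) (by simp)
        (ae_of_all _ fun d => ENNReal.tendsto_ofReal ?_)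
      · rw [← ENNReal.ofReal_one]
        exact ENNReal.ofReal_le_ofReal
          ((le_abs_self _).trans (abs_gapProb_le m a b B (NNReal.coe_nonneg _) d))
      · rw [tendsto_iff_norm_sub_tendsto_zero]
        refine squeeze_zero (fun _ => norm_nonneg _) (fun k => hlim B k d) ?_
        have h2 : Tendsto (fun k : ℕ => -(rateBound m a b * (1 - ρ)) * ((k : ℝ≥0) : ℝ)) atTop
            atBot := by
          simp only [NNReal.coe_natCast]
          exact tendsto_natCast_atTop_atTop.const_mul_atTop_of_neg (by linarith)
        simpa using (Real.tendsto_exp_atBot.comp h2).const_mul (c * (1 + V d))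
    simp only [hstat, lintegral_const, measure_univ, mul_one] at h1
    exact tendsto_nhds_unique tendsto_const_nhds h1
  · rw [law_real_eta, measureReal_def, weightMeasure_apply hp0 hps, ENNReal.toReal_ofReal (hsum0 B)]
    exact hlim B t (gaps x)
  · have h1 : Summable fun d => p d * V d := hpV
    have h2 : Summable fun d => p d * Real.exp (δ * ∑ i : Fin n, (d i : ℝ)) :=
      h1.of_nonneg_of_le (fun d => mul_nonneg (hp0 d) (Real.exp_nonneg _))
        fun d => mul_le_mul_of_nonneg_left (hexp d) (hp0 d)
    rw [lintegral_weightMeasure hp0 (fun d => Real.exp_nonneg _) h2]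
    exact ENNReal.ofReal_lt_top

end Stationary

end ElasticParticles

end

open ElasticParticles in
theorem corollary1 (n : ℕ) (m a b : Fin (n + 1) → ℝ≥0) (hm : ∀ i, 0 < m i) :
    (IsPositiveRecurrent m a b ↔ StabilityCondition m a b) ∧
    (IsPositiveRecurrent m a b →
      ∃ π : MeasureTheory.Measure (Gaps n), IsStationary m a b π ∧
        (∀ π' : MeasureTheory.Measure (Gaps n), IsStationary m a b π' → π' = π) ∧
        ConvergesGeometrically m a b π ∧ HasExponentialMoment π) :=
  ⟨⟨stabilityCondition_of_isPositiveRecurrent m a b hm,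
    isPositiveRecurrent_of_stabilityCondition m a b hm⟩, fun h =>
    exists_stationary_of_stabilityCondition m a b hm
      (stabilityCondition_of_isPositiveRecurrent m a b hm h)⟩
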